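/- Let $k$ be an algebraically closed field and $n\ge 0$. For $\mathbf d=(\mathbf d(1),\dots,\mathbf d(n))\in\mathbb N^n$ let $V=\bigoplus_{i=1}^n k^{\mathbf d(i)}$ and let $\Lambda(\mathbf d)$ be the nilpotent variety of pairs $(T_+,T_-)$ of commuting linear endomorphisms of $V$, homogeneous of degrees $1$ and $-1$ respectively, with the Zariski topology. Its points are the modules of graded dimension $\mathbf d$ over the preprojective algebra $\Pi$ of type $A_n$. Let $\mathrm{Comp}$ be the set of all irreducible components of all $\Lambda(\mathbf d)$, $\mathbf d\in\mathbb N^n$. A module $x$ is rigid if $\mathrm{Ext}^1_\Pi(x,x)=0$. For $C_i\in\mathrm{Comp}$, $C_i\subset\Lambda(\mathbf d_i)$, $i=1,2$, let $C_1*C_2\subset\Lambda(\mathbf d_1+\mathbf d_2)$ be the Zariski closure of the set of all $x$ that fit in a short exact sequence $0\to x_2\to x\to x_1\to 0$ of $\Pi$-modules with $(x_1,x_2)\in C_1\times C_2$ and $\dim\mathrm{Ext}^1_\Pi(x_1,x_2)$ minimal among all pairs in $C_1\times C_2$. Fix a segment $\Delta=[a,b]$, $1\le a\le b\le n$, and let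 $\sigma$ be one of the two labels $Z(\Delta)$, $L(\Delta)$. Let $\mathbf d_\Delta$ be the indicator function of $\Delta$. The basic component $C_\sigma\subset\Lambda(\mathbf d_\Delta)$ is the Zariski closure of the set of all $(T_+,T_-)$ such that $T_+$ (if $\sigma=Z(\Delta)$), respectively $T_-$ (if $\sigma=L(\Delta)$), is conjugate, by a degree-preserving automorphism, to a single Jordan block, i.e. to the shift taking the basis vector of degree $i$ to the one of degree $i+1$ (respectively $i-1$), or to $0$ if there is none. The component $C_\sigma$ contains a rigid module $x_\sigma$, which is unique up to isomorphism. A component $C\in\mathrm{Comp}$ is called $\sigma$-saturated if it contains a module $x$ such that $\mathrm{Hom}_\Pi(x',x_\sigma)\ne 0$ for every nonzero submodule $x'$ of $x$ (these $x$ are exactly the direct sums of submodules of $x_\sigma$). It is called $\sigma$-reduced if $$\hom_\Pi(C,C_\sigma):=\min_{(x,y)\in C\times C_\sigma}\dim\mathrm{Hom}_\Pi(x,y)=0.$$ Then every $C\in\mathrm{Comp}$ can be written as $C=C_1*C_2$ for exactly one pair $(C_1,C_2)$ of elements of $\mathrm{Comp}$ such that $C_1$ is $\sigma$-saturated and $C_2$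 is $\sigma$-reduced. -/

import Mathlib

namespace TypeA

variable {n : ℕ}

/-- The index set of the standard homogeneous basis of the graded vector space
`V = ⨁ i, k ^ (d i)` of graded dimension `d`; the basis vector `⟨i, _⟩` has degree `i`. -/
abbrev Idx (d : Fin n → ℕ) : Type := Σ i : Fin n, Fin (d i)

/-- Matrices of the linear maps `V → W` that are homogeneous of degree `r`, where `V` and `W`
have graded dimensions `d` and `e` (columns are indexed by the source, rows by the target). -/
def homogeneous (k : Type*) [Field k] (d e : Fin n → ℕ) (r : ℤ) :
    Submodule k (Matrix (Idx e) (Idx d) k) where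
  carrier := {F | ∀ a b, ((a.1 : ℕ) : ℤ) ≠ ((b.1 : ℕ) : ℤ) + r → F a b = 0}
  add_mem' := by
    intro F G hF hG a b h
    simp [hF a b h, hG a b h]
  zero_mem' := by
    intro a b _
    rfl
  smul_mem' := by
    intro c F hF a b h
    simp [hF a b h]

/-- The nilpotent variety `Λ(d)` of type `A_n`: pairs `(T₊, T₋)` of commuting endomorphisms, of
degrees `1` and `-1`, of the graded vector space of graded dimension `d`. Its points are the
modules over the preprojective algebra `Π` with underlying space `V = ⨁ i, k ^ (d i)`; every
finite-dimensional `Π`-module is isomorphic to such a point, for exactly one `d`. -/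
@[ext] structure Lam (k : Type*) [Field k] (d : Fin n → ℕ) where
  Tp : Matrix (Idx d) (Idx d) k
  Tm : Matrix (Idx d) (Idx d) k
  Tp_mem : Tp ∈ homogeneous k d d 1
  Tm_mem : Tm ∈ homogeneous k d d (-1)
  comm : Tp * Tm = Tm * Tp

/-- The matrix entries of a point, as a point of affine space. -/
def Lam.coords {k : Type*} [Field k] {d : Fin n → ℕ} (x : Lam k d) :
    (Idx d × Idx d) ⊕ (Idx d × Idx d) → k :=
  Sum.elim (fun p => x.Tp p.1 p.2) (fun p => x.Tm p.1 p.2)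

/-- The Zariski topology on `Λ(d)`: the closed sets are the common zero sets of families of
polynomials in the matrix entries (see `isClosed_lam_iff`). -/
noncomputable instance zariski {k : Type*} [Field k] {d : Fin n → ℕ} : TopologicalSpace (Lam k d) :=
  TopologicalSpace.induced (fun x => MvPolynomial.pointToPoint (k := k) x.coords) inferInstance

theorem isClosed_lam_iff {k : Type*} [Field k] {d : Fin n → ℕ} (Z : Set (Lam k d)) :
    IsClosed Z ↔ ∃ S : Set (MvPolynomial ((Idx d × Idx d) ⊕ (Idx d × Idx d)) k),
      Z = {x | ∀ p ∈ S, MvPolynomial.eval x.coords p = 0} := by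
  have key : ∀ S : Set (MvPolynomial ((Idx d × Idx d) ⊕ (Idx d × Idx d)) k),
      (fun x : Lam k d => MvPolynomial.pointToPoint (k := k) x.coords) ⁻¹'
        PrimeSpectrum.zeroLocus S = {x | ∀ p ∈ S, MvPolynomial.eval x.coords p = 0} := by
    intro S
    ext x
    simp only [Set.mem_preimage, PrimeSpectrum.mem_zeroLocus, MvPolynomial.pointToPoint,
      Set.mem_ofPred_eq, Set.subset_def, SetLike.mem_coe, MvPolynomial.mem_vanishingIdeal_iff,
      Set.mem_singleton_iff, forall_eq, MvPolynomial.aeval_eq_eval]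
  refine isClosed_induced_iff.trans ?_
  constructor
  · rintro ⟨t, ht, rfl⟩
    obtain ⟨S, rfl⟩ := (PrimeSpectrum.isClosed_iff_zeroLocus t).1 ht
    exact ⟨S, key S⟩
  · rintro ⟨S, rfl⟩
    exact ⟨_, PrimeSpectrum.isClosed_zeroLocus S, key S⟩

section Modules

variable {k : Type*} [Field k] {d e : Fin n → ℕ}

/-- `Hom_Π(x, y)`: the homogeneous linear maps of degree `0` that commute with `T₊` and `T₋`. -/
def homSpace (x : Lam k d) (y : Lam k e) : Submodule k (Matrix (Idx e) (Idx d) k) where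
  carrier := {F | F ∈ homogeneous k d e 0 ∧ F * x.Tp = y.Tp * F ∧ F * x.Tm = y.Tm * F}
  add_mem' := by
    rintro F G ⟨hF, hFp, hFm⟩ ⟨hG, hGp, hGm⟩
    exact ⟨add_mem hF hG, by rw [Matrix.add_mul, Matrix.mul_add, hFp, hGp], by rw [Matrix.add_mul, Matrix.mul_add, hFm, hGm]⟩
  zero_mem' := ⟨zero_mem _, by simp, by simp⟩
  smul_mem' := by
    rintro c F ⟨hF, hFp, hFm⟩
    exact ⟨Submodule.smul_mem _ c hF, by rw [Matrix.smul_mul, Matrix.mul_smul, hFp],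
      by rw [Matrix.smul_mul, Matrix.mul_smul, hFm]⟩

/-- `dim Hom_Π(x, y)`. -/
noncomputable def homDim (x : Lam k d) (y : Lam k e) : ℕ := Module.finrank k (homSpace x y)

/-- The extensions of `x` by `y` (with `y` as submodule and `x` as quotient) on the graded vector
space `V ⊕ W`: the pairs `(A, B)` of maps `V → W` of degrees `1` and `-1` for which the block
triangular endomorphisms with diagonal blocks given by `x`, `y` and lower left blocks `A`, `B`
commute (see `mem_extCocycles_iff`). -/
def extCocycles (x : Lam k d) (y : Lam k e) :
    Submodule k (Matrix (Idx e) (Idx d) k × Matrix (Idx e) (Idx d) k) where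
  carrier := {P | P.1 ∈ homogeneous k d e 1 ∧ P.2 ∈ homogeneous k d e (-1) ∧
    y.Tp * P.2 + P.1 * x.Tm = y.Tm * P.1 + P.2 * x.Tp}
  add_mem' := by
    rintro P R ⟨hP1, hP2, hP⟩ ⟨hR1, hR2, hR⟩
    refine ⟨add_mem hP1 hR1, add_mem hP2 hR2, ?_⟩
    simp only [Prod.fst_add, Prod.snd_add, Matrix.mul_add, Matrix.add_mul]
    calc _ = (y.Tp * P.2 + P.1 * x.Tm) + (y.Tp * R.2 + R.1 * x.Tm) := by abel
      _ = (y.Tm * P.1 + P.2 * x.Tp) + (y.Tm * R.1 + R.2 * x.Tp) := by rw [hP, hR]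
      _ = _ := by abel
  zero_mem' := ⟨zero_mem _, zero_mem _, by simp⟩
  smul_mem' := by
    rintro c P ⟨hP1, hP2, hP⟩
    refine ⟨Submodule.smul_mem _ c hP1, Submodule.smul_mem _ c hP2, ?_⟩
    simp only [Prod.smul_fst, Prod.smul_snd, Matrix.mul_smul, Matrix.smul_mul, ← smul_add, hP]

theorem mem_extCocycles_iff (x : Lam k d) (y : Lam k e)
    (P : Matrix (Idx e) (Idx d) k × Matrix (Idx e) (Idx d) k) :
    P ∈ extCocycles x y ↔ P.1 ∈ homogeneous k d e 1 ∧ P.2 ∈ homogeneous k d e (-1) ∧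
      Matrix.fromBlocks x.Tp 0 P.1 y.Tp * Matrix.fromBlocks x.Tm 0 P.2 y.Tm =
        Matrix.fromBlocks x.Tm 0 P.2 y.Tm * Matrix.fromBlocks x.Tp 0 P.1 y.Tp := by
  simp only [Matrix.fromBlocks_multiply, Matrix.fromBlocks_inj, x.comm, y.comm]
  simp only [extCocycles, Submodule.mem_mk, AddSubmonoid.mem_mk, AddSubsemigroup.mem_mk,
    Set.mem_ofPred_eq]
  simp only [Matrix.zero_mul, Matrix.mul_zero, add_zero, zero_add, true_and, and_true]
  rw [add_comm (y.Tp * P.2), add_comm (y.Tm * P.1)]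

/-- The change of splitting: a homogeneous linear map `F : V → W` of degree `0` gives the trivial
extension `(y.T₊ F - F x.T₊, y.T₋ F - F x.T₋)`. -/
def extBoundary (x : Lam k d) (y : Lam k e) : Matrix (Idx e) (Idx d) k →ₗ[k]
    Matrix (Idx e) (Idx d) k × Matrix (Idx e) (Idx d) k where
  toFun F := (y.Tp * F - F * x.Tp, y.Tm * F - F * x.Tm)
  map_add' F G := by
    simp only [Matrix.mul_add, Matrix.add_mul, Prod.mk_add_mk, Prod.mk.injEq]
    constructor <;> abel
  map_smul' c F := by
    simp [smul_sub]

/-- The extensions of `x` by `y` that split. -/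
def extCoboundaries (x : Lam k d) (y : Lam k e) :
    Submodule k (Matrix (Idx e) (Idx d) k × Matrix (Idx e) (Idx d) k) :=
  (homogeneous k d e 0).map (extBoundary x y)

theorem homogeneous_mul {d₁ d₂ d₃ : Fin n → ℕ} {r s : ℤ} {F : Matrix (Idx d₃) (Idx d₂) k}
    {G : Matrix (Idx d₂) (Idx d₁) k} (hF : F ∈ homogeneous k d₂ d₃ r)
    (hG : G ∈ homogeneous k d₁ d₂ s) : F * G ∈ homogeneous k d₁ d₃ (r + s) := by
  intro a b h
  rw [Matrix.mul_apply]
  refine Finset.sum_eq_zero fun c _ => ?_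
  by_cases hc : ((c.1 : ℕ) : ℤ) = ((b.1 : ℕ) : ℤ) + s
  · rw [hF a c (by omega), zero_mul]
  · rw [hG c b hc, mul_zero]

theorem extCoboundaries_le (x : Lam k d) (y : Lam k e) :
    extCoboundaries x y ≤ extCocycles x y := by
  rintro _ ⟨F, hF, rfl⟩
  refine ⟨sub_mem ?_ ?_, sub_mem ?_ ?_, ?_⟩
  · simpa using homogeneous_mul y.Tp_mem hF
  · simpa using homogeneous_mul hF x.Tp_mem
  · simpa using homogeneous_mul y.Tm_mem hF
  · simpa using homogeneous_mul hF x.Tm_mem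
  · simp only [extBoundary, LinearMap.coe_mk, AddHom.coe_mk, Matrix.mul_sub, Matrix.sub_mul,
      ← Matrix.mul_assoc, y.comm]
    simp only [Matrix.mul_assoc, x.comm]
    abel

/-- `dim Ext¹_Π(x, y)`, for `Ext¹` as the space of extensions of `x` by `y` up to equivalence. -/
noncomputable def extDim (x : Lam k d) (y : Lam k e) : ℕ :=
  Module.finrank k (extCocycles x y ⧸ (extCoboundaries x y).submoduleOf (extCocycles x y))

/-- `x` is rigid if `Ext¹_Π(x, x) = 0`. -/
def IsRigid (x : Lam k d) : Prop := extDim x x = 0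

/-- `y` is isomorphic to a submodule of `x`. -/
def Embeds (y : Lam k e) (x : Lam k d) : Prop :=
  ∃ F ∈ homSpace y x, Function.Injective F.mulVec

/-- There is a short exact sequence `0 → x₂ → x → x₁ → 0`. -/
def FitsInSES {d₁ d₂ : Fin n → ℕ} (x₂ : Lam k d₂) (x : Lam k d) (x₁ : Lam k d₁) : Prop :=
  ∃ F ∈ homSpace x₂ x, ∃ G ∈ homSpace x x₁,
    Function.Injective F.mulVec ∧ Function.Exact F.mulVec G.mulVec ∧ Function.Surjective G.mulVec

/-- `x` is `z`-saturated: `Hom_Π(x', z) ≠ 0` for every nonzero submodule `x'` of `x`. -/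
def IsSaturatedModule (z : Lam k e) (x : Lam k d) : Prop :=
  ∀ (d' : Fin n → ℕ) (x' : Lam k d'), d' ≠ 0 → Embeds x' x → homSpace x' z ≠ ⊥

end Modules

section Components

variable {k : Type*} [Field k]

/-- A graded dimension `d` together with a subset of `Λ(d)`. -/
abbrev Piece (k : Type*) [Field k] (n : ℕ) := Σ d : Fin n → ℕ, Set (Lam k d)

/-- The set `Comp` of the irreducible components of the varieties `Λ(d)`, for all `d`. -/
def IsComp (C : Piece k n) : Prop := C.2 ∈ irreducibleComponents (Lam k C.1)

/-- `hom_Π(C, D)`, the minimum of `dim Hom_Π(x, y)` over `x ∈ C` and `y ∈ D`. -/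
noncomputable def compHom (C D : Piece k n) : ℕ :=
  sInf {m | ∃ x ∈ C.2, ∃ y ∈ D.2, m = homDim x y}

/-- `C₁ * C₂`: the Zariski closure of the set of the modules `x` with a short exact sequence
`0 → x₂ → x → x₁ → 0`, where `(x₁, x₂) ∈ C₁ × C₂` and `dim Ext¹_Π(x₁, x₂)` is minimal. -/
def star (C₁ C₂ : Piece k n) : Piece k n :=
  ⟨C₁.1 + C₂.1, closure {x | ∃ x₁ ∈ C₁.2, ∃ x₂ ∈ C₂.2,
    (∀ y₁ ∈ C₁.2, ∀ y₂ ∈ C₂.2, extDim x₁ x₂ ≤ extDim y₁ y₂) ∧ FitsInSES x₂ x x₁}⟩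

end Components

section Basic

/-- The segment `[a, b]` with `a ≤ b`. -/
structure Segment (n : ℕ) where
  a : Fin n
  b : Fin n
  le : a ≤ b

/-- The graded dimension of a segment is its indicator function. -/
def Segment.grdim (Δ : Segment n) : Fin n → ℕ := fun i => if Δ.a ≤ i ∧ i ≤ Δ.b then 1 else 0

/-- The representation `M_Q(Δ)` of the linearly oriented quiver: a Jordan block of degree `1`. -/
def Segment.jordan (k : Type*) [Field k] (Δ : Segment n) :
    Matrix (Idx Δ.grdim) (Idx Δ.grdim) k :=
  Matrix.of fun i j => if (i.1 : ℕ) = (j.1 : ℕ) + 1 then 1 else 0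

/-- `T` and `T'` lie in the same orbit of `G_V = ∏ GL(V_i)` under conjugation. -/
def SameOrbit {k : Type*} [Field k] {d : Fin n → ℕ} (T T' : Matrix (Idx d) (Idx d) k) : Prop :=
  ∃ g ∈ homogeneous k d d 0, IsUnit g ∧ g * T = T' * g

/-- The labels `Z(Δ)` and `L(Δ)` of the basic representations. -/
inductive BasicRep (n : ℕ) where
  | Z (Δ : Segment n) : BasicRep n
  | L (Δ : Segment n) : BasicRep n

/-- The basic irreducible component `C_σ`: the closure of the set of the `(T₊, T₋)` such that `T₊`
is in the orbit of `M_Q(Δ)`, if `σ = Z(Δ)`, or such that `T₋` is in the orbit of the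
representation `M_{Q°}(Δ)` of the opposite quiver, if `σ = L(Δ)`. -/
def basicComp (k : Type*) [Field k] : BasicRep n → Piece k n
  | .Z Δ => ⟨Δ.grdim, closure {x | SameOrbit x.Tp (Δ.jordan k)}⟩
  | .L Δ => ⟨Δ.grdim, closure {x | SameOrbit x.Tm (Δ.jordan k).transpose}⟩

variable {k : Type*} [Field k]

/-- `C` is `σ`-saturated: it contains an `x_σ`-saturated module, where `x_σ` is a rigid element of
`C_σ` (which is unique up to isomorphism). -/
def IsSigmaSaturated (σ : BasicRep n) (C : Piece k n) : Prop :=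
  ∃ z ∈ (basicComp k σ).2, IsRigid z ∧ ∃ x ∈ C.2, IsSaturatedModule z x

/-- `C` is `σ`-reduced: `hom_Π(C, C_σ) = 0`. -/
def IsSigmaReduced (σ : BasicRep n) (C : Piece k n) : Prop :=
  compHom C (basicComp k σ) = 0

end Basic

end TypeA

/-!
The label `σ` fixes one of the two operators as the Jordan operator; the module `jordanLam k σ` is
the single Jordan block with the other operator zero. It cogenerates a torsion pair: the torsion
modules are the `x` with `Hom(x, jordanLam k σ) = 0`, and the torsion-free modules, the submodules
of its direct sums, are those supported on the segment for which the Jordan operator is injective at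
every position but the last (`exists_torsion_sequence`, `IsTorsionFree.exists_hom`). In each graded
dimension the torsion-free modules form an open set that is empty or a single orbit
(`isOpen_isTorsionFree`, `IsTorsionFree.exists_iso`). Consequently a component is saturated if and
only if it is the closure of that orbit, and a component is reduced if and only if it contains a
torsion module, in which case its torsion modules are open and dense in it.

*The product is a closure of a family of extensions.* Let `x₁` be torsion-free and `x₂` torsion, so
that `Hom(x₂, x₁) = 0`. The equation for extension cocycles of `x₁` by `x₂` is a linear map whose
transpose, for the trace pairing, has kernel `Hom(x₂, x₁)`; hence it is surjective
(`cocycleMap_surjective`), and the cocycles are the kernels of a regular family of linear maps of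
constant rank. All of them are values of one polynomial map (`kerProj`), so that the extensions over
an irreducible set of such pairs form an irreducible set. The same computation gives
`dim Ext¹(x₁, x₂) = dim Hom(x₁, x₂) + dim Hom(x₂, x₁) + const` (`extDim_add`). By semicontinuity the
pairs with the least `dim Ext¹` contain a dense set of pairs of this kind, and it follows that
`C₁ * C₂` is the closure of the set of all extensions of torsion-free points of `C₁` by torsion
points of `C₂` (`star_eq_closure_sesSet`). In particular `C₁ * C₂` is irreducible. Nothing here uses
dimensions of varieties.

*Existence.* Every module is an extension of a torsion-free module by a torsion module, so a
component is covered by the closures of finitely many of the sets just described. Being irreducible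
it lies in one of them, and equals it by maximality (`exists_subset_closure_torsionSet`).

*Uniqueness.* Let `C₁ * C₂ = C₁' * C₂'`, and let `x` be an extension of the torsion-free `x₁` by a
torsion module `x₂` in `C₂`. On the dense sets of extensions of either kind `dim Hom(·, x₁)` has
the same constant value, by semicontinuity. Where this dimension is constant, the quotient map
`x → x₁` extends to a regular family of surjections `y → x₁` (`exists_hom_section`,
`exists_quotient_section`). For an extension `y` of the second kind this map kills the torsion
submodule, whence `dim x₁ ≤ dim y₁` (`dim_le_of_closure_eq`), with equality by symmetry. Then the
kernels of the family are the torsion submodules, which lie in the closed set `C₂'` for a dense set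
of `y`, and therefore at `x` (`torsion_mem_of_closure_eq`). So the torsion points of `C₂` lie in
`C₂'`, and `C₂ = C₂'`.
-/

namespace TypeA

/-! ### Regular families of vectors and matrices -/

section Regular

variable {k : Type*} [Field k] {X : Type*}

/-- A map `f : X → E` to a vector space is regular, with respect to an algebra `A` of functions
on `X`, if `ℓ ∘ f` lies in `A` for every linear form `ℓ` on `E`. -/
def RegMap (A : Subalgebra k (X → k)) {E : Type*} [AddCommGroup E] [Module k E] (f : X → E) :
    Prop :=
  ∀ ℓ : Module.Dual k E, (fun x => ℓ (f x)) ∈ A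

variable {A : Subalgebra k (X → k)} {E F G : Type*} [AddCommGroup E] [Module k E]
  [AddCommGroup F] [Module k F] [AddCommGroup G] [Module k G]

theorem const_mem (A : Subalgebra k (X → k)) (c : k) : (fun _ => c) ∈ A :=
  A.algebraMap_mem c

theorem RegMap.const (e : E) : RegMap A (fun _ : X => e) := fun ℓ => const_mem A (ℓ e)

theorem RegMap.add {f g : X → E} (hf : RegMap A f) (hg : RegMap A g) :
    RegMap A (fun x => f x + g x) := by
  intro ℓ
  simp only [map_add]
  exact add_mem (hf ℓ) (hg ℓ)

theorem RegMap.sub {f g : X → E} (hf : RegMap A f) (hg : RegMap A g) :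
    RegMap A (fun x => f x - g x) := by
  intro ℓ
  simp only [map_sub]
  exact sub_mem (hf ℓ) (hg ℓ)

theorem RegMap.smul {a : X → k} {f : X → E} (ha : a ∈ A) (hf : RegMap A f) :
    RegMap A (fun x => a x • f x) := by
  intro ℓ
  simp only [map_smul, smul_eq_mul]
  exact mul_mem ha (hf ℓ)

theorem RegMap.map (L : E →ₗ[k] F) {f : X → E} (hf : RegMap A f) :
    RegMap A (fun x => L (f x)) := fun ℓ => hf (ℓ ∘ₗ L)

theorem RegMap.prodMk {f : X → E} {g : X → F} (hf : RegMap A f) (hg : RegMap A g) :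
    RegMap A (fun x => (f x, g x)) := by
  intro ℓ
  have : (fun x => ℓ (f x, g x)) =
      (fun x => (ℓ ∘ₗ LinearMap.inl k E F) (f x)) + fun x => (ℓ ∘ₗ LinearMap.inr k E F) (g x) := by
    ext x
    simp [← map_add]
  rw [this]
  exact add_mem (hf _) (hg _)

/-- Applying a family of linear maps that is regular at each fixed vector. -/
theorem RegMap.apply [FiniteDimensional k E] {L : X → E →ₗ[k] F} {f : X → E}
    (hL : ∀ e, RegMap A fun x => L x e) (hf : RegMap A f) : RegMap A fun x => L x (f x) := by
  intro ℓ
  have b := Module.finBasis k E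
  have : (fun x => ℓ (L x (f x))) =
      ∑ i, (fun x => b.coord i (f x)) * fun x => ℓ (L x (b i)) := by
    ext x
    conv_lhs => rw [← b.sum_repr (f x)]
    simp only [map_sum, map_smul, smul_eq_mul, Finset.sum_apply, Pi.mul_apply,
      Module.Basis.coord_apply]
  rw [this]
  exact Subalgebra.sum_mem _ fun i _ => mul_mem (hf _) (hL _ ℓ)

theorem regMap_matrix_iff {m n : Type*} [Fintype m] [Fintype n] [DecidableEq m] [DecidableEq n]
    {M : X → Matrix m n k} : RegMap A M ↔ ∀ i j, (fun x => M x i j) ∈ A := by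
  constructor
  · intro h i j
    exact h ⟨⟨fun N => N i j, fun _ _ => rfl⟩, fun _ _ => rfl⟩
  · intro h ℓ
    have : (fun x => ℓ (M x)) =
        ∑ i, ∑ j, (fun x => M x i j) * fun _ => ℓ (Matrix.single i j 1) := by
      ext x
      conv_lhs => rw [Matrix.matrix_eq_sum_single (M x)]
      simp only [map_sum, Finset.sum_apply, Pi.mul_apply]
      refine Finset.sum_congr rfl fun i _ => Finset.sum_congr rfl fun j _ => ?_
      rw [← smul_eq_mul, ← map_smul, Matrix.smul_single, smul_eq_mul, mul_one]
    rw [this]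
    exact Subalgebra.sum_mem _ fun i _ => Subalgebra.sum_mem _ fun j _ =>
      mul_mem (h i j) (const_mem _ _)

theorem regMap_pi_iff {m : Type*} [Fintype m] [DecidableEq m] {f : X → m → k} :
    RegMap A f ↔ ∀ i, (fun x => f x i) ∈ A := by
  constructor
  · intro h i
    exact h (LinearMap.proj i)
  · intro h ℓ
    have : (fun x => ℓ (f x)) = ∑ i, (fun x => f x i) * fun _ => ℓ (Pi.single i 1) := by
      ext x
      conv_lhs => rw [pi_eq_sum_univ' (f x)]
      simp only [map_sum, Finset.sum_apply, Pi.mul_apply]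
      refine Finset.sum_congr rfl fun i _ => ?_
      rw [← smul_eq_mul, ← map_smul]
    rw [this]
    exact Subalgebra.sum_mem _ fun i _ => mul_mem (h i) (const_mem _ _)

section Matrices

variable {l m n : Type*} [Fintype l] [DecidableEq l] [Fintype m] [Fintype n] [DecidableEq m]
  [DecidableEq n]

theorem RegMap.mul {M : X → Matrix l m k} {N : X → Matrix m n k} (hM : RegMap A M)
    (hN : RegMap A N) : RegMap A fun x => M x * N x := by
  rw [regMap_matrix_iff] at *
  intro i j
  have : (fun x => (M x * N x) i j) = ∑ c, (fun x => M x i c) * fun x => N x c j := by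
    ext x
    simp [Matrix.mul_apply]
  rw [this]
  exact Subalgebra.sum_mem _ fun c _ => mul_mem (hM _ _) (hN _ _)

theorem RegMap.det {M : X → Matrix m m k} (hM : RegMap A M) : (fun x => (M x).det) ∈ A := by
  rw [regMap_matrix_iff] at hM
  have : (fun x => (M x).det) = ∑ σ : Equiv.Perm m,
      (fun _ => ((Equiv.Perm.sign σ : ℤ) : k)) * ∏ i, fun x => M x (σ i) i := by
    ext x
    simp [Matrix.det_apply']
  rw [this]
  exact Subalgebra.sum_mem _ fun σ _ => mul_mem (const_mem _ _)
    (Subalgebra.prod_mem _ fun i _ => hM _ _)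

theorem RegMap.adjugate {M : X → Matrix m m k} (hM : RegMap A M) :
    RegMap A fun x => (M x).adjugate := by
  rw [regMap_matrix_iff]
  intro i j
  simp only [Matrix.adjugate_apply]
  apply RegMap.det
  rw [regMap_matrix_iff] at *
  intro a b
  by_cases h : a = j
  · subst h
    simpa using const_mem A _
  · simpa [Matrix.updateRow_ne h] using hM a b

theorem RegMap.inv {M : X → Matrix m m k} (hM : RegMap A M)
    (hdet : (fun x => (M x).det⁻¹) ∈ A) : RegMap A fun x => (M x)⁻¹ := by
  simp only [Matrix.inv_def, Ring.inverse_eq_inv']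
  exact RegMap.smul hdet hM.adjugate

end Matrices

/-! ### Kernels of linear maps of locally constant rank -/

/-- For linear maps `M : E → k^r` and `B : k^r → E`, the endomorphism
`s ↦ det(N) s - B adj(N) M s`, with `N = M B`, of `E`. Its values lie in the kernel of `M`, and
it depends polynomially on `M`, `B` and `s`. If `det(N) ≠ 0`, then it is a multiple of a projection
onto the kernel. -/
noncomputable def kerProj {r : ℕ} (M : E →ₗ[k] (Fin r → k)) (B : (Fin r → k) →ₗ[k] E) (s : E) :
    E :=
  (LinearMap.toMatrix' (M ∘ₗ B)).det • s -
    B ((LinearMap.toMatrix' (M ∘ₗ B)).adjugate.mulVec (M s))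

theorem apply_kerProj {r : ℕ} (M : E →ₗ[k] (Fin r → k)) (B : (Fin r → k) →ₗ[k] E) (s : E) :
    M (kerProj M B s) = 0 := by
  rw [kerProj, map_sub, map_smul, ← LinearMap.comp_apply,
    ← LinearMap.toMatrix'_mulVec (M ∘ₗ B), Matrix.mulVec_mulVec, Matrix.mul_adjugate,
    Matrix.smul_mulVec, Matrix.one_mulVec, sub_self]

theorem kerProj_of_apply_eq_zero {r : ℕ} (M : E →ₗ[k] (Fin r → k)) (B : (Fin r → k) →ₗ[k] E)
    {s : E} (hs : M s = 0) : kerProj M B s = (LinearMap.toMatrix' (M ∘ₗ B)).det • s := by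
  simp [kerProj, hs]

theorem RegMap.toMatrix' {r : ℕ} [FiniteDimensional k E] {M : X → E →ₗ[k] (Fin r → k)}
    {B : X → (Fin r → k) →ₗ[k] E} (hM : ∀ e, RegMap A fun x => M x e)
    (hB : ∀ e, RegMap A fun x => B x e) :
    RegMap A fun x => LinearMap.toMatrix' (M x ∘ₗ B x) := by
  rw [regMap_matrix_iff]
  intro i j
  simp only [LinearMap.toMatrix'_apply, LinearMap.comp_apply]
  exact RegMap.apply hM (hB _) (LinearMap.proj i)

theorem RegMap.kerProj {r : ℕ} [FiniteDimensional k E] {M : X → E →ₗ[k] (Fin r → k)}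
    {B : X → (Fin r → k) →ₗ[k] E} {s : X → E} (hM : ∀ e, RegMap A fun x => M x e)
    (hB : ∀ e, RegMap A fun x => B x e) (hs : RegMap A s) :
    RegMap A fun x => kerProj (M x) (B x) (s x) := by
  have hN := RegMap.toMatrix' hM hB
  refine (RegMap.smul hN.det hs).sub (RegMap.apply hB ?_)
  have h2 := RegMap.apply hM hs
  rw [regMap_pi_iff]
  intro i
  have h3 := regMap_matrix_iff.1 hN.adjugate
  rw [regMap_pi_iff] at h2
  have : (fun x => (((LinearMap.toMatrix' (M x ∘ₗ B x)).adjugate).mulVec (M x (s x))) i) =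
      ∑ j, (fun x => (LinearMap.toMatrix' (M x ∘ₗ B x)).adjugate i j) * fun x => M x (s x) j := by
    ext x
    simp [Matrix.mulVec, dotProduct]
  rw [this]
  exact Subalgebra.sum_mem _ fun j _ => mul_mem (h3 i j) (h2 j)

/-- A vector `s` in the kernel of a member `L x₀` of a family of linear maps is the value at `x₀` of
a regular family of vectors that lie in the kernel of `L x` for those `x` near `x₀` for which `L x`
has the same rank as `L x₀`. Near `x₀` the rank does not drop. -/
theorem exists_ker_section [FiniteDimensional k E] [FiniteDimensional k F]
    {L : X → E →ₗ[k] F} (hL : ∀ e, RegMap A fun x => L x e) (x₀ : X) :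
    ∃ D ∈ A, D x₀ ≠ 0 ∧
      (∀ x, D x ≠ 0 → Module.finrank k (LinearMap.ker (L x)) ≤
        Module.finrank k (LinearMap.ker (L x₀))) ∧
      ∀ s ∈ LinearMap.ker (L x₀), ∃ σ : X → E, RegMap A σ ∧ σ x₀ = s ∧ ∀ x, D x ≠ 0 →
        Module.finrank k (LinearMap.ker (L x)) = Module.finrank k (LinearMap.ker (L x₀)) →
        L x (σ x) = 0 := by
  set R := LinearMap.range (L x₀) with hR
  set r := Module.finrank k R with hr
  have hr' : r = Module.finrank k (LinearMap.range (L x₀)) := hr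
  let φ : R ≃ₗ[k] (Fin r → k) := (Module.finBasis k R).equivFun
  obtain ⟨p, hp⟩ := R.subtype.exists_leftInverse_of_injective R.ker_subtype
  obtain ⟨q, hq⟩ := (L x₀).rangeRestrict.exists_rightInverse_of_surjective
    (LinearMap.range_rangeRestrict _)
  -- `P` and `B` are coordinates for which `P (L x₀) B` is the identity, so that its determinant
  -- defines the neighbourhood, and `P (L x)` has the kernel of `L x` when the ranks agree
  let P : F →ₗ[k] (Fin r → k) := φ.toLinearMap ∘ₗ p
  let B : (Fin r → k) →ₗ[k] E := q ∘ₗ φ.symm.toLinearMap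
  have h1 : P ∘ₗ L x₀ ∘ₗ B = LinearMap.id := by
    have h2 : L x₀ ∘ₗ q = R.subtype := by
      ext1 v
      have := LinearMap.congr_fun hq v
      simpa [Subtype.ext_iff] using this
    calc P ∘ₗ L x₀ ∘ₗ B = φ.toLinearMap ∘ₗ p ∘ₗ (L x₀ ∘ₗ q) ∘ₗ φ.symm.toLinearMap := rfl
      _ = φ.toLinearMap ∘ₗ (p ∘ₗ R.subtype) ∘ₗ φ.symm.toLinearMap := by rw [h2]; rfl
      _ = LinearMap.id := by rw [hp]; ext; simp
  have hM : ∀ e, RegMap A fun x => (P ∘ₗ L x) e := fun e => (hL e).map P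
  have hN := RegMap.toMatrix' hM (fun e => RegMap.const (A := A) (B e))
  have key : ∀ x, (LinearMap.toMatrix' ((P ∘ₗ L x) ∘ₗ B)).det ≠ 0 →
      Function.Surjective (P ∘ₗ L x) := by
    intro x hx v
    have hu := Matrix.mulVec_surjective_iff_isUnit.2
      ((Matrix.isUnit_iff_isUnit_det _).2 (isUnit_iff_ne_zero.2 hx)) v
    obtain ⟨w, hw⟩ := hu
    exact ⟨B w, by rw [← hw, LinearMap.toMatrix'_mulVec]; rfl⟩
  have rk : ∀ x, Module.finrank k (LinearMap.range (L x)) +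
      Module.finrank k (LinearMap.ker (L x)) = Module.finrank k E :=
    fun x => (L x).finrank_range_add_finrank_ker
  have rge : ∀ x, (LinearMap.toMatrix' ((P ∘ₗ L x) ∘ₗ B)).det ≠ 0 →
      Function.Surjective (P.domRestrict (LinearMap.range (L x))) := by
    intro x hx v
    obtain ⟨e, he⟩ := key x hx v
    exact ⟨⟨L x e, e, rfl⟩, he⟩
  have one : (LinearMap.toMatrix' ((P ∘ₗ L x₀) ∘ₗ B)).det = 1 := by
    rw [LinearMap.comp_assoc, h1, LinearMap.toMatrix'_id, Matrix.det_one]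
  refine ⟨_, hN.det, by simp only [one]; exact one_ne_zero, ?_, ?_⟩
  · intro x hx
    have h3 := LinearMap.finrank_le_finrank_of_surjective (rge x hx)
    rw [Module.finrank_fin_fun] at h3
    have := rk x
    have := rk x₀
    omega
  · intro s hs
    refine ⟨fun x => kerProj (P ∘ₗ L x) B s, RegMap.kerProj hM (fun e => RegMap.const _)
      (RegMap.const _), ?_, ?_⟩
    · have : L x₀ s = 0 := hs
      simp only
      rw [kerProj_of_apply_eq_zero _ _ (by simp [this]), one, one_smul]
    · intro x hx hrk
      have h4 : Function.Injective (P.domRestrict (LinearMap.range (L x))) := by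
        have hd : Module.finrank k (LinearMap.range (L x)) = Module.finrank k (Fin r → k) := by
          rw [Module.finrank_fin_fun]
          have := rk x
          have := rk x₀
          omega
        exact (LinearMap.injective_iff_surjective_of_finrank_eq_finrank hd).2 (rge x hx)
      have h5 := apply_kerProj (P ∘ₗ L x) B s
      have h6 : P.domRestrict (LinearMap.range (L x))
          ⟨L x (kerProj (P ∘ₗ L x) B s), _, rfl⟩ = 0 := h5
      have := h4 (h6.trans (map_zero _).symm)
      exact congrArg Subtype.val this

end Regular

/-! ### Regular functions and irreducible sets -/

section Zariski

variable {n : ℕ} {k : Type*} [Field k] {X : Type*}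

/-- An algebra of functions without zero divisors, in terms of nonvanishing loci. -/
def NoZeroDiv (A : Subalgebra k (X → k)) : Prop :=
  ∀ f ∈ A, ∀ g ∈ A, (∃ x, f x ≠ 0) → (∃ x, g x ≠ 0) → ∃ x, f x ≠ 0 ∧ g x ≠ 0

/-- The regular functions on the principal open set `q ≠ 0`: the quotients `F / q ^ N` with
`F ∈ A`. -/
def locAlg (A : Subalgebra k (X → k)) (q : X → k) (hq : q ∈ A) :
    Subalgebra k ({x // q x ≠ 0} → k) where
  carrier := {f | ∃ N : ℕ, ∃ F ∈ A, ∀ x : {x // q x ≠ 0}, F x = q x ^ N * f x}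
  mul_mem' := by
    rintro f g ⟨N, F, hF, h⟩ ⟨M, G, hG, h'⟩
    refine ⟨N + M, F * G, mul_mem hF hG, fun x => ?_⟩
    simp only [Pi.mul_apply, h x, h' x]
    ring
  add_mem' := by
    rintro f g ⟨N, F, hF, h⟩ ⟨M, G, hG, h'⟩
    refine ⟨N + M, q ^ M * F + q ^ N * G,
      add_mem (mul_mem (pow_mem hq _) hF) (mul_mem (pow_mem hq _) hG), fun x => ?_⟩
    simp only [Pi.mul_apply, Pi.add_apply, Pi.pow_apply, h x, h' x]
    ring
  algebraMap_mem' c := ⟨0, fun _ => c, const_mem A c, fun x => by simp⟩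

theorem restrict_mem_locAlg {A : Subalgebra k (X → k)} {q : X → k} (hq : q ∈ A) {f : X → k}
    (hf : f ∈ A) : (fun x : {x // q x ≠ 0} => f x) ∈ locAlg A q hq :=
  ⟨0, f, hf, fun x => by simp⟩

theorem inv_mem_locAlg {A : Subalgebra k (X → k)} {q : X → k} (hq : q ∈ A) :
    (fun x : {x // q x ≠ 0} => (q x)⁻¹) ∈ locAlg A q hq :=
  ⟨1, fun _ => 1, const_mem A 1, fun x => by simp [mul_inv_cancel₀ x.2]⟩

theorem RegMap.restrict {A : Subalgebra k (X → k)} {q : X → k} (hq : q ∈ A) {E : Type*}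
    [AddCommGroup E] [Module k E] {f : X → E} (hf : RegMap A f) :
    RegMap (locAlg A q hq) fun x : {x // q x ≠ 0} => f x :=
  fun ℓ => restrict_mem_locAlg hq (hf ℓ)

theorem NoZeroDiv.locAlg {A : Subalgebra k (X → k)} (hA : NoZeroDiv A) {q : X → k} (hq : q ∈ A) :
    NoZeroDiv (locAlg A q hq) := by
  rintro f ⟨N, F, hF, h⟩ g ⟨M, G, hG, h'⟩ ⟨x, hx⟩ ⟨y, hy⟩
  obtain ⟨w, hw, hw'⟩ := hA (F * q) (mul_mem hF hq) (G * q) (mul_mem hG hq)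
    ⟨x, by simpa [h x, x.2] using hx⟩ ⟨y, by simpa [h' y, y.2] using hy⟩
  have hqw : q w ≠ 0 := right_ne_zero_of_mul hw
  have h1 := h ⟨w, hqw⟩
  have h2 := h' ⟨w, hqw⟩
  refine ⟨⟨w, hqw⟩, ?_, ?_⟩
  · intro h0
    rw [h0, mul_zero] at h1
    exact hw (by simp [h1])
  · intro h0
    rw [h0, mul_zero] at h2
    exact hw' (by simp [h2])

/-- The polynomial functions on a vector space. -/
def polyFun (k W : Type*) [Field k] [AddCommGroup W] [Module k W] : Subalgebra k (W → k) :=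
  Algebra.adjoin k (Set.range fun (ℓ : Module.Dual k W) (w : W) => ℓ w)

theorem regMap_polyFun {W E : Type*} [AddCommGroup W] [Module k W] [AddCommGroup E] [Module k E]
    (L : W →ₗ[k] E) : RegMap (polyFun k W) fun w => L w :=
  fun ℓ => Algebra.subset_adjoin ⟨ℓ ∘ₗ L, rfl⟩

theorem noZeroDiv_polyFun [Infinite k] (W : Type*) [AddCommGroup W] [Module k W]
    [FiniteDimensional k W] : NoZeroDiv (polyFun k W) := by
  let b := Module.finBasis k W
  have key : ∀ f ∈ polyFun k W, ∃ p : MvPolynomial (Fin (Module.finrank k W)) k,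
      ∀ v, f (b.equivFun.symm v) = MvPolynomial.eval v p := by
    intro f hf
    induction hf using Algebra.adjoin_induction with
    | mem f hf =>
      obtain ⟨ℓ, rfl⟩ := hf
      refine ⟨∑ i, MvPolynomial.X i * MvPolynomial.C (ℓ (b i)), fun v => ?_⟩
      simp [Module.Basis.equivFun_symm_apply, map_sum]
    | algebraMap c => exact ⟨MvPolynomial.C c, fun v => by simp⟩
    | add f g _ _ hf hg =>
      obtain ⟨p, hp⟩ := hf
      obtain ⟨q, hq⟩ := hg
      exact ⟨p + q, fun v => by rw [Pi.add_apply, hp, hq, map_add]⟩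
    | mul f g _ _ hf hg =>
      obtain ⟨p, hp⟩ := hf
      obtain ⟨q, hq⟩ := hg
      exact ⟨p * q, fun v => by rw [Pi.mul_apply, hp, hq, map_mul]⟩
  rintro f hf g hg ⟨x, hx⟩ ⟨y, hy⟩
  obtain ⟨p, hp⟩ := key f hf
  obtain ⟨q, hq⟩ := key g hg
  by_contra! hcon
  have hpq : p * q = 0 := by
    apply MvPolynomial.funext
    intro v
    rw [map_mul, ← hp, ← hq, map_zero]
    by_cases h : f (b.equivFun.symm v) = 0
    · rw [h, zero_mul]
    · rw [hcon _ h, mul_zero]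
  rcases mul_eq_zero.1 hpq with h | h
  · apply hx
    rw [← b.equivFun.symm_apply_apply x, hp, h, map_zero]
  · apply hy
    rw [← b.equivFun.symm_apply_apply y, hq, h, map_zero]

/-- The regular functions on `Λ(d)`: the polynomials in the matrix entries. -/
def regLam (k : Type*) [Field k] (d : Fin n → ℕ) : Subalgebra k (Lam k d → k) :=
  Algebra.adjoin k (Set.range fun c (x : Lam k d) => x.coords c)

variable {d e : Fin n → ℕ}

theorem eval_mem_regLam (p : MvPolynomial ((Idx d × Idx d) ⊕ (Idx d × Idx d)) k) :
    (fun x : Lam k d => MvPolynomial.eval x.coords p) ∈ regLam k d := by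
  induction p using MvPolynomial.induction_on with
  | C c => simpa using const_mem _ c
  | add p q hp hq =>
    simp only [map_add]
    exact add_mem hp hq
  | mul_X p i hp =>
    simp only [map_mul, MvPolynomial.eval_X]
    exact mul_mem hp (Algebra.subset_adjoin ⟨i, rfl⟩)

theorem exists_eval_of_mem_regLam {f : Lam k d → k} (hf : f ∈ regLam k d) :
    ∃ p : MvPolynomial ((Idx d × Idx d) ⊕ (Idx d × Idx d)) k,
      f = fun x => MvPolynomial.eval x.coords p := by
  induction hf using Algebra.adjoin_induction with
  | mem f hf =>
    obtain ⟨c, rfl⟩ := hf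
    exact ⟨MvPolynomial.X c, by simp⟩
  | algebraMap c => exact ⟨MvPolynomial.C c, by ext; simp⟩
  | add f g _ _ hf hg =>
    obtain ⟨p, rfl⟩ := hf
    obtain ⟨q, rfl⟩ := hg
    exact ⟨p + q, by ext; simp⟩
  | mul f g _ _ hf hg =>
    obtain ⟨p, rfl⟩ := hf
    obtain ⟨q, rfl⟩ := hg
    exact ⟨p * q, by ext; simp⟩

theorem isOpen_ne_zero {f : Lam k d → k} (hf : f ∈ regLam k d) : IsOpen {x | f x ≠ 0} := by
  obtain ⟨p, rfl⟩ := exists_eval_of_mem_regLam hf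
  rw [← isClosed_compl_iff, isClosed_lam_iff]
  exact ⟨{p}, by ext; simp⟩

theorem exists_basic_open {u : Set (Lam k d)} (hu : IsOpen u) {x : Lam k d} (hx : x ∈ u) :
    ∃ f ∈ regLam k d, f x ≠ 0 ∧ ∀ y, f y ≠ 0 → y ∈ u := by
  obtain ⟨S, hS⟩ := (isClosed_lam_iff _).1 (isClosed_compl_iff.2 hu)
  have hx' : x ∉ uᶜ := fun h => h hx
  rw [hS] at hx'
  simp only [Set.mem_ofPred_eq, not_forall] at hx'
  obtain ⟨p, hp, hpx⟩ := hx'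
  refine ⟨_, eval_mem_regLam p, hpx, fun y hy => ?_⟩
  by_contra h
  have : y ∈ uᶜ := h
  rw [hS] at this
  exact hy (this p hp)

theorem regMap_Tp : RegMap (regLam k d) fun x : Lam k d => x.Tp :=
  regMap_matrix_iff.2 fun i j => Algebra.subset_adjoin ⟨Sum.inl (i, j), rfl⟩

theorem regMap_Tm : RegMap (regLam k d) fun x : Lam k d => x.Tm :=
  regMap_matrix_iff.2 fun i j => Algebra.subset_adjoin ⟨Sum.inr (i, j), rfl⟩

theorem comp_mem {A : Subalgebra k (X → k)} {φ : X → Lam k d} (hp : RegMap A fun x => (φ x).Tp)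
    (hm : RegMap A fun x => (φ x).Tm) {f : Lam k d → k} (hf : f ∈ regLam k d) :
    (fun x => f (φ x)) ∈ A := by
  induction hf using Algebra.adjoin_induction with
  | mem f hf =>
    obtain ⟨(⟨i, j⟩ | ⟨i, j⟩), rfl⟩ := hf
    · exact regMap_matrix_iff.1 hp i j
    · exact regMap_matrix_iff.1 hm i j
  | algebraMap c => exact const_mem A c
  | add f g _ _ hf hg => exact add_mem hf hg
  | mul f g _ _ hf hg => exact mul_mem hf hg

theorem continuous_of_regMap {φ : Lam k e → Lam k d}
    (hp : RegMap (regLam k e) fun x => (φ x).Tp) (hm : RegMap (regLam k e) fun x => (φ x).Tm) :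
    Continuous φ := by
  refine continuous_def.2 fun u hu => isOpen_iff_forall_mem_open.2 fun x hx => ?_
  obtain ⟨f, hf, hfx, hfu⟩ := exists_basic_open hu hx
  exact ⟨_, fun y hy => hfu _ hy, isOpen_ne_zero (comp_mem hp hm hf), hfx⟩

/-- The image of an irreducible parameter space is irreducible. -/
theorem isPreirreducible_range {A : Subalgebra k (X → k)} (hA : NoZeroDiv A) {φ : X → Lam k d}
    (hp : RegMap A fun x => (φ x).Tp) (hm : RegMap A fun x => (φ x).Tm) :
    IsPreirreducible (Set.range φ) := by
  rintro u v hu hv ⟨_, ⟨x, rfl⟩, hx⟩ ⟨_, ⟨y, rfl⟩, hy⟩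
  obtain ⟨f, hf, hfx, hfu⟩ := exists_basic_open hu hx
  obtain ⟨g, hg, hgy, hgv⟩ := exists_basic_open hv hy
  obtain ⟨w, hw, hw'⟩ := hA _ (comp_mem hp hm hf) _ (comp_mem hp hm hg) ⟨x, hfx⟩ ⟨y, hgy⟩
  exact ⟨φ w, ⟨w, rfl⟩, hfu _ hw, hgv _ hw'⟩

instance : TopologicalSpace.NoetherianSpace (Lam k d) :=
  Topology.IsInducing.noetherianSpace
    (i := fun x : Lam k d => MvPolynomial.pointToPoint (k := k) x.coords) ⟨rfl⟩

/-- The image of an irreducible set under a separately continuous family of maps whose orbits in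
the parameter `w` are irreducible. -/
theorem isPreirreducible_image2 {X Y W : Type*} [TopologicalSpace X] [TopologicalSpace Y]
    {φ : X → W → Y} {C : Set X} (hC : IsPreirreducible C) (hφ : ∀ w, Continuous fun x => φ x w)
    (hW : ∀ x ∈ C, IsPreirreducible (Set.range (φ x))) :
    IsPreirreducible {y | ∃ x ∈ C, ∃ w, φ x w = y} := by
  rintro u v hu hv ⟨_, ⟨x, hx, w, rfl⟩, hxu⟩ ⟨_, ⟨x', hx', w', rfl⟩, hxv⟩
  obtain ⟨a, ha, hau, hav⟩ := hC _ _ (hu.preimage (hφ w)) (hv.preimage (hφ w'))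
    ⟨x, hx, hxu⟩ ⟨x', hx', hxv⟩
  obtain ⟨_, ⟨t, rfl⟩, htu, htv⟩ := hW a ha _ _ hu hv ⟨_, ⟨w, rfl⟩, hau⟩ ⟨_, ⟨w', rfl⟩, hav⟩
  exact ⟨_, ⟨a, ha, t, rfl⟩, htu, htv⟩

/-- A regular function on a principal open set that vanishes on a set `S` vanishes on the closure
of `S`. -/
theorem locAlg_eq_zero_of_mem_closure {q : Lam k d → k} {hq : q ∈ regLam k d}
    {f : {x // q x ≠ 0} → k} (hf : f ∈ locAlg (regLam k d) q hq) {S : Set (Lam k d)}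
    (hS : ∀ x, x.1 ∈ S → f x = 0) (x : {x // q x ≠ 0}) (hx : x.1 ∈ closure S) : f x = 0 := by
  obtain ⟨N, F, hF, h⟩ := hf
  by_contra h0
  have h1 : (F * q) x.1 ≠ 0 := by
    simp [h x, h0, x.2]
  obtain ⟨y, hy, hyS⟩ := mem_closure_iff.1 hx _ (isOpen_ne_zero (mul_mem hF hq)) h1
  have hqy : q y ≠ 0 := right_ne_zero_of_mul hy
  apply hy
  simp [h ⟨y, hqy⟩, hS ⟨y, hqy⟩ hyS]

end Zariski

/-! ### Homogeneous matrices -/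

section Graded

variable {n : ℕ} {k : Type*} [Field k] {d e f : Fin n → ℕ}

/-- The homogeneous part of degree `r` of a matrix. -/
def hpart (r : ℤ) (F : Matrix (Idx e) (Idx d) k) : Matrix (Idx e) (Idx d) k :=
  Matrix.of fun a b => if ((a.1 : ℕ) : ℤ) = ((b.1 : ℕ) : ℤ) + r then F a b else 0

theorem hpart_mem (r : ℤ) (F : Matrix (Idx e) (Idx d) k) : hpart r F ∈ homogeneous k d e r := by
  intro a b h
  simp [hpart, h]

theorem hpart_of_mem {r : ℤ} {F : Matrix (Idx e) (Idx d) k} (hF : F ∈ homogeneous k d e r) :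
    hpart r F = F := by
  ext a b
  by_cases h : ((a.1 : ℕ) : ℤ) = ((b.1 : ℕ) : ℤ) + r
  · simp [hpart, h]
  · simp [hpart, h, hF a b h]

theorem mul_hpart {r s : ℤ} {F : Matrix (Idx f) (Idx e) k} (hF : F ∈ homogeneous k e f s)
    (G : Matrix (Idx e) (Idx d) k) : F * hpart r G = hpart (s + r) (F * G) := by
  ext a b
  simp only [Matrix.mul_apply, hpart, Matrix.of_apply]
  split_ifs with h
  · refine Finset.sum_congr rfl fun c _ => ?_
    by_cases hc : ((a.1 : ℕ) : ℤ) = ((c.1 : ℕ) : ℤ) + s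
    · rw [if_pos (by omega)]
    · rw [hF a c hc, zero_mul, zero_mul]
  · refine Finset.sum_eq_zero fun c _ => ?_
    by_cases hc : ((a.1 : ℕ) : ℤ) = ((c.1 : ℕ) : ℤ) + s
    · rw [if_neg (by omega), mul_zero]
    · rw [hF a c hc, zero_mul]

theorem one_mem_homogeneous : (1 : Matrix (Idx d) (Idx d) k) ∈ homogeneous k d d 0 := by
  intro a b h
  rw [Matrix.one_apply_ne]
  rintro rfl
  simp at h

theorem mul_mem_homogeneous_zero {F : Matrix (Idx f) (Idx e) k} {G : Matrix (Idx e) (Idx d) k}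
    (hF : F ∈ homogeneous k e f 0) (hG : G ∈ homogeneous k d e 0) :
    F * G ∈ homogeneous k d f 0 := by
  simpa using homogeneous_mul hF hG

theorem exists_homogeneous_rightInverse {G : Matrix (Idx e) (Idx d) k}
    (hG : G ∈ homogeneous k d e 0) (hs : Function.Surjective G.mulVec) :
    ∃ S ∈ homogeneous k e d 0, G * S = 1 := by
  obtain ⟨S, hS⟩ := Matrix.mulVec_surjective_iff_exists_right_inverse.1 hs
  refine ⟨hpart 0 S, hpart_mem 0 S, ?_⟩
  rw [mul_hpart hG, hS, zero_add, hpart_of_mem one_mem_homogeneous]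

theorem mem_homogeneous_of_inverse {g : Matrix (Idx e) (Idx d) k} {h : Matrix (Idx d) (Idx e) k}
    (hg : g ∈ homogeneous k d e 0) (h₁ : g * h = 1) (h₂ : h * g = 1) :
    h ∈ homogeneous k e d 0 := by
  have : g * hpart 0 h = 1 := by
    rw [mul_hpart hg, h₁, zero_add, hpart_of_mem one_mem_homogeneous]
  have h3 : h * (g * hpart 0 h) = h := by rw [this, Matrix.mul_one]
  rw [← Matrix.mul_assoc, h₂, Matrix.one_mul] at h3
  rw [← h3]
  exact hpart_mem 0 h

theorem exists_left_inverse_of_injective {m l : Type*} [Fintype m] [DecidableEq m] [Fintype l]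
    [DecidableEq l] {F : Matrix l m k} (hF : Function.Injective F.mulVec) :
    ∃ L : Matrix m l k, L * F = 1 := by
  obtain ⟨L, hL⟩ := (Matrix.toLin' F).exists_leftInverse_of_injective (LinearMap.ker_eq_bot.2 hF)
  refine ⟨LinearMap.toMatrix' L, ?_⟩
  rw [← LinearMap.toMatrix'_toLin' F, ← LinearMap.toMatrix'_comp, hL, LinearMap.toMatrix'_id]

theorem le_of_mul_eq_one {g : Matrix (Idx e) (Idx d) k} {h : Matrix (Idx d) (Idx e) k}
    (hg : g ∈ homogeneous k d e 0) (h₁ : g * h = 1) : e ≤ d := by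
  intro i
  let g' : Matrix (Fin (e i)) (Fin (d i)) k := g.submatrix (fun a => ⟨i, a⟩) fun a => ⟨i, a⟩
  let h' : Matrix (Fin (d i)) (Fin (e i)) k := h.submatrix (fun a => ⟨i, a⟩) fun a => ⟨i, a⟩
  have key : g' * h' = 1 := by
    ext a b
    have h2 := congrFun (congrFun h₁ ⟨i, a⟩) ⟨i, b⟩
    rw [Matrix.mul_apply, Fintype.sum_sigma, Finset.sum_eq_single i] at h2
    · rw [Matrix.mul_apply]
      refine h2.trans ?_
      simp [Matrix.one_apply]
    · intro j _ hj
      refine Finset.sum_eq_zero fun c _ => ?_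
      rw [hg ⟨i, a⟩ ⟨j, c⟩, zero_mul]
      simp only [add_zero, Nat.cast_inj, ne_eq]
      exact fun h => hj (Fin.ext h.symm)
    · simp
  have h3 := Matrix.rank_mul_le_left g' h'
  rw [key, Matrix.rank_one, Fintype.card_fin] at h3
  exact h3.trans (by simpa using g'.rank_le_width)

/-- A decomposition `V ≅ V₁ ⊕ V₂` of graded vector spaces: the inclusions `S`, `F` and the
projections `G`, `R`. In an extension `0 → x₂ → x → x₁ → 0` the maps `F` and `G` are those of the
sequence, `S` is a section of `G`, and `R` is a retraction of `F`. -/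
structure Split (k : Type*) [Field k] (d₁ d₂ d : Fin n → ℕ) where
  S : Matrix (Idx d) (Idx d₁) k
  F : Matrix (Idx d) (Idx d₂) k
  G : Matrix (Idx d₁) (Idx d) k
  R : Matrix (Idx d₂) (Idx d) k
  S_mem : S ∈ homogeneous k d₁ d 0
  F_mem : F ∈ homogeneous k d₂ d 0
  G_mem : G ∈ homogeneous k d d₁ 0
  R_mem : R ∈ homogeneous k d d₂ 0
  GS : G * S = 1
  RF : R * F = 1
  GF : G * F = 0
  RS : R * S = 0
  add : S * G + F * R = 1

variable {d₁ d₂ : Fin n → ℕ}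

theorem blockDiagonal'_mem (M : ∀ i, Matrix (Fin (e i)) (Fin (d i)) k) :
    (Matrix.blockDiagonal' M : Matrix (Idx e) (Idx d) k) ∈ homogeneous k d e 0 := by
  rintro ⟨i, a⟩ ⟨j, b⟩ h
  refine Matrix.blockDiagonal'_apply_ne _ _ _ fun hij => h ?_
  simp [hij]

/-- A decomposition of each homogeneous piece. -/
noncomputable def Split.ofEquiv
    (ε : ∀ i, (Fin (d i) → k) ≃ₗ[k] (Fin (d₁ i) → k) × (Fin (d₂ i) → k)) : Split k d₁ d₂ d where
  S := Matrix.blockDiagonal' fun i =>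
    LinearMap.toMatrix' ((ε i).symm.toLinearMap ∘ₗ LinearMap.inl k _ _)
  F := Matrix.blockDiagonal' fun i =>
    LinearMap.toMatrix' ((ε i).symm.toLinearMap ∘ₗ LinearMap.inr k _ _)
  G := Matrix.blockDiagonal' fun i =>
    LinearMap.toMatrix' (LinearMap.fst k _ _ ∘ₗ (ε i).toLinearMap)
  R := Matrix.blockDiagonal' fun i =>
    LinearMap.toMatrix' (LinearMap.snd k _ _ ∘ₗ (ε i).toLinearMap)
  S_mem := blockDiagonal'_mem _
  F_mem := blockDiagonal'_mem _
  G_mem := blockDiagonal'_mem _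
  R_mem := blockDiagonal'_mem _
  GS := by
    rw [← Matrix.blockDiagonal'_mul, ← Matrix.blockDiagonal'_one]
    congr 1
    funext i
    rw [← LinearMap.toMatrix'_comp, Pi.one_apply, ← LinearMap.toMatrix'_id]
    congr 1
    refine LinearMap.ext fun v => ?_
    simp
  RF := by
    rw [← Matrix.blockDiagonal'_mul, ← Matrix.blockDiagonal'_one]
    congr 1
    funext i
    rw [← LinearMap.toMatrix'_comp, Pi.one_apply, ← LinearMap.toMatrix'_id]
    congr 1
    refine LinearMap.ext fun v => ?_
    simp
  GF := by
    rw [← Matrix.blockDiagonal'_mul, ← Matrix.blockDiagonal'_zero]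
    congr 1
    funext i
    rw [← LinearMap.toMatrix'_comp, Pi.zero_apply, ← map_zero LinearMap.toMatrix']
    congr 1
    refine LinearMap.ext fun v => ?_
    simp
  RS := by
    rw [← Matrix.blockDiagonal'_mul, ← Matrix.blockDiagonal'_zero]
    congr 1
    funext i
    rw [← LinearMap.toMatrix'_comp, Pi.zero_apply, ← map_zero LinearMap.toMatrix']
    congr 1
    refine LinearMap.ext fun v => ?_
    simp
  add := by
    rw [← Matrix.blockDiagonal'_mul, ← Matrix.blockDiagonal'_mul, ← Matrix.blockDiagonal'_add,
      ← Matrix.blockDiagonal'_one]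
    congr 1
    funext i
    rw [Pi.add_apply, ← LinearMap.toMatrix'_comp, ← LinearMap.toMatrix'_comp, ← map_add,
      Pi.one_apply, ← LinearMap.toMatrix'_id]
    congr 1
    refine LinearMap.ext fun v => (ε i).injective ?_
    simp

theorem exists_split (k : Type*) [Field k] (d₁ d₂ : Fin n → ℕ) :
    Nonempty (Split k d₁ d₂ (d₁ + d₂)) :=
  ⟨Split.ofEquiv fun i => LinearEquiv.ofFinrankEq _ _ (by simp)⟩

theorem Split.eq_add (sp : Split k d₁ d₂ d) : d = d₁ + d₂ := by
  obtain ⟨sp'⟩ := exists_split k d₁ d₂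
  apply le_antisymm
  · refine le_of_mul_eq_one (g := sp.S * sp'.G + sp.F * sp'.R)
      (h := sp'.S * sp.G + sp'.F * sp.R) ?_ ?_
    · exact add_mem (mul_mem_homogeneous_zero sp.S_mem sp'.G_mem)
        (mul_mem_homogeneous_zero sp.F_mem sp'.R_mem)
    · rw [Matrix.add_mul, Matrix.mul_add, Matrix.mul_add]
      simp only [Matrix.mul_assoc]
      simp only [← Matrix.mul_assoc sp'.G, ← Matrix.mul_assoc sp'.R, sp'.GS, sp'.GF, sp'.RS,
        sp'.RF, Matrix.one_mul, Matrix.zero_mul, Matrix.mul_zero, add_zero, zero_add]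
      exact sp.add
  · refine le_of_mul_eq_one (h := sp.S * sp'.G + sp.F * sp'.R)
      (g := sp'.S * sp.G + sp'.F * sp.R) ?_ ?_
    · exact add_mem (mul_mem_homogeneous_zero sp'.S_mem sp.G_mem)
        (mul_mem_homogeneous_zero sp'.F_mem sp.R_mem)
    · rw [Matrix.add_mul, Matrix.mul_add, Matrix.mul_add]
      simp only [Matrix.mul_assoc]
      simp only [← Matrix.mul_assoc sp.G, ← Matrix.mul_assoc sp.R, sp.GS, sp.GF, sp.RS,
        sp.RF, Matrix.one_mul, Matrix.zero_mul, Matrix.mul_zero, add_zero, zero_add]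
      exact sp'.add

theorem exists_equiv_prod_of_subspace {m : ℕ} (W : Submodule k (Fin m → k)) :
    ∃ m₁ m₂ : ℕ, ∃ ε : (Fin m → k) ≃ₗ[k] (Fin m₁ → k) × (Fin m₂ → k),
      ∀ v, (ε v).1 = 0 ↔ v ∈ W := by
  obtain ⟨W', hW⟩ := W.exists_isCompl
  refine ⟨Module.finrank k W', Module.finrank k W,
    (Submodule.prodEquivOfIsCompl W' W hW.symm).symm ≪≫ₗ
      LinearEquiv.prodCongr (Module.finBasis k W').equivFun (Module.finBasis k W).equivFun, ?_⟩
  intro v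
  simp only [LinearEquiv.trans_apply, LinearEquiv.prodCongr_apply, LinearEquiv.map_eq_zero_iff]
  exact Submodule.prodEquivOfIsCompl_symm_apply_fst_eq_zero _ _ hW.symm

/-- The common kernel of a set of homogeneous maps of degree `0` is the second summand of a
decomposition of the graded vector space. -/
theorem exists_split_of_homogeneous (Φ : Set (Matrix (Idx e) (Idx d) k))
    (hΦ : ∀ φ ∈ Φ, φ ∈ homogeneous k d e 0) :
    ∃ d₁ d₂ : Fin n → ℕ, ∃ sp : Split k d₁ d₂ d, (∀ φ ∈ Φ, φ * sp.F = 0) ∧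
      ∀ v : Idx d → k, (∀ φ ∈ Φ, φ.mulVec v = 0) → sp.G.mulVec v = 0 := by
  let W : ∀ i : Fin n, Submodule k (Fin (d i) → k) := fun i =>
    ⨅ φ ∈ Φ, ⨅ p : Idx e, LinearMap.ker
      (∑ a, φ p ⟨i, a⟩ • LinearMap.proj (R := k) (φ := fun _ => k) a)
  have hW : ∀ i w, w ∈ W i ↔ ∀ φ ∈ Φ, ∀ p, ∑ a, φ p ⟨i, a⟩ * w a = 0 := by
    intro i w
    simp [W]
  choose m₁ m₂ ε hε using fun i => exists_equiv_prod_of_subspace (W i)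
  refine ⟨m₁, m₂, Split.ofEquiv ε, ?_, ?_⟩
  · intro φ hφ
    ext p ⟨i, c⟩
    rw [Matrix.mul_apply, Fintype.sum_sigma, Finset.sum_eq_single i]
    · simp only [Split.ofEquiv, Matrix.blockDiagonal'_apply_eq, LinearMap.toMatrix'_apply]
      refine (hW i _).1 ((hε i _).1 ?_) φ hφ p
      simp
    · intro j _ hj
      refine Finset.sum_eq_zero fun a _ => ?_
      simp only [Split.ofEquiv]
      rw [Matrix.blockDiagonal'_apply_ne _ _ _ hj, mul_zero]
    · simp
  · intro v hv
    ext ⟨i, c⟩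
    have h1 : (fun a => v ⟨i, a⟩) ∈ W i := by
      rw [hW]
      intro φ hφ p
      by_cases hp : p.1 = i
      · have h2 := congrFun (hv φ hφ) p
        rw [Matrix.mulVec, dotProduct, Fintype.sum_sigma, Finset.sum_eq_single i] at h2
        · exact h2
        · intro j _ hj
          refine Finset.sum_eq_zero fun a _ => ?_
          rw [hΦ φ hφ, zero_mul]
          simp only [add_zero, Nat.cast_inj, ne_eq]
          exact fun h => hj (Fin.ext (h.symm.trans (by rw [hp])))
        · simp
      · refine Finset.sum_eq_zero fun a _ => ?_
        rw [hΦ φ hφ, zero_mul]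
        simp only [add_zero, Nat.cast_inj, ne_eq]
        exact fun h => hp (Fin.ext h)
    have h3 := congrFun ((hε i _).2 h1) c
    rw [Matrix.mulVec, dotProduct, Fintype.sum_sigma, Finset.sum_eq_single i]
    · simp only [Split.ofEquiv, Matrix.blockDiagonal'_apply_eq]
      have h4 := congrFun (LinearMap.toMatrix'_mulVec (LinearMap.fst k _ _ ∘ₗ (ε i).toLinearMap)
        (fun a => v ⟨i, a⟩)) c
      exact h4.trans h3
    · intro j _ hj
      refine Finset.sum_eq_zero fun a _ => ?_
      simp only [Split.ofEquiv]
      rw [Matrix.blockDiagonal'_apply_ne _ _ _ (Ne.symm hj), zero_mul]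
    · simp

end Graded

/-! ### Extensions -/

section Extensions

variable {n : ℕ} {k : Type*} [Field k] {d e d₁ d₂ : Fin n → ℕ}

/-- The block triangular endomorphism of `V₁ ⊕ V₂` with diagonal blocks `A`, `B` and lower left
block `C`. -/
def Split.block (sp : Split k d₁ d₂ d) (A : Matrix (Idx d₁) (Idx d₁) k)
    (B : Matrix (Idx d₂) (Idx d₂) k) (C : Matrix (Idx d₂) (Idx d₁) k) : Matrix (Idx d) (Idx d) k :=
  sp.S * A * sp.G + sp.F * B * sp.R + sp.F * C * sp.G

theorem Split.block_mul (sp : Split k d₁ d₂ d) (A A' : Matrix (Idx d₁) (Idx d₁) k)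
    (B B' : Matrix (Idx d₂) (Idx d₂) k) (C C' : Matrix (Idx d₂) (Idx d₁) k) :
    sp.block A B C * sp.block A' B' C' = sp.block (A * A') (B * B') (B * C' + C * A') := by
  simp only [Split.block, Matrix.add_mul, Matrix.mul_add, Matrix.mul_assoc]
  simp only [← Matrix.mul_assoc sp.G, ← Matrix.mul_assoc sp.R, sp.GS, sp.GF, sp.RS,
    sp.RF, Matrix.one_mul, Matrix.zero_mul, Matrix.mul_zero, add_zero, zero_add]
  abel

theorem Split.G_mul_block (sp : Split k d₁ d₂ d) (A : Matrix (Idx d₁) (Idx d₁) k)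
    (B : Matrix (Idx d₂) (Idx d₂) k) (C : Matrix (Idx d₂) (Idx d₁) k) :
    sp.G * sp.block A B C = A * sp.G := by
  simp only [Split.block, Matrix.mul_add, Matrix.mul_assoc]
  simp only [← Matrix.mul_assoc sp.G, sp.GS, sp.GF, Matrix.one_mul, Matrix.zero_mul, add_zero]

theorem Split.block_mul_F (sp : Split k d₁ d₂ d) (A : Matrix (Idx d₁) (Idx d₁) k)
    (B : Matrix (Idx d₂) (Idx d₂) k) (C : Matrix (Idx d₂) (Idx d₁) k) :
    sp.block A B C * sp.F = sp.F * B := by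
  simp only [Split.block, Matrix.add_mul, Matrix.mul_assoc]
  simp only [sp.RF, sp.GF, Matrix.mul_one, Matrix.mul_zero, add_zero, zero_add]

/-- The extension of `x₁` by `x₂` given by the cocycle `P`. -/
def Split.ext (sp : Split k d₁ d₂ d) (x₁ : Lam k d₁) (x₂ : Lam k d₂)
    (P : Matrix (Idx d₂) (Idx d₁) k × Matrix (Idx d₂) (Idx d₁) k) (hP : P ∈ extCocycles x₁ x₂) :
    Lam k d where
  Tp := sp.block x₁.Tp x₂.Tp P.1
  Tm := sp.block x₁.Tm x₂.Tm P.2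
  Tp_mem := by
    refine add_mem (add_mem ?_ ?_) ?_
    · simpa using homogeneous_mul (homogeneous_mul sp.S_mem x₁.Tp_mem) sp.G_mem
    · simpa using homogeneous_mul (homogeneous_mul sp.F_mem x₂.Tp_mem) sp.R_mem
    · simpa using homogeneous_mul (homogeneous_mul sp.F_mem hP.1) sp.G_mem
  Tm_mem := by
    refine add_mem (add_mem ?_ ?_) ?_
    · simpa using homogeneous_mul (homogeneous_mul sp.S_mem x₁.Tm_mem) sp.G_mem
    · simpa using homogeneous_mul (homogeneous_mul sp.F_mem x₂.Tm_mem) sp.R_mem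
    · simpa using homogeneous_mul (homogeneous_mul sp.F_mem hP.2.1) sp.G_mem
  comm := by
    rw [Split.block_mul, Split.block_mul, x₁.comm, x₂.comm, hP.2.2]

/-- Transport of structure along an isomorphism of graded vector spaces. -/
def Lam.conj (x : Lam k d) (g : Matrix (Idx e) (Idx d) k) (h : Matrix (Idx d) (Idx e) k)
    (hg : g ∈ homogeneous k d e 0) (hh : h ∈ homogeneous k e d 0) (hgh : h * g = 1) :
    Lam k e where
  Tp := g * x.Tp * h
  Tm := g * x.Tm * h
  Tp_mem := by simpa using homogeneous_mul (homogeneous_mul hg x.Tp_mem) hh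
  Tm_mem := by simpa using homogeneous_mul (homogeneous_mul hg x.Tm_mem) hh
  comm := by
    have key : ∀ A B : Matrix (Idx d) (Idx d) k, g * A * h * (g * B * h) = g * (A * B) * h := by
      intro A B
      simp only [Matrix.mul_assoc]
      rw [← Matrix.mul_assoc h, hgh, Matrix.one_mul]
    rw [key, key, x.comm]

theorem fitsInSES_of_split {sp : Split k d₁ d₂ d} {x₂ : Lam k d₂} {x : Lam k d} {x₁ : Lam k d₁}
    (hF : sp.F ∈ homSpace x₂ x) (hG : sp.G ∈ homSpace x x₁) : FitsInSES x₂ x x₁ := by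
  refine ⟨sp.F, hF, sp.G, hG, ?_, ?_, ?_⟩
  · intro v w h
    have := congrArg sp.R.mulVec h
    simpa [Matrix.mulVec_mulVec, sp.RF] using this
  · intro v
    constructor
    · intro h
      refine ⟨sp.R.mulVec v, ?_⟩
      have h1 := congrArg (fun M => Matrix.mulVec M v) sp.add
      simp only [Matrix.add_mulVec, ← Matrix.mulVec_mulVec, h, Matrix.mulVec_zero, zero_add,
        Matrix.one_mulVec] at h1
      exact h1
    · rintro ⟨w, rfl⟩
      rw [Matrix.mulVec_mulVec, sp.GF, Matrix.zero_mulVec]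
  · intro v
    exact ⟨sp.S.mulVec v, by rw [Matrix.mulVec_mulVec, sp.GS, Matrix.one_mulVec]⟩

theorem exists_split_of_fitsInSES {x₂ : Lam k d₂} {x : Lam k d} {x₁ : Lam k d₁}
    (h : FitsInSES x₂ x x₁) :
    ∃ sp : Split k d₁ d₂ d, sp.F ∈ homSpace x₂ x ∧ sp.G ∈ homSpace x x₁ := by
  obtain ⟨F, hF, G, hG, hinj, hex, hsurj⟩ := h
  obtain ⟨S, hS, hGS⟩ := exists_homogeneous_rightInverse hG.1 hsurj
  obtain ⟨L, hL⟩ := exists_left_inverse_of_injective hinj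
  have hGF : G * F = 0 := by
    refine Matrix.ext_of_mulVec_single fun i => ?_
    rw [← Matrix.mulVec_mulVec, (hex _).2 ⟨_, rfl⟩, Matrix.zero_mulVec]
  have hFL : F * L * (1 - S * G) = 1 - S * G := by
    refine Matrix.ext_of_mulVec_single fun i => ?_
    have h1 : G.mulVec ((1 - S * G).mulVec (Pi.single i 1)) = 0 := by
      rw [Matrix.mulVec_mulVec, Matrix.mul_sub, ← Matrix.mul_assoc, hGS, Matrix.mul_one,
        Matrix.one_mul, sub_self, Matrix.zero_mulVec]
    obtain ⟨w, hw⟩ := (hex _).1 h1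
    rw [← Matrix.mulVec_mulVec, ← hw, Matrix.mulVec_mulVec, Matrix.mul_assoc, hL, Matrix.mul_one]
  have hRF : L * (1 - S * G) * F = 1 := by
    rw [Matrix.mul_assoc, Matrix.sub_mul, Matrix.mul_assoc S, hGF, Matrix.mul_zero, sub_zero,
      Matrix.one_mul, hL]
  have hSG : S * G ∈ homogeneous k d d 0 := mul_mem_homogeneous_zero hS hG.1
  -- the projection onto the submodule is homogeneous because the composite `F R` is
  have hpF : ∀ N : Matrix (Idx d₂) (Idx d) k, F * N ∈ homogeneous k d d 0 →
      N ∈ homogeneous k d d₂ 0 := by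
    intro N hN
    have h1 : F * hpart 0 N = F * N := by
      rw [mul_hpart hF.1, zero_add, hpart_of_mem hN]
    have h2 : hpart 0 N = N := by
      rw [← Matrix.one_mul (hpart 0 N), ← hL, Matrix.mul_assoc, h1, ← Matrix.mul_assoc, hL,
        Matrix.one_mul]
    rw [← h2]
    exact hpart_mem 0 N
  refine ⟨⟨S, F, G, L * (1 - S * G), hS, hF.1, hG.1, hpF _ ?_, hGS, hRF, hGF, ?_, ?_⟩, hF, hG⟩
  · rw [← Matrix.mul_assoc, hFL]
    exact sub_mem one_mem_homogeneous hSG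
  · rw [Matrix.mul_assoc, Matrix.sub_mul, Matrix.one_mul, Matrix.mul_assoc, hGS, Matrix.mul_one,
      sub_self, Matrix.mul_zero]
  · rw [← Matrix.mul_assoc, hFL]
    abel

theorem Split.fitsInSES_ext (sp : Split k d₁ d₂ d) (x₁ : Lam k d₁) (x₂ : Lam k d₂)
    (P : Matrix (Idx d₂) (Idx d₁) k × Matrix (Idx d₂) (Idx d₁) k) (hP : P ∈ extCocycles x₁ x₂) :
    FitsInSES x₂ (sp.ext x₁ x₂ P hP) x₁ :=
  fitsInSES_of_split (sp := sp)
    ⟨sp.F_mem, (sp.block_mul_F _ _ _).symm, (sp.block_mul_F _ _ _).symm⟩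
    ⟨sp.G_mem, sp.G_mul_block _ _ _, sp.G_mul_block _ _ _⟩

theorem Split.eq_block (sp : Split k d₁ d₂ d) {T : Matrix (Idx d) (Idx d) k}
    {A : Matrix (Idx d₁) (Idx d₁) k} {B : Matrix (Idx d₂) (Idx d₂) k} (hF : sp.F * B = T * sp.F)
    (hG : sp.G * T = A * sp.G) : T = sp.block A B (sp.R * T * sp.S) := by
  have h1 : T = (sp.S * sp.G + sp.F * sp.R) * T * (sp.S * sp.G + sp.F * sp.R) := by
    rw [sp.add, Matrix.one_mul, Matrix.mul_one]
  conv_lhs => rw [h1]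
  have h2 : sp.S * sp.G * T = sp.S * A * sp.G := by rw [Matrix.mul_assoc, hG, Matrix.mul_assoc]
  have h3 : T * (sp.F * sp.R) = sp.F * B * sp.R := by rw [← Matrix.mul_assoc, ← hF]
  rw [Matrix.add_mul, h2, Matrix.mul_add, Matrix.add_mul, Matrix.add_mul,
    Matrix.mul_assoc (sp.F * sp.R) T (sp.F * sp.R), h3]
  simp only [Split.block, Matrix.mul_assoc]
  simp only [← Matrix.mul_assoc sp.G, ← Matrix.mul_assoc sp.R, sp.GS, sp.GF,
    sp.RF, Matrix.one_mul, Matrix.zero_mul, Matrix.mul_zero]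
  abel

theorem exists_eq_ext_of_split {x₂ : Lam k d₂} {x : Lam k d} {x₁ : Lam k d₁}
    (sp : Split k d₁ d₂ d) (hF : sp.F ∈ homSpace x₂ x) (hG : sp.G ∈ homSpace x x₁) :
    ∃ P, ∃ hP : P ∈ extCocycles x₁ x₂, x = sp.ext x₁ x₂ P hP := by
  have hp := sp.eq_block hF.2.1 hG.2.1
  have hm := sp.eq_block hF.2.2 hG.2.2
  refine ⟨(sp.R * x.Tp * sp.S, sp.R * x.Tm * sp.S), ⟨?_, ?_, ?_⟩, Lam.ext hp hm⟩
  · simpa using homogeneous_mul (homogeneous_mul sp.R_mem x.Tp_mem) sp.S_mem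
  · simpa using homogeneous_mul (homogeneous_mul sp.R_mem x.Tm_mem) sp.S_mem
  · have h1 := x.comm
    rw [hp, hm, sp.block_mul, sp.block_mul, x₁.comm, x₂.comm] at h1
    simp only [Split.block, add_right_inj] at h1
    have h2 := congrArg (fun M => sp.R * M * sp.S) h1
    simp only [Matrix.mul_assoc] at h2
    simp only [← Matrix.mul_assoc sp.R, sp.GS, sp.RF,
      Matrix.one_mul, Matrix.mul_one] at h2
    simpa only [Matrix.mul_assoc] using h2

/-- The change of decomposition, as an automorphism. -/
theorem Split.ext_eq_conj (sp sp' : Split k d₁ d₂ d) (x₁ : Lam k d₁) (x₂ : Lam k d₂)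
    (P : Matrix (Idx d₂) (Idx d₁) k × Matrix (Idx d₂) (Idx d₁) k) (hP : P ∈ extCocycles x₁ x₂) :
    ∃ g ∈ homogeneous k d d 0, ∃ h : Matrix (Idx d) (Idx d) k, g * h = 1 ∧
      (sp'.ext x₁ x₂ P hP).Tp = g * (sp.ext x₁ x₂ P hP).Tp * h ∧
      (sp'.ext x₁ x₂ P hP).Tm = g * (sp.ext x₁ x₂ P hP).Tm * h := by
  refine ⟨sp'.S * sp.G + sp'.F * sp.R, add_mem (mul_mem_homogeneous_zero sp'.S_mem sp.G_mem)
    (mul_mem_homogeneous_zero sp'.F_mem sp.R_mem), sp.S * sp'.G + sp.F * sp'.R, ?_, ?_, ?_⟩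
  · rw [Matrix.add_mul, Matrix.mul_add, Matrix.mul_add]
    simp only [Matrix.mul_assoc]
    simp only [← Matrix.mul_assoc sp.G, ← Matrix.mul_assoc sp.R, sp.GS, sp.GF, sp.RS,
      sp.RF, Matrix.one_mul, Matrix.zero_mul, Matrix.mul_zero, add_zero, zero_add]
    exact sp'.add
  all_goals
    simp only [Split.ext, Split.block, Matrix.add_mul, Matrix.mul_add]
    simp only [Matrix.mul_assoc]
    simp only [← Matrix.mul_assoc sp.G, ← Matrix.mul_assoc sp.R, sp.GS, sp.GF, sp.RS,
      sp.RF, Matrix.one_mul, Matrix.zero_mul, Matrix.mul_zero, add_zero, zero_add]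
    abel

end Extensions

/-! ### The dimension of `Ext¹` -/

section ExtDim

variable {n : ℕ} {k : Type*} [Field k] {d e : Fin n → ℕ}

/-- The linear map whose kernel is the space of extensions of `x` by `y`. -/
def cocycleMap (x : Lam k d) (y : Lam k e) :
    (homogeneous k d e 1 × homogeneous k d e (-1)) →ₗ[k] homogeneous k d e 0 where
  toFun P := ⟨y.Tp * P.2.1 + P.1.1 * x.Tm - (y.Tm * P.1.1 + P.2.1 * x.Tp), by
    refine sub_mem (add_mem ?_ ?_) (add_mem ?_ ?_)
    · simpa using homogeneous_mul y.Tp_mem P.2.2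
    · simpa using homogeneous_mul P.1.2 x.Tm_mem
    · simpa using homogeneous_mul y.Tm_mem P.1.2
    · simpa using homogeneous_mul P.2.2 x.Tp_mem⟩
  map_add' P Q := by
    ext1
    simp only [Prod.fst_add, Prod.snd_add, Submodule.coe_add, Matrix.mul_add, Matrix.add_mul]
    abel
  map_smul' c P := by
    ext1
    simp [smul_sub]

theorem cocycleMap_eq_zero_iff (x : Lam k d) (y : Lam k e)
    (P : homogeneous k d e 1 × homogeneous k d e (-1)) :
    cocycleMap x y P = 0 ↔ (P.1.1, P.2.1) ∈ extCocycles x y := by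
  rw [Subtype.ext_iff]
  refine (sub_eq_zero (a := y.Tp * P.2.1 + P.1.1 * x.Tm)).trans ?_
  exact ⟨fun h => ⟨P.1.2, P.2.2, h⟩, fun h => h.2.2⟩

/-- The trace pairing between homogeneous maps of degree `0` in opposite directions. -/
noncomputable def tracePairing (k : Type*) [Field k] (d e : Fin n → ℕ) :
    homogeneous k e d 0 →ₗ[k] Module.Dual k (homogeneous k d e 0) where
  toFun F :=
    { toFun := fun G => (F.1 * G.1).trace
      map_add' := fun G H => by simp [Matrix.mul_add]
      map_smul' := fun c G => by simp }
  map_add' F F' := by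
    ext G
    simp [Matrix.add_mul]
  map_smul' c F := by
    ext G
    simp

theorem tracePairing_apply (F : homogeneous k e d 0) (G : homogeneous k d e 0) :
    tracePairing k d e F G = (F.1 * G.1).trace := rfl

theorem single_mem_homogeneous {r : ℤ} {a : Idx e} {b : Idx d}
    (h : ((a.1 : ℕ) : ℤ) = ((b.1 : ℕ) : ℤ) + r) (c : k) :
    Matrix.single a b c ∈ homogeneous k d e r := by
  intro i j hij
  refine Matrix.single_apply_of_ne _ _ _ _ _ ?_
  rintro ⟨rfl, rfl⟩
  exact hij h

/-- A matrix of degree `-r` that is orthogonal to all matrices of degree `r` vanishes. -/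
theorem eq_zero_of_trace_mul {r s : ℤ} (hrs : r + s = 0) {F : Matrix (Idx d) (Idx e) k}
    (hF : F ∈ homogeneous k e d s)
    (h : ∀ G ∈ homogeneous k d e r, (F * G).trace = 0) : F = 0 := by
  ext a b
  by_cases hab : ((a.1 : ℕ) : ℤ) = ((b.1 : ℕ) : ℤ) + s
  · have := h (Matrix.single b a 1) (single_mem_homogeneous (by omega) 1)
    simpa [Matrix.trace_mul_single] using this
  · exact hF a b hab

theorem tracePairing_bijective : Function.Bijective (tracePairing k d e) := by
  constructor
  · rw [injective_iff_map_eq_zero]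
    intro F hF
    exact Subtype.ext (eq_zero_of_trace_mul (r := 0) (by simp) F.2 fun G hG =>
      LinearMap.congr_fun hF ⟨G, hG⟩)
  · intro ℓ
    have key : ∀ G : Matrix (Idx e) (Idx d) k, hpart 0 G =
        ∑ i, ∑ j, G i j • hpart 0 (Matrix.single i j (1 : k)) := by
      intro G
      ext a b
      simp only [Matrix.sum_apply, Matrix.smul_apply, hpart, Matrix.of_apply, smul_eq_mul,
        add_zero]
      split_ifs
      · simp [Matrix.single_apply, ite_and]
      · simp
    refine ⟨⟨hpart 0 (Matrix.of fun a b => ℓ ⟨hpart 0 (Matrix.single b a 1), hpart_mem 0 _⟩),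
      hpart_mem 0 _⟩, ?_⟩
    ext G
    have hG : G = ∑ i, ∑ j, G.1 i j •
        (⟨hpart 0 (Matrix.single i j (1 : k)), hpart_mem 0 _⟩ : homogeneous k d e 0) := by
      ext1
      simp only [AddSubmonoidClass.coe_finsetSum, SetLike.val_smul]
      rw [← key, hpart_of_mem G.2]
    rw [tracePairing_apply]
    conv_rhs => rw [hG]
    simp only [map_sum, map_smul, smul_eq_mul, Matrix.trace, Matrix.diag, Matrix.mul_apply]
    rw [Finset.sum_comm]
    refine Finset.sum_congr rfl fun i _ => Finset.sum_congr rfl fun j _ => ?_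
    simp only [hpart, Matrix.of_apply, add_zero]
    split_ifs with h
    · rw [mul_comm]
    · rw [G.2 i j (by rw [add_zero]; exact fun h' => h h'.symm), zero_mul, zero_mul]

/-- The transpose of the cocycle map is, up to the trace pairing, the boundary map for homomorphisms
in the opposite direction. -/
theorem trace_mul_cocycleMap (x : Lam k d) (y : Lam k e) (F : Matrix (Idx d) (Idx e) k)
    (P : homogeneous k d e 1 × homogeneous k d e (-1)) :
    (F * (cocycleMap x y P).1).trace =
      ((F * y.Tp - x.Tp * F) * P.2.1).trace - ((F * y.Tm - x.Tm * F) * P.1.1).trace := by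
  have h1 : (cocycleMap x y P).1 =
    y.Tp * P.2.1 + P.1.1 * x.Tm - (y.Tm * P.1.1 + P.2.1 * x.Tp) := rfl
  rw [h1]
  simp only [Matrix.mul_sub, Matrix.mul_add, Matrix.sub_mul, Matrix.trace_sub, Matrix.trace_add,
    ← Matrix.mul_assoc]
  rw [Matrix.trace_mul_comm (F * P.1.1) x.Tm, Matrix.trace_mul_comm (F * P.2.1) x.Tp]
  simp only [← Matrix.mul_assoc]
  ring

theorem tracePairing_mem_ker_iff (x : Lam k d) (y : Lam k e) (F : homogeneous k e d 0) :
    tracePairing k d e F ∈ LinearMap.ker (cocycleMap x y).dualMap ↔ F.1 ∈ homSpace y x := by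
  rw [LinearMap.mem_ker]
  have hFp : F.1 * y.Tp - x.Tp * F.1 ∈ homogeneous k e d 1 :=
    sub_mem (by simpa using homogeneous_mul F.2 y.Tp_mem)
      (by simpa using homogeneous_mul x.Tp_mem F.2)
  have hFm : F.1 * y.Tm - x.Tm * F.1 ∈ homogeneous k e d (-1) :=
    sub_mem (by simpa using homogeneous_mul F.2 y.Tm_mem)
      (by simpa using homogeneous_mul x.Tm_mem F.2)
  constructor
  · intro h
    have h' : ∀ P, (F.1 * (cocycleMap x y P).1).trace = 0 := fun P => LinearMap.congr_fun h P
    refine ⟨F.2, sub_eq_zero.1 ?_, sub_eq_zero.1 ?_⟩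
    · refine eq_zero_of_trace_mul (r := -1) (by simp) hFp fun G hG => ?_
      simpa [trace_mul_cocycleMap] using h' (0, ⟨G, hG⟩)
    · refine eq_zero_of_trace_mul (r := 1) (by simp) hFm fun G hG => ?_
      simpa [trace_mul_cocycleMap] using h' (⟨G, hG⟩, 0)
  · intro h
    refine LinearMap.ext fun P => ?_
    rw [LinearMap.dualMap_apply, tracePairing_apply, trace_mul_cocycleMap, h.2.1, h.2.2]
    simp

theorem finrank_range_cocycleMap (x : Lam k d) (y : Lam k e) :
    Module.finrank k (LinearMap.range (cocycleMap x y)) + homDim y x =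
      Module.finrank k (homogeneous k d e 0) := by
  let T := LinearEquiv.ofBijective (tracePairing k d e) tracePairing_bijective
  have h1 : (homSpace y x).submoduleOf (homogeneous k e d 0) =
      (LinearMap.ker (cocycleMap x y).dualMap).map T.symm.toLinearMap := by
    ext F
    rw [Submodule.mem_map_equiv, LinearEquiv.symm_symm]
    exact (tracePairing_mem_ker_iff x y F).symm
  have h2 : homDim y x = Module.finrank k (LinearMap.ker (cocycleMap x y).dualMap) := by
    rw [homDim, ← LinearEquiv.finrank_eq (Submodule.submoduleOfEquivOfLe
      (show homSpace y x ≤ homogeneous k e d 0 from fun F hF => hF.1)), h1]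
    exact LinearEquiv.finrank_map_eq T.symm _
  rw [h2, ← LinearMap.finrank_range_dualMap_eq_finrank_range,
    LinearMap.finrank_range_add_finrank_ker, Subspace.dual_finrank_eq]

/-- If there are no homomorphisms from `y` to `x`, then the cocycle condition for extensions of
`x` by `y` is a system of linear equations of maximal rank. -/
theorem cocycleMap_surjective {x : Lam k d} {y : Lam k e} (h : homDim y x = 0) :
    Function.Surjective (cocycleMap x y) := by
  have := finrank_range_cocycleMap x y
  rw [h, add_zero] at this
  exact LinearMap.range_eq_top.1 (Submodule.eq_top_of_finrank_eq this)

/-- The Euler form of the preprojective algebra: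
`dim Ext¹(x, y) - dim Hom(x, y) - dim Hom(y, x)` depends only on the graded dimensions. -/
theorem extDim_add (x : Lam k d) (y : Lam k e) :
    extDim x y + 2 * Module.finrank k (homogeneous k d e 0) =
      Module.finrank k (homogeneous k d e 1) + Module.finrank k (homogeneous k d e (-1)) +
        homDim x y + homDim y x := by
  have h1 := Submodule.finrank_quotient_add_finrank
    ((extCoboundaries x y).submoduleOf (extCocycles x y))
  rw [LinearEquiv.finrank_eq (Submodule.submoduleOfEquivOfLe (extCoboundaries_le x y))] at h1
  have h2 : Module.finrank k (extCocycles x y) +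
      Module.finrank k (LinearMap.range (cocycleMap x y)) =
      Module.finrank k (homogeneous k d e 1) + Module.finrank k (homogeneous k d e (-1)) := by
    rw [← Module.finrank_prod (M := homogeneous k d e 1) (M' := homogeneous k d e (-1)),
      ← LinearMap.finrank_range_add_finrank_ker (cocycleMap x y), add_comm]
    congr 1
    refine LinearEquiv.finrank_eq
      { toFun := fun P => ⟨(⟨P.1.1, P.2.1⟩, ⟨P.1.2, P.2.2.1⟩),
          (cocycleMap_eq_zero_iff x y _).2 P.2⟩
        invFun := fun P => ⟨(P.1.1.1, P.1.2.1), (cocycleMap_eq_zero_iff x y P.1).1 P.2⟩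
        map_add' := fun _ _ => rfl
        map_smul' := fun _ _ => rfl
        left_inv := fun _ => rfl
        right_inv := fun _ => rfl }
  have h3 : Module.finrank k (extCoboundaries x y) + homDim x y =
      Module.finrank k (homogeneous k d e 0) := by
    rw [← LinearMap.finrank_range_add_finrank_ker
      ((extBoundary x y).domRestrict (homogeneous k d e 0))]
    congr 1
    · rw [LinearMap.range_domRestrict]
      rfl
    · refine LinearEquiv.finrank_eq
        { toFun := fun F => ⟨⟨F.1, F.2.1⟩, ?_⟩
          invFun := fun F => ⟨F.1.1, F.1.2, ?_, ?_⟩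
          map_add' := fun _ _ => rfl
          map_smul' := fun _ _ => rfl
          left_inv := fun _ => rfl
          right_inv := fun _ => rfl }
      · exact Prod.ext (sub_eq_zero.2 F.2.2.1.symm) (sub_eq_zero.2 F.2.2.2.symm)
      · exact (sub_eq_zero.1 (congrArg Prod.fst F.2)).symm
      · exact (sub_eq_zero.1 (congrArg Prod.snd F.2)).symm
  have h4 := finrank_range_cocycleMap x y
  rw [extDim]
  omega

end ExtDim

/-! ### Semicontinuity of `dim Hom` -/

section HomSemicontinuity

variable {n : ℕ} {k : Type*} [Field k] {d e : Fin n → ℕ}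

/-- The linear map whose kernel is `Hom(x, y)`. -/
def homMap (x : Lam k d) (y : Lam k e) : Matrix (Idx e) (Idx d) k →ₗ[k]
    Matrix (Idx e) (Idx d) k × Matrix (Idx e) (Idx d) k × Matrix (Idx e) (Idx d) k where
  toFun F := (F - hpart 0 F, F * x.Tp - y.Tp * F, F * x.Tm - y.Tm * F)
  map_add' F G := by
    refine Prod.ext ?_ (Prod.ext ?_ ?_)
    · ext a b
      simp only [hpart, Matrix.sub_apply, Matrix.add_apply, Matrix.of_apply, Prod.fst_add]
      split_ifs <;> ring
    · simp only [Matrix.add_mul, Matrix.mul_add, Prod.fst_add, Prod.snd_add]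
      abel
    · simp only [Matrix.add_mul, Matrix.mul_add, Prod.snd_add]
      abel
  map_smul' c F := by
    refine Prod.ext ?_ (Prod.ext ?_ ?_)
    · ext a b
      simp only [hpart, Matrix.sub_apply, Matrix.smul_apply, Matrix.of_apply, Prod.smul_fst,
        RingHom.id_apply, smul_eq_mul]
      split_ifs <;> ring
    · simp [smul_sub]
    · simp [smul_sub]

theorem ker_homMap (x : Lam k d) (y : Lam k e) : LinearMap.ker (homMap x y) = homSpace x y := by
  ext F
  rw [LinearMap.mem_ker]
  constructor
  · intro h
    refine ⟨?_, sub_eq_zero.1 (congrArg (fun P => P.2.1) h),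
      sub_eq_zero.1 (congrArg (fun P => P.2.2) h)⟩
    rw [sub_eq_zero.1 (congrArg (fun P => P.1) h : F - hpart 0 F = 0)]
    exact hpart_mem 0 F
  · intro h
    refine Prod.ext (sub_eq_zero.2 (hpart_of_mem h.1).symm)
      (Prod.ext (sub_eq_zero.2 h.2.1) (sub_eq_zero.2 h.2.2))

theorem finrank_ker_homMap (x : Lam k d) (y : Lam k e) :
    Module.finrank k (LinearMap.ker (homMap x y)) = homDim x y := by
  rw [ker_homMap, homDim]

theorem regMap_homMap_left (y : Lam k e) (F : Matrix (Idx e) (Idx d) k) :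
    RegMap (regLam k d) fun x => homMap x y F :=
  (RegMap.const _).prodMk
    ((((RegMap.const F).mul regMap_Tp).sub (RegMap.const _)).prodMk
      (((RegMap.const F).mul regMap_Tm).sub (RegMap.const _)))

theorem regMap_homMap_right (x : Lam k d) (F : Matrix (Idx e) (Idx d) k) :
    RegMap (regLam k e) fun y => homMap x y F :=
  (RegMap.const _).prodMk
    (((RegMap.const _).sub (regMap_Tp.mul (RegMap.const F))).prodMk
      ((RegMap.const _).sub (regMap_Tm.mul (RegMap.const F))))

/-- A homomorphism `x₀ → y` extends to a regular family of homomorphisms `x → y`, for the `x` near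
`x₀` with `dim Hom(x, y) = dim Hom(x₀, y)`. -/
theorem exists_hom_section (x₀ : Lam k d) (y : Lam k e) :
    ∃ D ∈ regLam k d, D x₀ ≠ 0 ∧ (∀ x, D x ≠ 0 → homDim x y ≤ homDim x₀ y) ∧
      ∀ F ∈ homSpace x₀ y, ∃ σ : Lam k d → Matrix (Idx e) (Idx d) k, RegMap (regLam k d) σ ∧
        σ x₀ = F ∧ ∀ x, D x ≠ 0 → homDim x y = homDim x₀ y → σ x ∈ homSpace x y := by
  obtain ⟨D, hD, hD0, h1, h2⟩ := exists_ker_section (fun F => regMap_homMap_left y F) x₀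
  simp only [finrank_ker_homMap] at h1 h2
  refine ⟨D, hD, hD0, h1, fun F hF => ?_⟩
  obtain ⟨σ, hσ, hσ0, h3⟩ := h2 F (by rwa [ker_homMap])
  refine ⟨σ, hσ, hσ0, fun x hx hx' => ?_⟩
  rw [← ker_homMap]
  exact h3 x hx hx'

theorem isOpen_homDim_left (y : Lam k e) (c : ℕ) : IsOpen {x : Lam k d | homDim x y ≤ c} := by
  refine isOpen_iff_forall_mem_open.2 fun x₀ hx₀ => ?_
  obtain ⟨D, hD, hD0, h1, -⟩ := exists_hom_section x₀ y
  exact ⟨_, fun x hx => (h1 x hx).trans hx₀, isOpen_ne_zero hD, hD0⟩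

theorem isOpen_homDim_right (x : Lam k d) (c : ℕ) : IsOpen {y : Lam k e | homDim x y ≤ c} := by
  refine isOpen_iff_forall_mem_open.2 fun y₀ hy₀ => ?_
  obtain ⟨D, hD, hD0, h1, -⟩ := exists_ker_section (fun F => regMap_homMap_right x F) y₀
  simp only [finrank_ker_homMap] at h1
  exact ⟨_, fun y hy => (h1 y hy).trans hy₀, isOpen_ne_zero hD, hD0⟩

theorem homDim_eq_zero_iff {x : Lam k d} {y : Lam k e} : homDim x y = 0 ↔ homSpace x y = ⊥ :=
  Submodule.finrank_eq_zero

end HomSemicontinuity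

/-! ### The family of all extensions -/

section Family

variable {n : ℕ} {k : Type*} [Field k] {d e d₁ d₂ : Fin n → ℕ}

theorem regMap_subtype {X : Type*} {A : Subalgebra k (X → k)} {E : Type*} [AddCommGroup E]
    [Module k E] {S : Submodule k E} {f : X → S} (hf : RegMap A fun x => (f x : E)) :
    RegMap A f := by
  intro ℓ
  obtain ⟨ℓ', hℓ⟩ := LinearMap.exists_extend ℓ
  have := hf ℓ'
  rw [← hℓ]
  exact this

/-- The action of an automorphism of the graded vector space. -/
noncomputable def Lam.act (x : Lam k d) (g : homogeneous k d d 0) (hg : g.1.det ≠ 0) : Lam k d :=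
  x.conj g.1 g.1⁻¹ g.2
    (mem_homogeneous_of_inverse g.2 (Matrix.mul_nonsing_inv _ (isUnit_iff_ne_zero.2 hg))
      (Matrix.nonsing_inv_mul _ (isUnit_iff_ne_zero.2 hg)))
    (Matrix.nonsing_inv_mul _ (isUnit_iff_ne_zero.2 hg))

/-- An isomorphism of modules with the same underlying graded vector space. -/
theorem eq_act_of_iso {x y : Lam k d} {g : Matrix (Idx d) (Idx d) k} (hg : g ∈ homSpace x y)
    (hu : IsUnit g.det) : y = x.act ⟨g, hg.1⟩ hu.ne_zero := by
  refine Lam.ext ?_ ?_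
  · change y.Tp = g * x.Tp * g⁻¹
    rw [hg.2.1, Matrix.mul_assoc, Matrix.mul_nonsing_inv _ hu, Matrix.mul_one]
  · change y.Tm = g * x.Tm * g⁻¹
    rw [hg.2.2, Matrix.mul_assoc, Matrix.mul_nonsing_inv _ hu, Matrix.mul_one]

theorem act_mem_homSpace (x : Lam k d) (g : homogeneous k d d 0) (hg : g.1.det ≠ 0) :
    g.1 ∈ homSpace x (x.act g hg) := by
  refine ⟨g.2, ?_, ?_⟩
  · change g.1 * x.Tp = g.1 * x.Tp * g.1⁻¹ * g.1
    rw [Matrix.mul_assoc _ g.1⁻¹, Matrix.nonsing_inv_mul _ (isUnit_iff_ne_zero.2 hg),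
      Matrix.mul_one]
  · change g.1 * x.Tm = g.1 * x.Tm * g.1⁻¹ * g.1
    rw [Matrix.mul_assoc _ g.1⁻¹, Matrix.nonsing_inv_mul _ (isUnit_iff_ne_zero.2 hg),
      Matrix.mul_one]

/-- The parameters of an extension of `x₁` by `x₂`: a linear map `B` and a vector `s` that
determine a cocycle by `kerProj`, and an automorphism `g` of the graded vector space. -/
abbrev ExtParam (k : Type*) [Field k] (d₁ d₂ d : Fin n → ℕ) : Type _ :=
  ((Fin (Module.finrank k (homogeneous k d₁ d₂ 0)) → k) →ₗ[k]
    (homogeneous k d₁ d₂ 1 × homogeneous k d₁ d₂ (-1))) ×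
  (homogeneous k d₁ d₂ 1 × homogeneous k d₁ d₂ (-1)) × homogeneous k d d 0

/-- The automorphism, as a function of the parameters. -/
def autParam (k : Type*) [Field k] (d₁ d₂ d : Fin n → ℕ) :
    ExtParam k d₁ d₂ d →ₗ[k] Matrix (Idx d) (Idx d) k where
  toFun w := w.2.2.1
  map_add' _ _ := rfl
  map_smul' _ _ := rfl

/-- The vector to be projected to a cocycle, as a function of the parameters. -/
def vecParam (k : Type*) [Field k] (d₁ d₂ d : Fin n → ℕ) :
    ExtParam k d₁ d₂ d →ₗ[k] (homogeneous k d₁ d₂ 1 × homogeneous k d₁ d₂ (-1)) where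
  toFun w := w.2.1
  map_add' _ _ := rfl
  map_smul' _ _ := rfl

/-- The value of the linear map `B` at a fixed vector, as a function of the parameters. -/
def mapParam (k : Type*) [Field k] (d₁ d₂ d : Fin n → ℕ)
    (v : Fin (Module.finrank k (homogeneous k d₁ d₂ 0)) → k) :
    ExtParam k d₁ d₂ d →ₗ[k] (homogeneous k d₁ d₂ 1 × homogeneous k d₁ d₂ (-1)) where
  toFun w := w.1 v
  map_add' _ _ := rfl
  map_smul' _ _ := rfl

/-- The determinant of the automorphism, as a function of the parameters. -/
def detParam (k : Type*) [Field k] (d₁ d₂ d : Fin n → ℕ) (w : ExtParam k d₁ d₂ d) : k :=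
  (autParam k d₁ d₂ d w).det

theorem detParam_mem : detParam k d₁ d₂ d ∈ polyFun k (ExtParam k d₁ d₂ d) :=
  RegMap.det (M := fun w => autParam k d₁ d₂ d w) (regMap_polyFun _)

/-- The linear equations of the space of cocycles, in coordinates. -/
noncomputable def cocycleEqs (x₁ : Lam k d₁) (x₂ : Lam k d₂) :
    (homogeneous k d₁ d₂ 1 × homogeneous k d₁ d₂ (-1)) →ₗ[k]
      (Fin (Module.finrank k (homogeneous k d₁ d₂ 0)) → k) :=
  (Module.finBasis k (homogeneous k d₁ d₂ 0)).equivFun.toLinearMap ∘ₗ cocycleMap x₁ x₂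

theorem kerProj_mem_extCocycles (x₁ : Lam k d₁) (x₂ : Lam k d₂) (w : ExtParam k d₁ d₂ d) :
    ((kerProj (cocycleEqs x₁ x₂) w.1 w.2.1).1.1, (kerProj (cocycleEqs x₁ x₂) w.1 w.2.1).2.1) ∈
      extCocycles x₁ x₂ := by
  rw [← cocycleMap_eq_zero_iff]
  have := apply_kerProj (cocycleEqs x₁ x₂) w.1 w.2.1
  exact (LinearEquiv.map_eq_zero_iff (Module.finBasis k (homogeneous k d₁ d₂ 0)).equivFun).1 this

/-- The family of extensions of `x₁` by `x₂`. It depends polynomially on `x₁` and on `x₂`, and it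
contains all extensions of `x₁` by `x₂` if `Hom(x₂, x₁) = 0`. -/
noncomputable def extFamily (sp : Split k d₁ d₂ d) (x₁ : Lam k d₁) (x₂ : Lam k d₂)
    (w : {w : ExtParam k d₁ d₂ d // detParam k d₁ d₂ d w ≠ 0}) : Lam k d :=
  (sp.ext x₁ x₂ _ (kerProj_mem_extCocycles x₁ x₂ w.1)).act w.1.2.2 w.2

theorem RegMap.block {X : Type*} {A : Subalgebra k (X → k)} (sp : Split k d₁ d₂ d)
    {a : X → Matrix (Idx d₁) (Idx d₁) k} {b : X → Matrix (Idx d₂) (Idx d₂) k}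
    {c : X → Matrix (Idx d₂) (Idx d₁) k} (ha : RegMap A a) (hb : RegMap A b) (hc : RegMap A c) :
    RegMap A fun x => sp.block (a x) (b x) (c x) :=
  ((((RegMap.const _).mul ha).mul (RegMap.const _)).add
    (((RegMap.const _).mul hb).mul (RegMap.const _))).add
    (((RegMap.const _).mul hc).mul (RegMap.const _))

theorem regMap_extFamily {X : Type*} {A : Subalgebra k (X → k)} (sp : Split k d₁ d₂ d)
    {y₁ : X → Lam k d₁} {y₂ : X → Lam k d₂}
    {w : X → {w : ExtParam k d₁ d₂ d // detParam k d₁ d₂ d w ≠ 0}}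
    (h₁p : RegMap A fun x => (y₁ x).Tp) (h₁m : RegMap A fun x => (y₁ x).Tm)
    (h₂p : RegMap A fun x => (y₂ x).Tp) (h₂m : RegMap A fun x => (y₂ x).Tm)
    (hB : ∀ v, RegMap A fun x => (w x).1.1 v) (hs : RegMap A fun x => (w x).1.2.1)
    (hg : RegMap A fun x => (w x).1.2.2.1) (hg' : RegMap A fun x => (w x).1.2.2.1⁻¹) :
    (RegMap A fun x => (extFamily sp (y₁ x) (y₂ x) (w x)).Tp) ∧
      RegMap A fun x => (extFamily sp (y₁ x) (y₂ x) (w x)).Tm := by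
  have hM : ∀ P, RegMap A fun x => cocycleEqs (y₁ x) (y₂ x) P := by
    intro P
    refine RegMap.map (Module.finBasis k (homogeneous k d₁ d₂ 0)).equivFun.toLinearMap
      (f := fun x => cocycleMap (y₁ x) (y₂ x) P) (regMap_subtype ?_)
    exact ((h₂p.mul (RegMap.const _)).add ((RegMap.const _).mul h₁m)).sub
      ((h₂m.mul (RegMap.const _)).add ((RegMap.const _).mul h₁p))
  have hK := RegMap.kerProj hM hB hs
  have hK1 := hK.map ((homogeneous k d₁ d₂ 1).subtype ∘ₗ
    LinearMap.fst k (homogeneous k d₁ d₂ 1) (homogeneous k d₁ d₂ (-1)))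
  have hK2 := hK.map ((homogeneous k d₁ d₂ (-1)).subtype ∘ₗ
    LinearMap.snd k (homogeneous k d₁ d₂ 1) (homogeneous k d₁ d₂ (-1)))
  exact ⟨(hg.mul (RegMap.block sp h₁p h₂p hK1)).mul hg',
    (hg.mul (RegMap.block sp h₁m h₂m hK2)).mul hg'⟩

theorem continuous_extFamily_left (sp : Split k d₁ d₂ d) (x₂ : Lam k d₂)
    (w : {w : ExtParam k d₁ d₂ d // detParam k d₁ d₂ d w ≠ 0}) :
    Continuous fun x₁ => extFamily sp x₁ x₂ w := by
  have := regMap_extFamily sp regMap_Tp regMap_Tm (RegMap.const x₂.Tp) (RegMap.const x₂.Tm)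
    (w := fun _ => w) (fun v => RegMap.const _) (RegMap.const _) (RegMap.const _) (RegMap.const _)
  exact continuous_of_regMap this.1 this.2

theorem continuous_extFamily_right (sp : Split k d₁ d₂ d) (x₁ : Lam k d₁)
    (w : {w : ExtParam k d₁ d₂ d // detParam k d₁ d₂ d w ≠ 0}) :
    Continuous fun x₂ => extFamily sp x₁ x₂ w := by
  have := regMap_extFamily sp (RegMap.const x₁.Tp) (RegMap.const x₁.Tm) regMap_Tp regMap_Tm
    (w := fun _ => w) (fun v => RegMap.const _) (RegMap.const _) (RegMap.const _) (RegMap.const _)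
  exact continuous_of_regMap this.1 this.2

theorem isPreirreducible_range_extFamily [Infinite k] (sp : Split k d₁ d₂ d) (x₁ : Lam k d₁)
    (x₂ : Lam k d₂) : IsPreirreducible (Set.range (extFamily sp x₁ x₂)) := by
  have hq := detParam_mem (k := k) (d₁ := d₁) (d₂ := d₂) (d := d)
  have hB : ∀ v, RegMap (locAlg _ _ hq) fun x => x.1.1 v := fun v =>
    (regMap_polyFun (mapParam k d₁ d₂ d v)).restrict hq
  have hs : RegMap (locAlg _ _ hq) fun x => x.1.2.1 :=
    (regMap_polyFun (vecParam k d₁ d₂ d)).restrict hq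
  have hg : RegMap (locAlg _ _ hq) fun x => x.1.2.2.1 :=
    (regMap_polyFun (autParam k d₁ d₂ d)).restrict hq
  have := regMap_extFamily sp (RegMap.const x₁.Tp) (RegMap.const x₁.Tm) (RegMap.const x₂.Tp)
    (RegMap.const x₂.Tm) (w := fun w => w) hB hs hg (hg.inv (inv_mem_locAlg hq))
  exact isPreirreducible_range ((noZeroDiv_polyFun _).locAlg hq) this.1 this.2

theorem fitsInSES_act {x₂ : Lam k d₂} {x : Lam k d} {x₁ : Lam k d₁} (h : FitsInSES x₂ x x₁)
    (g : homogeneous k d d 0) (hg : g.1.det ≠ 0) : FitsInSES x₂ (x.act g hg) x₁ := by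
  obtain ⟨sp, hF, hG⟩ := exists_split_of_fitsInSES h
  have h1 := act_mem_homSpace x g hg
  have hu := isUnit_iff_ne_zero.2 hg
  have hinv := mem_homogeneous_of_inverse g.2 (Matrix.mul_nonsing_inv _ hu)
    (Matrix.nonsing_inv_mul _ hu)
  have ee : ∀ {a b : Fin n → ℕ} (M : Matrix (Idx a) (Idx d) k) (N : Matrix (Idx d) (Idx b) k),
      M * g.1⁻¹ * (g.1 * N) = M * N := by
    intro a b M N
    rw [Matrix.mul_assoc, ← Matrix.mul_assoc _ g.1, Matrix.nonsing_inv_mul _ hu, Matrix.one_mul]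
  let sp' : Split k d₁ d₂ d :=
    { S := g.1 * sp.S
      F := g.1 * sp.F
      G := sp.G * g.1⁻¹
      R := sp.R * g.1⁻¹
      S_mem := mul_mem_homogeneous_zero g.2 sp.S_mem
      F_mem := mul_mem_homogeneous_zero g.2 sp.F_mem
      G_mem := mul_mem_homogeneous_zero sp.G_mem hinv
      R_mem := mul_mem_homogeneous_zero sp.R_mem hinv
      GS := (ee _ _).trans sp.GS
      RF := (ee _ _).trans sp.RF
      GF := (ee _ _).trans sp.GF
      RS := (ee _ _).trans sp.RS
      add := by
        have : g.1 * sp.S * (sp.G * g.1⁻¹) + g.1 * sp.F * (sp.R * g.1⁻¹) =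
            g.1 * (sp.S * sp.G + sp.F * sp.R) * g.1⁻¹ := by
          simp only [Matrix.mul_add, Matrix.add_mul, Matrix.mul_assoc]
        rw [this, sp.add, Matrix.mul_one, Matrix.mul_nonsing_inv _ hu] }
  refine fitsInSES_of_split (sp := sp') ⟨sp'.F_mem, ?_, ?_⟩ ⟨sp'.G_mem, ?_, ?_⟩
  · change g.1 * sp.F * x₂.Tp = _ * (g.1 * sp.F)
    rw [Matrix.mul_assoc, hF.2.1, ← Matrix.mul_assoc, h1.2.1, Matrix.mul_assoc]
  · change g.1 * sp.F * x₂.Tm = _ * (g.1 * sp.F)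
    rw [Matrix.mul_assoc, hF.2.2, ← Matrix.mul_assoc, h1.2.2, Matrix.mul_assoc]
  · change sp.G * g.1⁻¹ * (g.1 * x.Tp * g.1⁻¹) = x₁.Tp * (sp.G * g.1⁻¹)
    rw [Matrix.mul_assoc g.1, ee, ← Matrix.mul_assoc, hG.2.1, Matrix.mul_assoc]
  · change sp.G * g.1⁻¹ * (g.1 * x.Tm * g.1⁻¹) = x₁.Tm * (sp.G * g.1⁻¹)
    rw [Matrix.mul_assoc g.1, ee, ← Matrix.mul_assoc, hG.2.2, Matrix.mul_assoc]

theorem fitsInSES_extFamily (sp : Split k d₁ d₂ d) (x₁ : Lam k d₁) (x₂ : Lam k d₂)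
    (w : {w : ExtParam k d₁ d₂ d // detParam k d₁ d₂ d w ≠ 0}) :
    FitsInSES x₂ (extFamily sp x₁ x₂ w) x₁ :=
  fitsInSES_act (sp.fitsInSES_ext _ _ _ _) _ _

theorem exists_extFamily_eq (sp : Split k d₁ d₂ d) {x₂ : Lam k d₂} {x : Lam k d} {x₁ : Lam k d₁}
    (h0 : homDim x₂ x₁ = 0) (h : FitsInSES x₂ x x₁) : ∃ w, extFamily sp x₁ x₂ w = x := by
  obtain ⟨sp', hF, hG⟩ := exists_split_of_fitsInSES h
  obtain ⟨P, hP, rfl⟩ := exists_eq_ext_of_split sp' hF hG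
  obtain ⟨g, hg, g', hgg, hp, hm⟩ := sp.ext_eq_conj sp' x₁ x₂ P hP
  obtain ⟨B, hB⟩ := (cocycleEqs x₁ x₂).exists_rightInverse_of_surjective
    (LinearMap.range_eq_top.2 ((LinearEquiv.surjective
      (Module.finBasis k (homogeneous k d₁ d₂ 0)).equivFun).comp (cocycleMap_surjective h0)))
  let s : homogeneous k d₁ d₂ 1 × homogeneous k d₁ d₂ (-1) := (⟨P.1, hP.1⟩, ⟨P.2, hP.2.1⟩)
  have hs : cocycleEqs x₁ x₂ s = 0 :=
    (LinearEquiv.map_eq_zero_iff (Module.finBasis k (homogeneous k d₁ d₂ 0)).equivFun).2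
      ((cocycleMap_eq_zero_iff x₁ x₂ s).2 hP)
  have hdet : g.det ≠ 0 := by
    intro h
    have := congrArg Matrix.det hgg
    rw [Matrix.det_mul, h, zero_mul, Matrix.det_one] at this
    exact zero_ne_one this
  have hK : kerProj (cocycleEqs x₁ x₂) B s = s := by
    rw [kerProj_of_apply_eq_zero _ _ hs, hB, LinearMap.toMatrix'_id, Matrix.det_one, one_smul]
  have hinv : g⁻¹ = g' := Matrix.inv_eq_right_inv hgg
  refine ⟨⟨(B, s, ⟨g, hg⟩), hdet⟩, Lam.ext ?_ ?_⟩
  · rw [hp, ← hinv]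
    change g * sp.block x₁.Tp x₂.Tp (kerProj (cocycleEqs x₁ x₂) B s).1.1 * g⁻¹ = _
    rw [hK]
    rfl
  · rw [hm, ← hinv]
    change g * sp.block x₁.Tm x₂.Tm (kerProj (cocycleEqs x₁ x₂) B s).2.1 * g⁻¹ = _
    rw [hK]
    rfl

end Family

/-! ### Irreducible components and the operation `*` -/

section Star

variable {n : ℕ} {k : Type*} [Field k] {d d₁ d₂ : Fin n → ℕ}

theorem act_one (x : Lam k d) (h : (1 : Matrix (Idx d) (Idx d) k).det ≠ 0) :
    x.act ⟨1, one_mem_homogeneous⟩ h = x := by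
  refine Lam.ext ?_ ?_
  · change 1 * x.Tp * 1⁻¹ = x.Tp
    simp
  · change 1 * x.Tm * 1⁻¹ = x.Tm
    simp

/-- The determinant, as a function on the endomorphisms of the graded vector space. -/
def detFun (k : Type*) [Field k] (d : Fin n → ℕ) (g : homogeneous k d d 0) : k := g.1.det

theorem detFun_mem : detFun k d ∈ polyFun k (homogeneous k d d 0) :=
  RegMap.det (M := fun w => (homogeneous k d d 0).subtype w) (regMap_polyFun _)

theorem regMap_act {X : Type*} {A : Subalgebra k (X → k)} {x : X → Lam k d}
    {w : X → {g : homogeneous k d d 0 // detFun k d g ≠ 0}}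
    (hp : RegMap A fun a => (x a).Tp) (hm : RegMap A fun a => (x a).Tm)
    (hg : RegMap A fun a => (w a).1.1) (hg' : RegMap A fun a => (w a).1.1⁻¹) :
    (RegMap A fun a => ((x a).act (w a).1 (w a).2).Tp) ∧
      RegMap A fun a => ((x a).act (w a).1 (w a).2).Tm :=
  ⟨(hg.mul hp).mul hg', (hg.mul hm).mul hg'⟩

theorem isPreirreducible_range_act [Infinite k] (x : Lam k d) :
    IsPreirreducible (Set.range fun w : {g : homogeneous k d d 0 // detFun k d g ≠ 0} =>
      x.act w.1 w.2) := by
  have hg : RegMap (locAlg _ _ (detFun_mem (k := k) (d := d))) fun w => w.1.1 :=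
    (regMap_polyFun (homogeneous k d d 0).subtype).restrict detFun_mem
  have := regMap_act (RegMap.const x.Tp) (RegMap.const x.Tm) (w := fun w => w) hg
    (hg.inv (inv_mem_locAlg detFun_mem))
  exact isPreirreducible_range ((noZeroDiv_polyFun _).locAlg detFun_mem) this.1 this.2

/-- The irreducible components of `Λ(d)` are stable under isomorphisms, because the group of
automorphisms of the graded vector space is irreducible. -/
theorem mem_component_of_iso [Infinite k] {Z : Set (Lam k d)}
    (hZ : Z ∈ irreducibleComponents (Lam k d)) {x y : Lam k d} (hx : x ∈ Z)
    {g : Matrix (Idx d) (Idx d) k} (hg : g ∈ homSpace x y) (hu : IsUnit g.det) : y ∈ Z := by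
  have h1 : IsPreirreducible {y | ∃ x ∈ Z, ∃ w : {g : homogeneous k d d 0 // detFun k d g ≠ 0},
      x.act w.1 w.2 = y} := by
    refine isPreirreducible_image2 hZ.1.2 (fun w => ?_) fun x _ => isPreirreducible_range_act x
    have := regMap_act regMap_Tp regMap_Tm (w := fun _ => w) (RegMap.const _) (RegMap.const _)
    exact continuous_of_regMap this.1 this.2
  have h2 : Z ⊆ {y | ∃ x ∈ Z, ∃ w : {g : homogeneous k d d 0 // detFun k d g ≠ 0},
      x.act w.1 w.2 = y} := fun y hy =>
    ⟨y, hy, ⟨⟨1, one_mem_homogeneous⟩, by simp [detFun]⟩, act_one _ _⟩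
  have h3 := hZ.2 ⟨hZ.1.1.mono h2, h1⟩ h2
  exact h3 ⟨x, hx, ⟨⟨g, hg.1⟩, hu.ne_zero⟩, (eq_act_of_iso hg hu).symm⟩

/-- The modules `x` with an exact sequence `0 → x₂ → x → x₁ → 0` for a pair `(x₁, x₂)` with the
property `Q`. -/
def sesSet (d : Fin n → ℕ) (Q : Lam k d₁ → Lam k d₂ → Prop) : Set (Lam k d) :=
  {x | ∃ x₁ x₂, Q x₁ x₂ ∧ FitsInSES x₂ x x₁}

/-- The members of the family of extensions over the pairs with the property `Q`. -/
def famSet (sp : Split k d₁ d₂ d) (Q : Lam k d₁ → Lam k d₂ → Prop) : Set (Lam k d) :=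
  {x | ∃ x₁ x₂, Q x₁ x₂ ∧ ∃ w, extFamily sp x₁ x₂ w = x}

theorem famSet_subset (sp : Split k d₁ d₂ d) (Q : Lam k d₁ → Lam k d₂ → Prop) :
    famSet sp Q ⊆ sesSet d Q := by
  rintro _ ⟨x₁, x₂, hQ, w, rfl⟩
  exact ⟨x₁, x₂, hQ, fitsInSES_extFamily sp x₁ x₂ w⟩

theorem sesSet_subset (sp : Split k d₁ d₂ d) {Q : Lam k d₁ → Lam k d₂ → Prop}
    (hQ : ∀ x₁ x₂, Q x₁ x₂ → homDim x₂ x₁ = 0) : sesSet d Q ⊆ famSet sp Q := by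
  rintro x ⟨x₁, x₂, h, hx⟩
  exact ⟨x₁, x₂, h, exists_extFamily_eq sp (hQ _ _ h) hx⟩

theorem isIrreducible_famSet [Infinite k] (sp : Split k d₁ d₂ d) {C₁ : Set (Lam k d₁)}
    {C₂ : Set (Lam k d₂)} (h₁ : IsIrreducible C₁) (h₂ : IsIrreducible C₂) :
    IsIrreducible (famSet sp fun x₁ x₂ => x₁ ∈ C₁ ∧ x₂ ∈ C₂) := by
  constructor
  · obtain ⟨x₁, hx₁⟩ := h₁.1
    obtain ⟨x₂, hx₂⟩ := h₂.1
    exact ⟨_, x₁, x₂, ⟨hx₁, hx₂⟩, ⟨(0, 0, ⟨1, one_mem_homogeneous⟩), by simp [detParam, autParam]⟩,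
      rfl⟩
  · have key := isPreirreducible_image2 (φ := fun x₁ (w : C₂ × _) => extFamily sp x₁ w.1.1 w.2)
      h₁.2 (fun w => continuous_extFamily_left sp w.1.1 w.2) (fun x₁ _ => by
        have := isPreirreducible_image2 (φ := fun x₂ w => extFamily sp x₁ x₂ w) h₂.2
          (fun w => continuous_extFamily_right sp x₁ w)
          (fun x₂ _ => isPreirreducible_range_extFamily sp x₁ x₂)
        convert this using 1
        ext y
        simp)
    convert key using 1
    ext y
    constructor
    · rintro ⟨x₁, x₂, ⟨h, h'⟩, w, rfl⟩
      exact ⟨x₁, h, (⟨x₂, h'⟩, w), rfl⟩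
    · rintro ⟨x₁, h, w, rfl⟩
      exact ⟨x₁, w.1.1, ⟨h, w.1.2⟩, w.2, rfl⟩

/-- A set of pairs that is dense in `C₁ × C₂` in the iterated sense carries a dense part of the
family of extensions. -/
theorem famSet_subset_closure (sp : Split k d₁ d₂ d) {C₁ O₁ : Set (Lam k d₁)}
    {C₂ : Set (Lam k d₂)} {Q : Lam k d₁ → Lam k d₂ → Prop} (h₁ : C₁ ⊆ closure O₁)
    (h₂ : ∀ x₁ ∈ O₁, C₂ ⊆ closure {x₂ | Q x₁ x₂}) :
    famSet sp (fun x₁ x₂ => x₁ ∈ C₁ ∧ x₂ ∈ C₂) ⊆ closure (famSet sp Q) := by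
  rintro _ ⟨x₁, x₂, ⟨hx₁, hx₂⟩, w, rfl⟩
  have key : ∀ y ∈ O₁, extFamily sp y x₂ w ∈ closure (famSet sp Q) := fun y hy =>
    map_mem_closure (f := fun z => extFamily sp y z w) (continuous_extFamily_right sp y w)
      (h₂ y hy hx₂)
      fun z hz => ⟨y, z, hz, w, rfl⟩
  have := map_mem_closure (f := fun z => extFamily sp z x₂ w)
    (continuous_extFamily_left sp x₂ w) (h₁ hx₁) key
  rwa [closure_closure] at this

theorem subset_closure_inter {X : Type*} [TopologicalSpace X] {C U : Set X}
    (hC : IsPreirreducible C) (hU : IsOpen U) (h : (C ∩ U).Nonempty) : C ⊆ closure (C ∩ U) := by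
  intro x hx
  rw [mem_closure_iff]
  intro V hV hxV
  obtain ⟨y, hy, hyV, hyU⟩ := hC V U hV hU ⟨x, hx, hxV⟩ h
  exact ⟨y, hyV, hy, hyU⟩

/-- If the pairs `(x₁, x₂)` in nonempty open subsets of `C₁` and `C₂` satisfy
`Hom(x₂, x₁) = 0`, then `C₁ * C₂` is the closure of the set of all extensions of such pairs,
whether or not `Ext¹(x₁, x₂)` has minimal dimension, and it is irreducible. -/
theorem star_eq_closure_sesSet [Infinite k] {C₁ U₁ : Set (Lam k d₁)} {C₂ U₂ : Set (Lam k d₂)}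
    (h₁ : IsIrreducible C₁) (h₂ : IsIrreducible C₂) (hU₁ : IsOpen U₁) (hU₂ : IsOpen U₂)
    (hn₁ : (C₁ ∩ U₁).Nonempty) (hn₂ : (C₂ ∩ U₂).Nonempty)
    (hhom : ∀ x₁ ∈ C₁ ∩ U₁, ∀ x₂ ∈ C₂ ∩ U₂, homDim x₂ x₁ = 0) :
    (star ⟨d₁, C₁⟩ ⟨d₂, C₂⟩).2 =
        closure (sesSet (d₁ + d₂) fun x₁ x₂ => x₁ ∈ C₁ ∩ U₁ ∧ x₂ ∈ C₂ ∩ U₂) ∧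
      IsIrreducible (star ⟨d₁, C₁⟩ ⟨d₂, C₂⟩).2 := by
  obtain ⟨sp⟩ := exists_split k d₁ d₂
  -- a pair with the least dimension of `Hom(x₁, x₂)`
  obtain ⟨a, ha, b, hb, hmin⟩ : ∃ a ∈ C₁, ∃ b ∈ C₂, ∀ y₁ ∈ C₁, ∀ y₂ ∈ C₂,
      homDim a b ≤ homDim y₁ y₂ := by
    have hne : {m | ∃ x ∈ C₁, ∃ y ∈ C₂, m = homDim x y}.Nonempty := by
      obtain ⟨x, hx⟩ := h₁.1
      obtain ⟨y, hy⟩ := h₂.1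
      exact ⟨_, x, hx, y, hy, rfl⟩
    obtain ⟨a, ha, b, hb, hab⟩ := Nat.sInf_mem hne
    exact ⟨a, ha, b, hb, fun y₁ h y₂ h' => hab ▸ Nat.sInf_le ⟨y₁, h, y₂, h', rfl⟩⟩
  -- a dense part of `C₁` for which the same minimum is attained on a dense part of `C₂`
  set O₁ := C₁ ∩ (U₁ ∩ {x | homDim x b ≤ homDim a b}) with hO₁
  have hO₁n : O₁.Nonempty := h₁.2 _ _ hU₁ (isOpen_homDim_left b _) hn₁ ⟨a, ha, le_refl (homDim a b)⟩
  have hO₁d : C₁ ⊆ closure O₁ :=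
    subset_closure_inter h₁.2 (hU₁.inter (isOpen_homDim_left b _)) hO₁n
  let Q : Lam k d₁ → Lam k d₂ → Prop := fun x₁ x₂ =>
    (x₁ ∈ C₁ ∩ U₁ ∧ x₂ ∈ C₂ ∩ U₂) ∧ homDim x₁ x₂ ≤ homDim a b
  have hQd : ∀ x₁ ∈ O₁, (C₂ ∩ (U₂ ∩ {x₂ | homDim x₁ x₂ ≤ homDim a b})).Nonempty := fun x₁ hx₁ =>
    h₂.2 _ _ hU₂ (isOpen_homDim_right x₁ _) hn₂ ⟨b, hb, hx₁.2.2⟩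
  have hdense : famSet sp (fun x₁ x₂ => x₁ ∈ C₁ ∧ x₂ ∈ C₂) ⊆ closure (famSet sp Q) := by
    refine famSet_subset_closure sp hO₁d fun x₁ hx₁ => ?_
    refine (subset_closure_inter h₂.2 (hU₂.inter (isOpen_homDim_right x₁ (homDim a b)))
      (hQd x₁ hx₁)).trans (closure_mono ?_)
    exact fun x₂ hx₂ => ⟨⟨⟨hx₁.1, hx₁.2.1⟩, ⟨hx₂.1, hx₂.2.1⟩⟩, hx₂.2.2⟩
  -- both inclusions compare `dim Ext¹` with `dim Hom` through the Euler form
  have hstar1 : closure (famSet sp Q) ⊆ (star ⟨d₁, C₁⟩ ⟨d₂, C₂⟩).2 := by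
    refine closure_mono ((famSet_subset sp Q).trans ?_)
    rintro x ⟨x₁, x₂, ⟨⟨hx₁, hx₂⟩, hh⟩, hx⟩
    refine ⟨x₁, hx₁.1, x₂, hx₂.1, fun (y₁ : Lam k d₁) hy₁ (y₂ : Lam k d₂) hy₂ => ?_, hx⟩
    have e1 := extDim_add x₁ x₂
    have e2 := extDim_add y₁ y₂
    have e3 := hhom x₁ hx₁ x₂ hx₂
    have e4 := hmin y₁ hy₁ y₂ hy₂
    omega
  have hstar2 : (star ⟨d₁, C₁⟩ ⟨d₂, C₂⟩).2 ⊆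
      closure (famSet sp fun x₁ x₂ => x₁ ∈ C₁ ∧ x₂ ∈ C₂) := by
    refine closure_mono ?_
    rintro x ⟨(x₁ : Lam k d₁), hx₁, (x₂ : Lam k d₂), hx₂, hle, hx⟩
    obtain ⟨c₁, hc₁⟩ := hO₁n
    obtain ⟨c₂, hc₂⟩ := hQd c₁ hc₁
    refine ⟨x₁, x₂, ⟨hx₁, hx₂⟩, exists_extFamily_eq sp ?_ hx⟩
    have e1 := extDim_add x₁ x₂
    have e2 := extDim_add c₁ c₂
    have e3 := hhom c₁ ⟨hc₁.1, hc₁.2.1⟩ c₂ ⟨hc₂.1, hc₂.2.1⟩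
    have e4 := hmin x₁ hx₁ x₂ hx₂
    have e5 := hle c₁ hc₁.1 c₂ hc₂.1
    have e6 : homDim c₁ c₂ ≤ homDim a b := hc₂.2.2
    omega
  have hfam : (star ⟨d₁, C₁⟩ ⟨d₂, C₂⟩).2 =
      closure (famSet sp fun x₁ x₂ => x₁ ∈ C₁ ∧ x₂ ∈ C₂) :=
    hstar2.antisymm ((closure_minimal hdense isClosed_closure).trans hstar1)
  refine ⟨Set.Subset.antisymm ?_ ?_, ?_⟩
  · rw [hfam]
    refine (closure_minimal hdense isClosed_closure).trans (closure_mono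
      ((famSet_subset sp Q).trans ?_))
    rintro x ⟨x₁, x₂, h, hx⟩
    exact ⟨x₁, x₂, h.1, hx⟩
  · rw [hfam]
    refine closure_mono ((sesSet_subset sp fun x₁ x₂ h => hhom x₁ h.1 x₂ h.2).trans ?_)
    rintro x ⟨x₁, x₂, h, hx⟩
    exact ⟨x₁, x₂, ⟨h.1.1, h.2.1⟩, hx⟩
  · rw [hfam]
    exact (isIrreducible_famSet sp h₁ h₂).closure

end Star

/-! ### Torsion-free modules for a basic representation -/

section Segments

variable {n : ℕ}

/-- The segment of a basic representation. -/
def BasicRep.seg : BasicRep n → Segment n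
  | .Z Δ => Δ
  | .L Δ => Δ

/-- The degree of the operator that is a Jordan block on the basic representation. -/
def BasicRep.sgn : BasicRep n → ℤ
  | .Z _ => 1
  | .L _ => -1

/-- The degree of a vertex, with the sign for which the Jordan block raises it by `1`. -/
def BasicRep.pos (σ : BasicRep n) (i : Fin n) : ℤ := σ.sgn * (i : ℕ)

/-- The position of the top of the basic representation. -/
def BasicRep.lo : BasicRep n → ℤ
  | .Z Δ => (Δ.a : ℕ)
  | .L Δ => -((Δ.b : ℕ) : ℤ)

/-- The position of the socle of the basic representation. -/
def BasicRep.hi : BasicRep n → ℤ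
  | .Z Δ => (Δ.b : ℕ)
  | .L Δ => -((Δ.a : ℕ) : ℤ)

theorem BasicRep.lo_le_hi (σ : BasicRep n) : σ.lo ≤ σ.hi := by
  cases σ with
  | Z Δ => simpa [BasicRep.lo, BasicRep.hi] using Δ.le
  | L Δ => simpa [BasicRep.lo, BasicRep.hi] using Δ.le

theorem BasicRep.exists_pos (σ : BasicRep n) {p : ℤ} (h₁ : σ.lo ≤ p) (h₂ : p ≤ σ.hi) :
    ∃ i : Fin n, σ.pos i = p := by
  cases σ with
  | Z Δ =>
    simp only [BasicRep.lo, BasicRep.hi] at h₁ h₂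
    exact ⟨⟨p.toNat, by omega⟩, by simp only [BasicRep.pos, BasicRep.sgn]; omega⟩
  | L Δ =>
    simp only [BasicRep.lo, BasicRep.hi] at h₁ h₂
    exact ⟨⟨(-p).toNat, by omega⟩, by simp only [BasicRep.pos, BasicRep.sgn]; omega⟩

theorem BasicRep.pos_injective (σ : BasicRep n) : Function.Injective σ.pos := by
  intro i j h
  cases σ <;> simp only [BasicRep.pos, BasicRep.sgn] at h <;> ext <;> omega

theorem BasicRep.mem_seg_iff (σ : BasicRep n) (i : Fin n) :
    (σ.seg.a ≤ i ∧ i ≤ σ.seg.b) ↔ σ.lo ≤ σ.pos i ∧ σ.pos i ≤ σ.hi := by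
  cases σ <;>
    simp only [BasicRep.seg, BasicRep.lo, BasicRep.hi, BasicRep.pos, BasicRep.sgn, Fin.le_def] <;>
    omega

/-- The graded dimension of the basic representation. -/
abbrev BasicRep.dim (σ : BasicRep n) : Fin n → ℕ := σ.seg.grdim

theorem BasicRep.idx_mem (σ : BasicRep n) (a : Idx σ.dim) :
    σ.lo ≤ σ.pos a.1 ∧ σ.pos a.1 ≤ σ.hi := by
  obtain ⟨i, c⟩ := a
  by_contra h
  rw [← σ.mem_seg_iff] at h
  have : σ.dim i = 0 := by simp only [BasicRep.dim, Segment.grdim, if_neg h]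
  exact (Fin.cast this c).elim0

theorem BasicRep.exists_idx (σ : BasicRep n) {p : ℤ} (h₁ : σ.lo ≤ p) (h₂ : p ≤ σ.hi) :
    ∃ a : Idx σ.dim, σ.pos a.1 = p := by
  obtain ⟨i, rfl⟩ := σ.exists_pos h₁ h₂
  have : σ.dim i = 1 := by
    simp only [BasicRep.dim, Segment.grdim, if_pos ((σ.mem_seg_iff i).2 ⟨h₁, h₂⟩)]
  exact ⟨⟨i, Fin.cast this.symm 0⟩, rfl⟩

theorem BasicRep.idx_ext (σ : BasicRep n) {a b : Idx σ.dim} (h : σ.pos a.1 = σ.pos b.1) :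
    a = b := by
  obtain ⟨i, c⟩ := a
  obtain ⟨j, c'⟩ := b
  obtain rfl := σ.pos_injective h
  have : σ.dim i ≤ 1 := by
    simp only [BasicRep.dim, Segment.grdim]
    split_ifs <;> omega
  congr 1
  ext
  omega

end Segments

section Vectors

variable {n : ℕ} {k : Type*} [Field k] {d e f : Fin n → ℕ} (σ : BasicRep n)

/-- `F` raises positions by `m`. -/
def HasDeg (m : ℤ) (F : Matrix (Idx e) (Idx d) k) : Prop :=
  ∀ a b, σ.pos a.1 ≠ σ.pos b.1 + m → F a b = 0

/-- The component of a vector in position `p`. -/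
def vpart (p : ℤ) (v : Idx d → k) : Idx d → k := fun j => if σ.pos j.1 = p then v j else 0

variable {σ}

theorem HasDeg.mul {m m' : ℤ} {F : Matrix (Idx f) (Idx e) k} {G : Matrix (Idx e) (Idx d) k}
    (hF : HasDeg σ m F) (hG : HasDeg σ m' G) : HasDeg σ (m + m') (F * G) := by
  intro a b h
  rw [Matrix.mul_apply]
  refine Finset.sum_eq_zero fun c _ => ?_
  by_cases hc : σ.pos c.1 = σ.pos b.1 + m'
  · rw [hF a c (by omega), zero_mul]
  · rw [hG c b hc, mul_zero]

theorem HasDeg.pow {F : Matrix (Idx d) (Idx d) k} (hF : HasDeg σ 1 F) (m : ℕ) :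
    HasDeg σ m (F ^ m) := by
  induction m with
  | zero =>
    intro a b h
    rw [pow_zero, Matrix.one_apply_ne]
    rintro rfl
    simp at h
  | succ m ih =>
    rw [pow_succ]
    exact_mod_cast ih.mul hF

theorem hasDeg_zero_iff {F : Matrix (Idx e) (Idx d) k} :
    HasDeg σ 0 F ↔ F ∈ homogeneous k d e 0 := by
  have key : ∀ i j : Fin n, σ.pos i ≠ σ.pos j + 0 ↔ ((i : ℕ) : ℤ) ≠ ((j : ℕ) : ℤ) + 0 := by
    intro i j
    cases σ <;> simp [BasicRep.pos, BasicRep.sgn]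
  exact forall₂_congr fun a b => imp_congr_left (key a.1 b.1)

theorem mulVec_vpart {m : ℤ} {F : Matrix (Idx e) (Idx d) k} (hF : HasDeg σ m F) (p : ℤ)
    (v : Idx d → k) : F.mulVec (vpart σ p v) = vpart σ (p + m) (F.mulVec v) := by
  ext a
  simp only [Matrix.mulVec, dotProduct, vpart]
  split_ifs with h
  · refine Finset.sum_congr rfl fun b _ => ?_
    split_ifs with h'
    · rfl
    · rw [hF a b (by omega), zero_mul, zero_mul]
  · refine Finset.sum_eq_zero fun b _ => ?_
    split_ifs with h'
    · rw [hF a b (by omega), zero_mul]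
    · rw [mul_zero]

theorem vpart_zero (p : ℤ) : vpart σ p (0 : Idx d → k) = 0 := by
  ext
  simp [vpart]

theorem vpart_vpart (p : ℤ) (v : Idx d → k) : vpart σ p (vpart σ p v) = vpart σ p v := by
  ext j
  simp only [vpart]
  split_ifs <;> rfl

theorem vpart_single (j : Idx d) :
    vpart σ (σ.pos j.1) (Pi.single j 1 : Idx d → k) = Pi.single j 1 := by
  ext i
  simp only [vpart]
  split_ifs with h
  · rfl
  · rw [Pi.single_apply, if_neg]
    rintro rfl
    exact h rfl

theorem vpart_eq_zero_of_idx {p : ℤ} (hp : ∀ j : Idx d, σ.pos j.1 ≠ p) (v : Idx d → k) :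
    vpart σ p v = 0 := by
  ext j
  simp [vpart, hp j]

end Vectors

section TorsionFree

variable {n : ℕ} {k : Type*} [Field k] {d e f : Fin n → ℕ} (σ : BasicRep n)

/-- The operator of `x` that is a Jordan block on the basic representation. -/
def Lam.up (x : Lam k d) : Matrix (Idx d) (Idx d) k :=
  match σ with
  | .Z _ => x.Tp
  | .L _ => x.Tm

/-- The operator of `x` that vanishes on the basic representation. -/
def Lam.dn (x : Lam k d) : Matrix (Idx d) (Idx d) k :=
  match σ with
  | .Z _ => x.Tm
  | .L _ => x.Tp

theorem Lam.hasDeg_up (x : Lam k d) : HasDeg σ 1 (x.up σ) := by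
  intro a b h
  cases σ with
  | Z Δ => exact x.Tp_mem a b (by simp only [BasicRep.pos, BasicRep.sgn] at h; omega)
  | L Δ => exact x.Tm_mem a b (by simp only [BasicRep.pos, BasicRep.sgn] at h; omega)

theorem Lam.hasDeg_dn (x : Lam k d) : HasDeg σ (-1) (x.dn σ) := by
  intro a b h
  cases σ with
  | Z Δ => exact x.Tm_mem a b (by simp only [BasicRep.pos, BasicRep.sgn] at h; omega)
  | L Δ => exact x.Tp_mem a b (by simp only [BasicRep.pos, BasicRep.sgn] at h; omega)

theorem Lam.up_mul_dn (x : Lam k d) : x.up σ * x.dn σ = x.dn σ * x.up σ := by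
  cases σ with
  | Z Δ => exact x.comm
  | L Δ => exact x.comm.symm

theorem mem_homSpace_iff {x : Lam k d} {y : Lam k e} {F : Matrix (Idx e) (Idx d) k} :
    F ∈ homSpace x y ↔
      F ∈ homogeneous k d e 0 ∧ F * x.up σ = y.up σ * F ∧ F * x.dn σ = y.dn σ * F := by
  cases σ with
  | Z Δ => exact Iff.rfl
  | L Δ => exact and_congr_right fun _ => and_comm

theorem mul_pow_of_comm {F : Matrix (Idx e) (Idx d) k} {A : Matrix (Idx d) (Idx d) k}
    {B : Matrix (Idx e) (Idx e) k} (h : F * A = B * F) (m : ℕ) : F * A ^ m = B ^ m * F := by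
  induction m with
  | zero => simp
  | succ m ih => rw [pow_succ, ← Matrix.mul_assoc, ih, Matrix.mul_assoc, h, ← Matrix.mul_assoc,
      ← pow_succ]

theorem homSpace_comp {x : Lam k d} {y : Lam k e} {z : Lam k f} {F : Matrix (Idx e) (Idx d) k}
    {G : Matrix (Idx f) (Idx e) k} (hG : G ∈ homSpace y z) (hF : F ∈ homSpace x y) :
    G * F ∈ homSpace x z :=
  ⟨mul_mem_homogeneous_zero hG.1 hF.1,
    by rw [Matrix.mul_assoc, hF.2.1, ← Matrix.mul_assoc, hG.2.1, Matrix.mul_assoc],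
    by rw [Matrix.mul_assoc, hF.2.2, ← Matrix.mul_assoc, hG.2.2, Matrix.mul_assoc]⟩

/-- The torsion-free modules: those with support in the segment on which the Jordan operator is
injective in all positions but the last one. These are the direct sums of submodules of the basic
representation. -/
def IsTorsionFree (x : Lam k d) : Prop :=
  (∀ j : Idx d, σ.lo ≤ σ.pos j.1 ∧ σ.pos j.1 ≤ σ.hi) ∧
    ∀ v, (x.up σ).mulVec v = 0 → ∀ j, σ.pos j.1 < σ.hi → v j = 0

variable {σ}

theorem IsTorsionFree.vpart_eq_zero {x : Lam k d} (hx : IsTorsionFree σ x) (m : ℕ) {p : ℤ}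
    (hp : p + m ≤ σ.hi) {v : Idx d → k} (h : (x.up σ ^ m).mulVec (vpart σ p v) = 0) :
    vpart σ p v = 0 := by
  induction m generalizing p v with
  | zero => simpa using h
  | succ m ih =>
    rw [pow_succ, ← Matrix.mulVec_mulVec, mulVec_vpart (x.hasDeg_up σ)] at h
    push_cast at hp
    have h1 := ih (by omega) h
    rw [← mulVec_vpart (x.hasDeg_up σ)] at h1
    ext j
    by_cases hj : σ.pos j.1 = p
    · exact hx.2 _ h1 j (by omega)
    · simp [vpart, hj]

/-- A matrix of degree `-1` that commutes with the Jordan operator of a torsion-free module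
vanishes: it maps a vector in position `p` to a vector that is killed by the power of the
operator from position `p - 1` to the last position. -/
theorem IsTorsionFree.eq_zero_of_comm {x : Lam k d} (hx : IsTorsionFree σ x)
    {B : Matrix (Idx d) (Idx d) k} (hB : HasDeg σ (-1) B) (hc : B * x.up σ = x.up σ * B) :
    B = 0 := by
  refine Matrix.ext_of_mulVec_single fun j => ?_
  rw [Matrix.zero_mulVec, ← vpart_single (σ := σ), mulVec_vpart hB]
  have hj := (hx.1 j).2
  refine hx.vpart_eq_zero ((σ.hi - σ.pos j.1).toNat + 1) (by push_cast; omega) ?_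
  rw [← mulVec_vpart hB, Matrix.mulVec_mulVec, ← mul_pow_of_comm hc, ← Matrix.mulVec_mulVec,
    mulVec_vpart ((x.hasDeg_up σ).pow _), vpart_eq_zero_of_idx, Matrix.mulVec_zero]
  intro i
  have := (hx.1 i).2
  push_cast
  omega

theorem IsTorsionFree.dn_eq_zero {x : Lam k d} (hx : IsTorsionFree σ x) : x.dn σ = 0 :=
  hx.eq_zero_of_comm (x.hasDeg_dn σ) (x.up_mul_dn σ).symm

theorem IsTorsionFree.of_injective {x : Lam k d} {y : Lam k e} (hy : IsTorsionFree σ y)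
    {F : Matrix (Idx e) (Idx d) k} (hF : F ∈ homogeneous k d e 0)
    (hc : F * x.up σ = y.up σ * F) (hinj : Function.Injective F.mulVec) : IsTorsionFree σ x := by
  have hF' : HasDeg σ 0 F := hasDeg_zero_iff.2 hF
  constructor
  · intro j
    by_contra h
    have h1 : F.mulVec (Pi.single j 1) = 0 := by
      ext i
      rw [Matrix.mulVec_single_one, Matrix.col_apply]
      refine hF' i j fun h' => h ?_
      have := hy.1 i
      rwa [h', add_zero] at this
    have h2 := congrFun (hinj (h1.trans (Matrix.mulVec_zero _).symm)) j
    simp at h2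
  · intro v hv j hj
    have h1 : (y.up σ).mulVec (F.mulVec v) = 0 := by
      rw [Matrix.mulVec_mulVec, ← hc, ← Matrix.mulVec_mulVec, hv, Matrix.mulVec_zero]
    have h2 : F.mulVec (vpart σ (σ.pos j.1) v) = 0 := by
      rw [mulVec_vpart hF']
      ext i
      simp only [vpart, Pi.zero_apply]
      split_ifs with h
      · exact hy.2 _ h1 i (by omega)
      · rfl
    have h3 := congrFun (hinj (h2.trans (Matrix.mulVec_zero _).symm)) j
    simpa [vpart] using h3

end TorsionFree

/-! ### The torsion pair of a basic representation -/

section TorsionPair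

variable {n : ℕ} {k : Type*} [Field k] {d e d₁ d₂ : Fin n → ℕ} (σ : BasicRep n)

/-- The basic representation: a single Jordan block for one of the two operators. -/
def jordanLam (k : Type*) [Field k] : (σ : BasicRep n) → Lam k σ.dim
  | .Z Δ =>
    { Tp := Δ.jordan k
      Tm := 0
      Tp_mem := fun a b h => if_neg (by omega)
      Tm_mem := zero_mem _
      comm := (Matrix.mul_zero (Δ.jordan k)).trans (Matrix.zero_mul _).symm }
  | .L Δ =>
    { Tp := 0
      Tm := (Δ.jordan k).transpose
      Tp_mem := zero_mem _
      Tm_mem := fun a b h => if_neg (by omega)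
      comm := (Matrix.zero_mul (Δ.jordan k).transpose).trans (Matrix.mul_zero _).symm }

theorem jordanLam_up (a b : Idx σ.dim) :
    (jordanLam k σ).up σ a b = if σ.pos a.1 = σ.pos b.1 + 1 then 1 else 0 := by
  cases σ with
  | Z Δ =>
    refine if_congr ?_ rfl rfl
    simp only [BasicRep.pos, BasicRep.sgn]
    omega
  | L Δ =>
    refine if_congr ?_ rfl rfl
    simp only [BasicRep.pos, BasicRep.sgn]
    omega

theorem jordanLam_dn : (jordanLam k σ).dn σ = 0 := by
  cases σ <;> rfl

variable {σ}

/-- Homomorphisms to the basic representation are given by linear forms `f` in the last position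
that vanish on the image of one operator and on the image of a power of the other one. -/
theorem exists_hom_of_functional (x : Lam k d) {f : Idx d → k}
    (hf : ∀ j, σ.pos j.1 ≠ σ.hi → f j = 0) (hD : Matrix.vecMul f (x.dn σ) = 0)
    (hU : Matrix.vecMul f (x.up σ ^ ((σ.hi - σ.lo).toNat + 1)) = 0) :
    ∃ φ ∈ homSpace x (jordanLam k σ), ∀ i j,
      φ i j = Matrix.vecMul f (x.up σ ^ (σ.hi - σ.pos i.1).toNat) j := by
  have hdeg : ∀ (m : ℕ) (j : Idx d), σ.pos j.1 + m ≠ σ.hi →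
      Matrix.vecMul f (x.up σ ^ m) j = 0 := by
    intro m j hj
    rw [Matrix.vecMul, dotProduct]
    refine Finset.sum_eq_zero fun a _ => ?_
    by_cases ha : σ.pos a.1 = σ.hi
    · rw [(x.hasDeg_up σ).pow m a j (by omega), mul_zero]
    · rw [hf a ha, zero_mul]
  refine ⟨Matrix.of fun i j => Matrix.vecMul f (x.up σ ^ (σ.hi - σ.pos i.1).toNat) j,
    (mem_homSpace_iff σ).2 ⟨?_, ?_, ?_⟩, fun i j => rfl⟩
  · rw [← hasDeg_zero_iff (σ := σ)]
    intro i j hij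
    have := (σ.idx_mem i).2
    exact hdeg _ _ (by omega)
  · ext i j
    have hL : (Matrix.of (fun i j => Matrix.vecMul f (x.up σ ^ (σ.hi - σ.pos i.1).toNat) j) *
        x.up σ) i j = Matrix.vecMul f (x.up σ ^ ((σ.hi - σ.pos i.1).toNat + 1)) j := by
      rw [pow_succ, ← Matrix.vecMul_vecMul]
      rfl
    rw [hL, Matrix.mul_apply]
    simp only [jordanLam_up, ite_mul, one_mul, zero_mul, Matrix.of_apply]
    obtain ⟨h1, h2⟩ := σ.idx_mem i
    rcases h1.eq_or_lt with h | h
    · rw [← h, hU, Pi.zero_apply]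
      refine (Finset.sum_eq_zero fun b _ => if_neg ?_).symm
      have := (σ.idx_mem b).1
      omega
    · obtain ⟨b, hb⟩ := σ.exists_idx (p := σ.pos i.1 - 1) (by omega) (by omega)
      rw [Finset.sum_eq_single b]
      · rw [if_pos (by omega), hb]
        congr 3
        omega
      · intro c _ hc
        refine if_neg fun h' => hc (σ.idx_ext ?_)
        omega
      · simp
  · rw [jordanLam_dn, Matrix.zero_mul]
    ext i j
    have hL : (Matrix.of (fun i j => Matrix.vecMul f (x.up σ ^ (σ.hi - σ.pos i.1).toNat) j) *
        x.dn σ) i j = Matrix.vecMul f (x.up σ ^ (σ.hi - σ.pos i.1).toNat * x.dn σ) j := by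
      rw [← Matrix.vecMul_vecMul]
      rfl
    rw [hL, ← mul_pow_of_comm (x.up_mul_dn σ).symm, ← Matrix.vecMul_vecMul, hD, Matrix.zero_vecMul]
    rfl

/-- A torsion-free module is cogenerated by the basic representation. -/
theorem IsTorsionFree.exists_hom {x : Lam k d} (hx : IsTorsionFree σ x) {v : Idx d → k}
    (hv : v ≠ 0) : ∃ φ ∈ homSpace x (jordanLam k σ), φ.mulVec v ≠ 0 := by
  obtain ⟨j, hj⟩ := Function.ne_iff.1 hv
  obtain ⟨hlo, hhi⟩ := hx.1 j
  have hpart : vpart σ (σ.pos j.1) v ≠ 0 := by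
    refine Function.ne_iff.2 ⟨j, ?_⟩
    simpa [vpart] using hj
  have h1 : (x.up σ ^ (σ.hi - σ.pos j.1).toNat).mulVec (vpart σ (σ.pos j.1) v) ≠ 0 :=
    fun h => hpart (hx.vpart_eq_zero _ (by omega) h)
  obtain ⟨a, ha⟩ := Function.ne_iff.1 h1
  have hapos : σ.pos a.1 = σ.hi := by
    by_contra hne
    apply ha
    rw [mulVec_vpart ((x.hasDeg_up σ).pow _)]
    simp only [vpart, Pi.zero_apply]
    exact if_neg (by omega)
  obtain ⟨φ, hφ, hφa⟩ := exists_hom_of_functional (σ := σ) x (f := Pi.single a 1)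
    (fun b hb => by rw [Pi.single_apply, if_neg]; rintro rfl; exact hb hapos)
    (by rw [hx.dn_eq_zero, Matrix.vecMul_zero])
    (by
      ext b
      rw [Matrix.single_one_vecMul, Pi.zero_apply, Matrix.row_apply]
      refine (x.hasDeg_up σ).pow _ a b ?_
      have := hx.1 b
      push_cast
      omega)
  refine ⟨φ, hφ, fun h0 => ?_⟩
  obtain ⟨i, hi⟩ := σ.exists_idx hlo hhi
  have h2 : φ.mulVec (vpart σ (σ.pos j.1) v) = 0 := by
    rw [mulVec_vpart (hasDeg_zero_iff.2 hφ.1), h0, vpart_zero]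
  apply ha
  have h3 := congrFun h2 i
  rw [Matrix.mulVec, dotProduct] at h3
  simp only [hφa, Matrix.single_one_vecMul, hi] at h3
  exact h3

/-- A module that is cogenerated by the basic representation is torsion-free. -/
theorem isTorsionFree_of_cogenerated {x : Lam k d}
    (h : ∀ v, (∀ φ ∈ homSpace x (jordanLam k σ), φ.mulVec v = 0) → v = 0) :
    IsTorsionFree σ x := by
  constructor
  · intro j
    by_contra hj
    have h1 : (Pi.single j 1 : Idx d → k) = 0 := by
      refine h _ fun φ hφ => ?_
      ext i
      rw [Matrix.mulVec_single_one, Matrix.col_apply]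
      refine hasDeg_zero_iff (σ := σ).2 hφ.1 i j fun h' => hj ?_
      have := σ.idx_mem i
      rwa [h', add_zero] at this
    have h2 := congrFun h1 j
    simp at h2
  · intro v hv j hj
    have h1 : vpart σ (σ.pos j.1) v = 0 := by
      refine h _ fun φ hφ => ?_
      have hφ0 := hasDeg_zero_iff (σ := σ).2 hφ.1
      rw [mulVec_vpart hφ0]
      ext i
      simp only [vpart, Pi.zero_apply]
      split_ifs with hi
      · obtain ⟨i', hi'⟩ := σ.exists_idx (p := σ.pos i.1 + 1)
          (by have := σ.idx_mem i; omega) (by omega)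
        have h2 : ((jordanLam k σ).up σ).mulVec (φ.mulVec v) = 0 := by
          rw [Matrix.mulVec_mulVec, ← ((mem_homSpace_iff σ).1 hφ).2.1, ← Matrix.mulVec_mulVec, hv,
            Matrix.mulVec_zero]
        have h3 := congrFun h2 i'
        rw [Matrix.mulVec, dotProduct, Finset.sum_eq_single i] at h3
        · rwa [jordanLam_up, if_pos hi', one_mul] at h3
        · intro b _ hb
          rw [jordanLam_up, if_neg, zero_mul]
          exact fun h' => hb (σ.idx_ext (by omega))
        · simp
      · rfl
    have h2 := congrFun h1 j
    simpa [vpart] using h2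

theorem isTorsionFree_jordanLam : IsTorsionFree σ (jordanLam k σ) := by
  refine isTorsionFree_of_cogenerated fun v hv => ?_
  simpa using hv 1 ⟨one_mem_homogeneous, by simp, by simp⟩

/-- There are no homomorphisms from torsion modules to torsion-free modules. -/
theorem homSpace_eq_bot_of_torsion {x₂ : Lam k d₂} (h₂ : homSpace x₂ (jordanLam k σ) = ⊥)
    {x₁ : Lam k d₁} (h₁ : IsTorsionFree σ x₁) : homSpace x₂ x₁ = ⊥ := by
  rw [eq_bot_iff]
  intro φ hφ
  refine (Submodule.mem_bot k).2 (Matrix.ext_of_mulVec_single fun j => ?_)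
  rw [Matrix.zero_mulVec]
  by_contra hne
  obtain ⟨ψ, hψ, h3⟩ := h₁.exists_hom hne
  have h4 : ψ * φ = 0 := by
    have := homSpace_comp hψ hφ
    rwa [h₂] at this
  rw [Matrix.mulVec_mulVec, h4, Matrix.zero_mulVec] at h3
  exact h3 rfl

/-- A graded subspace that is stable under both operators gives a submodule and a quotient. -/
theorem exists_sub_quotient (x : Lam k d) (sp : Split k d₁ d₂ d) (hp : sp.G * x.Tp * sp.F = 0)
    (hm : sp.G * x.Tm * sp.F = 0) :
    ∃ (x₁ : Lam k d₁) (x₂ : Lam k d₂), sp.F ∈ homSpace x₂ x ∧ sp.G ∈ homSpace x x₁ := by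
  have hG : ∀ T : Matrix (Idx d) (Idx d) k, sp.G * T * sp.F = 0 →
      sp.G * T = sp.G * T * sp.S * sp.G := by
    intro T hT
    conv_lhs => rw [← Matrix.mul_one (sp.G * T), ← sp.add, Matrix.mul_add,
      ← Matrix.mul_assoc _ sp.F, hT, Matrix.zero_mul, add_zero, ← Matrix.mul_assoc]
  have hF : ∀ T : Matrix (Idx d) (Idx d) k, sp.G * T * sp.F = 0 →
      T * sp.F = sp.F * (sp.R * T * sp.F) := by
    intro T hT
    conv_lhs => rw [← Matrix.one_mul (T * sp.F), ← sp.add, Matrix.add_mul, Matrix.mul_assoc sp.S,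
      ← Matrix.mul_assoc sp.G, hT, Matrix.mul_zero, zero_add]
    simp only [Matrix.mul_assoc]
  refine ⟨⟨sp.G * x.Tp * sp.S, sp.G * x.Tm * sp.S, ?_, ?_, ?_⟩,
    ⟨sp.R * x.Tp * sp.F, sp.R * x.Tm * sp.F, ?_, ?_, ?_⟩,
    ⟨sp.F_mem, (hF _ hp).symm, (hF _ hm).symm⟩,
    ⟨sp.G_mem, hG _ hp, hG _ hm⟩⟩
  · simpa using homogeneous_mul (homogeneous_mul sp.G_mem x.Tp_mem) sp.S_mem
  · simpa using homogeneous_mul (homogeneous_mul sp.G_mem x.Tm_mem) sp.S_mem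
  · rw [← Matrix.mul_assoc, ← Matrix.mul_assoc, ← hG _ hp, ← Matrix.mul_assoc, ← Matrix.mul_assoc,
      ← hG _ hm, Matrix.mul_assoc sp.G, x.comm, ← Matrix.mul_assoc sp.G]
  · simpa using homogeneous_mul (homogeneous_mul sp.R_mem x.Tp_mem) sp.F_mem
  · simpa using homogeneous_mul (homogeneous_mul sp.R_mem x.Tm_mem) sp.F_mem
  · rw [Matrix.mul_assoc (sp.R * x.Tp), ← hF _ hm, Matrix.mul_assoc (sp.R * x.Tm), ← hF _ hp,
      Matrix.mul_assoc sp.R, Matrix.mul_assoc sp.R, ← Matrix.mul_assoc x.Tp, x.comm,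
      Matrix.mul_assoc x.Tm]

/-- Every module has a torsion submodule with torsion-free quotient. The submodule is the common
kernel of the homomorphisms to the basic representation. -/
theorem exists_torsion_sequence (σ : BasicRep n) (x : Lam k d) :
    ∃ (d₁ d₂ : Fin n → ℕ) (x₁ : Lam k d₁) (x₂ : Lam k d₂), FitsInSES x₂ x x₁ ∧
      IsTorsionFree σ x₁ ∧ homSpace x₂ (jordanLam k σ) = ⊥ := by
  obtain ⟨d₁, d₂, sp, hsF, hsG⟩ := exists_split_of_homogeneous
    (homSpace x (jordanLam k σ) : Set (Matrix (Idx σ.dim) (Idx d) k)) fun φ hφ => hφ.1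
  have stable : ∀ T : Matrix (Idx d) (Idx d) k,
      (∃ T' : Matrix (Idx σ.dim) (Idx σ.dim) k, ∀ φ ∈ homSpace x (jordanLam k σ),
        φ * T = T' * φ) → sp.G * T * sp.F = 0 := by
    rintro T ⟨T', hT⟩
    refine Matrix.ext_of_mulVec_single fun j => ?_
    rw [Matrix.mul_assoc, ← Matrix.mulVec_mulVec, Matrix.zero_mulVec]
    refine hsG _ fun φ hφ => ?_
    rw [Matrix.mulVec_mulVec, ← Matrix.mul_assoc, hT φ hφ, Matrix.mul_assoc, hsF φ hφ,
      Matrix.mul_zero, Matrix.zero_mulVec]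
  obtain ⟨x₁, x₂, hF, hG⟩ := exists_sub_quotient x sp (stable _ ⟨_, fun φ hφ => hφ.2.1⟩)
    (stable _ ⟨_, fun φ hφ => hφ.2.2⟩)
  refine ⟨d₁, d₂, x₁, x₂, fitsInSES_of_split hF hG, isTorsionFree_of_cogenerated ?_, ?_⟩
  · intro v hv
    have h1 : sp.G.mulVec (sp.S.mulVec v) = 0 := by
      refine hsG _ fun φ hφ => ?_
      have hφS : φ * sp.S * sp.G = φ := by
        conv_rhs => rw [← Matrix.mul_one φ, ← sp.add, Matrix.mul_add, ← Matrix.mul_assoc φ sp.F,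
          hsF φ hφ, Matrix.zero_mul, add_zero, ← Matrix.mul_assoc]
      -- `φ` factors through the quotient
      have hmem : φ * sp.S ∈ homSpace x₁ (jordanLam k σ) := by
        refine ⟨mul_mem_homogeneous_zero hφ.1 sp.S_mem, ?_, ?_⟩
        · rw [← Matrix.mul_one x₁.Tp, ← sp.GS, ← Matrix.mul_assoc x₁.Tp, ← hG.2.1,
            Matrix.mul_assoc sp.G, ← Matrix.mul_assoc, hφS, ← Matrix.mul_assoc, hφ.2.1,
            Matrix.mul_assoc]
        · rw [← Matrix.mul_one x₁.Tm, ← sp.GS, ← Matrix.mul_assoc x₁.Tm, ← hG.2.2,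
            Matrix.mul_assoc sp.G, ← Matrix.mul_assoc, hφS, ← Matrix.mul_assoc, hφ.2.2,
            Matrix.mul_assoc]
      rw [Matrix.mulVec_mulVec]
      exact hv _ hmem
    rwa [Matrix.mulVec_mulVec, sp.GS, Matrix.one_mulVec] at h1
  · rw [eq_bot_iff]
    intro ψ hψ
    have hψ' := (mem_homSpace_iff σ).1 hψ
    have hψ0 := hasDeg_zero_iff (σ := σ).2 hψ.1
    have hF' := (mem_homSpace_iff σ).1 hF
    have hF0 := hasDeg_zero_iff (σ := σ).2 hF.1
    -- positions outside the segment lie in the submodule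
    have outside : ∀ p, (p < σ.lo ∨ σ.hi < p) → ∀ c : Idx d → k,
        vpart σ p c = sp.F.mulVec (sp.R.mulVec (vpart σ p c)) := by
      intro p hp c
      have h1 : sp.G.mulVec (vpart σ p c) = 0 := by
        refine hsG _ fun φ hφ => ?_
        rw [mulVec_vpart (hasDeg_zero_iff.2 hφ.1), vpart_eq_zero_of_idx]
        intro i
        have := σ.idx_mem i
        omega
      have h2 := congrArg (fun M => Matrix.mulVec M (vpart σ p c)) sp.add
      simp only [Matrix.add_mulVec, ← Matrix.mulVec_mulVec, h1, Matrix.mulVec_zero, zero_add,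
        Matrix.one_mulVec] at h2
      exact h2.symm
    -- A homomorphism `ψ` from the submodule vanishes in the last position: a vector `w` of the
    -- submodule there is a sum of values, in `x`, of the second operator and of a power of the
    -- Jordan operator, since otherwise a linear form that separates `w` from these values would
    -- give a homomorphism on `x` that is nonzero at `w`.
    have last : ∀ u : Idx d₂ → k, ψ.mulVec (vpart σ σ.hi u) = 0 := by
      intro u
      set w := sp.F.mulVec (vpart σ σ.hi u) with hw
      let N : Submodule k (Idx d → k) :=
        { carrier := {v | ∀ j, σ.pos j.1 = σ.hi → v j = 0}
          add_mem' := fun {v v'} hv hv' j hj => by simp [hv j hj, hv' j hj]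
          zero_mem' := fun j _ => rfl
          smul_mem' := fun c v hv j hj => by simp [hv j hj] }
      -- the power of the Jordan operator that leads from position `lo - 1` to position `hi`
      let m := (σ.hi - σ.lo).toNat + 1
      have hwK : w ∈ LinearMap.range (x.dn σ).mulVecLin ⊔
          LinearMap.range (x.up σ ^ m).mulVecLin ⊔ N := by
        by_contra hwK
        obtain ⟨ℓ, hℓw, hℓ⟩ := Submodule.exists_le_ker_of_notMem hwK
        let f : Idx d → k := fun j => ℓ (Pi.single j 1)
        have hℓf : ∀ v, f ⬝ᵥ v = ℓ v := by
          intro v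
          conv_rhs => rw [pi_eq_sum_univ' v]
          rw [map_sum]
          refine Finset.sum_congr rfl fun i _ => ?_
          rw [mul_comm, ← smul_eq_mul, ← map_smul]
        have hcol : ∀ T : Matrix (Idx d) (Idx d) k, (∀ v, ℓ (T.mulVec v) = 0) →
            Matrix.vecMul f T = 0 := by
          intro T hT
          ext b
          have := hT (Pi.single b 1)
          rw [← hℓf, Matrix.mulVec_single_one] at this
          exact this
        obtain ⟨φ, hφ, hφf⟩ := exists_hom_of_functional (σ := σ) x (f := f)
          (fun j hj => hℓ (Submodule.mem_sup_right fun i hi => by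
            rw [Pi.single_apply, if_neg]
            rintro rfl
            exact hj hi))
          (hcol _ fun v => hℓ (Submodule.mem_sup_left (Submodule.mem_sup_left ⟨v, rfl⟩)))
          (hcol _ fun v => hℓ (Submodule.mem_sup_left (Submodule.mem_sup_right ⟨v, rfl⟩)))
        obtain ⟨i, hi⟩ := σ.exists_idx σ.lo_le_hi le_rfl
        apply hℓw
        have h1 : φ.mulVec w = 0 := by
          rw [hw, Matrix.mulVec_mulVec, hsF φ hφ, Matrix.zero_mulVec]
        have h2 := congrFun h1 i
        rw [Matrix.mulVec, dotProduct] at h2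
        simp only [hφf, hi, sub_self, Int.toNat_zero, pow_zero, Matrix.vecMul_one] at h2
        rw [← hℓf]
        exact h2
      obtain ⟨y₁, hy₁, y, hy, hsum⟩ := Submodule.mem_sup.1 hwK
      obtain ⟨_, ⟨a, rfl⟩, _, ⟨c, rfl⟩, rfl⟩ := Submodule.mem_sup.1 hy₁
      rw [Matrix.mulVecLin_apply, Matrix.mulVecLin_apply] at hsum
      have hDa : (x.dn σ).mulVec (vpart σ (σ.hi + 1) a) = vpart σ σ.hi ((x.dn σ).mulVec a) := by
        rw [mulVec_vpart (x.hasDeg_dn σ), add_neg_cancel_right]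
      have hlo : σ.lo - 1 + (m : ℤ) = σ.hi := by
        have := σ.lo_le_hi
        simp only [m]
        omega
      have hUc : (x.up σ ^ m).mulVec (vpart σ (σ.lo - 1) c) =
          vpart σ σ.hi ((x.up σ ^ m).mulVec c) := by
        rw [mulVec_vpart ((x.hasDeg_up σ).pow m), hlo]
      have hwpart : vpart σ σ.hi w = w := by
        have h1 := mulVec_vpart hF0 σ.hi u
        rw [add_zero] at h1
        rw [hw, h1, vpart_vpart]
      have hweq : w = (x.dn σ).mulVec (vpart σ (σ.hi + 1) a) +
          (x.up σ ^ m).mulVec (vpart σ (σ.lo - 1) c) := by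
        rw [← hwpart, ← hsum, hDa, hUc]
        ext j
        simp only [vpart, Pi.add_apply]
        split_ifs with hj
        · rw [hy j hj, add_zero]
        · rw [add_zero]
      have hDF : ∀ t, (x.dn σ).mulVec (sp.F.mulVec t) = sp.F.mulVec ((x₂.dn σ).mulVec t) := by
        intro t
        rw [Matrix.mulVec_mulVec, Matrix.mulVec_mulVec, hF'.2.2]
      have hUF : ∀ t, (x.up σ ^ m).mulVec (sp.F.mulVec t) =
          sp.F.mulVec ((x₂.up σ ^ m).mulVec t) := by
        intro t
        rw [Matrix.mulVec_mulVec, Matrix.mulVec_mulVec, mul_pow_of_comm hF'.2.1]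
      -- the preimages of `w` lie in positions outside the segment, hence in the submodule, and the
      -- basic representation vanishes in these positions
      rw [outside _ (Or.inr (lt_add_one _)) a, outside _ (Or.inl (sub_one_lt _)) c,
        hDF, hUF, ← Matrix.mulVec_add, hw] at hweq
      have hu := congrArg sp.R.mulVec hweq
      rw [Matrix.mulVec_mulVec, Matrix.mulVec_mulVec, sp.RF, Matrix.one_mulVec,
        Matrix.one_mulVec] at hu
      rw [hu, Matrix.mulVec_add, Matrix.mulVec_mulVec, hψ'.2.2, jordanLam_dn, Matrix.zero_mul,
        Matrix.zero_mulVec, zero_add, Matrix.mulVec_mulVec, mul_pow_of_comm hψ'.2.1,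
        mulVec_vpart (hasDeg_zero_iff.2 sp.R_mem), ← Matrix.mulVec_mulVec, mulVec_vpart hψ0,
        vpart_eq_zero_of_idx, Matrix.mulVec_zero]
      intro i
      have := (σ.idx_mem i).1
      omega
    -- the other positions follow, since powers of the Jordan operator are injective on the target
    refine (Submodule.mem_bot k).2 (Matrix.ext_of_mulVec_single fun j => ?_)
    rw [Matrix.zero_mulVec, ← vpart_single (σ := σ), mulVec_vpart hψ0, add_zero]
    by_cases hj : σ.lo ≤ σ.pos j.1 ∧ σ.pos j.1 ≤ σ.hi
    · refine isTorsionFree_jordanLam.vpart_eq_zero (σ.hi - σ.pos j.1).toNat (by omega) ?_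
      have h1 : σ.pos j.1 + ((σ.hi - σ.pos j.1).toNat : ℤ) = σ.hi := by omega
      have h2 := mulVec_vpart hψ0 (σ.pos j.1) (Pi.single j 1)
      rw [add_zero] at h2
      rw [← h2, Matrix.mulVec_mulVec, ← mul_pow_of_comm hψ'.2.1, ← Matrix.mulVec_mulVec,
        mulVec_vpart ((x₂.hasDeg_up σ).pow _), h1]
      exact last _
    · refine vpart_eq_zero_of_idx (fun i h => hj ?_) _
      rw [← h]
      exact σ.idx_mem i

end TorsionPair

/-! ### Torsion-free modules form one open orbit -/

section Orbit

variable {n : ℕ} {k : Type*} [Field k] {d e : Fin n → ℕ} {σ : BasicRep n}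

/-- Two injective matrices of the same shape differ by an automorphism of the target. -/
theorem exists_mul_eq_of_injective {l m : Type*} [Fintype l] [DecidableEq l] [Fintype m]
    [DecidableEq m] {A B : Matrix l m k} (hA : Function.Injective A.mulVec)
    (hB : Function.Injective B.mulVec) : ∃ h h' : Matrix l l k, h * h' = 1 ∧ h * A = B := by
  let f := Matrix.toLin' A
  let g := Matrix.toLin' B
  have hf : Function.Injective f := hA
  have hg : Function.Injective g := hB
  obtain ⟨P, hP⟩ := (LinearMap.range f).exists_isCompl
  obtain ⟨Q, hQ⟩ := (LinearMap.range g).exists_isCompl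
  let ef := LinearEquiv.ofInjective f hf
  let eg := LinearEquiv.ofInjective g hg
  have hPQ : Module.finrank k P = Module.finrank k Q := by
    have h1 := Submodule.finrank_add_eq_of_isCompl hP
    have h2 := Submodule.finrank_add_eq_of_isCompl hQ
    have h3 := LinearEquiv.finrank_eq (ef.symm ≪≫ₗ eg)
    omega
  let E : (l → k) ≃ₗ[k] (l → k) := (Submodule.prodEquivOfIsCompl _ P hP).symm ≪≫ₗ
    LinearEquiv.prodCongr (ef.symm ≪≫ₗ eg) (LinearEquiv.ofFinrankEq P Q hPQ) ≪≫ₗ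
    Submodule.prodEquivOfIsCompl _ Q hQ
  have hE : ∀ v, E (f v) = g v := by
    intro v
    have h1 : (Submodule.prodEquivOfIsCompl _ P hP).symm (f v) = (ef v, 0) := by
      rw [LinearEquiv.symm_apply_eq]
      simp [ef]
    simp only [E, LinearEquiv.trans_apply, h1]
    simp [eg]
  refine ⟨LinearMap.toMatrix' E.toLinearMap, LinearMap.toMatrix' E.symm.toLinearMap, ?_, ?_⟩
  · rw [← LinearMap.toMatrix'_comp, ← LinearMap.toMatrix'_id]
    congr 1
    refine LinearMap.ext fun v => ?_
    simp
  · rw [← LinearMap.toMatrix'_toLin' A, ← LinearMap.toMatrix'_comp, ← LinearMap.toMatrix'_toLin' B]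
    congr 1
    exact LinearMap.ext hE

/-- The inclusion of a homogeneous piece. -/
def vincl (i : Fin n) (v : Fin (d i) → k) : Idx d → k :=
  fun j => if h : j.1 = i then v (Fin.cast (by rw [h]) j.2) else 0

theorem mulVec_vincl {l : Type*} (M : Matrix l (Idx d) k) (i : Fin n) (v : Fin (d i) → k) (r : l) :
    M.mulVec (vincl i v) r = ∑ a, M r ⟨i, a⟩ * v a := by
  rw [Matrix.mulVec, dotProduct, Fintype.sum_sigma, Finset.sum_eq_single i]
  · simp [vincl]
  · intro j _ hj
    exact Finset.sum_eq_zero fun a _ => by simp [vincl, hj]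
  · simp

theorem vpart_vincl (i : Fin n) (v : Fin (d i) → k) :
    vpart σ (σ.pos i) (vincl i v) = vincl i v := by
  ext j
  simp only [vpart, vincl]
  split_ifs with h h' h'
  · rfl
  · rfl
  · exact absurd (by rw [h']) h
  · rfl

theorem eq_zero_of_vincl {i : Fin n} {v : Fin (d i) → k} (h : vincl i v = 0) : v = 0 := by
  ext a
  have := congrFun h ⟨i, a⟩
  simpa [vincl] using this

theorem isUnit_det_of_mul_eq_one {m : Type*} [Fintype m] [DecidableEq m] {g h : Matrix m m k}
    (hgh : g * h = 1) : IsUnit g.det := by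
  rw [← Matrix.isUnit_iff_isUnit_det]
  exact IsUnit.of_mul_eq_one h hgh

theorem mulVec_injective_of_isUnit_det {m : Type*} [Fintype m] [DecidableEq m] {g : Matrix m m k}
    (hg : IsUnit g.det) : Function.Injective g.mulVec :=
  Matrix.mulVec_injective_iff_isUnit.2 ((Matrix.isUnit_iff_isUnit_det _).2 hg)

/-- Torsion-free modules of the same graded dimension are isomorphic: a chain of injective maps
between vector spaces is determined by the dimensions. -/
theorem IsTorsionFree.exists_iso {x y : Lam k d} (hx : IsTorsionFree σ x)
    (hy : IsTorsionFree σ y) : ∃ g ∈ homSpace x y, IsUnit g.det := by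
  -- an isomorphism of the parts in the first positions is extended by one position at a time
  have key : ∀ m : ℕ, ∃ g ∈ homogeneous k d d 0, IsUnit g.det ∧
      ∀ a b, σ.pos b.1 < σ.lo + m → (g * x.up σ) a b = (y.up σ * g) a b := by
    intro m
    induction m with
    | zero =>
      refine ⟨1, one_mem_homogeneous, by simp, fun a b hb => ?_⟩
      have := (hx.1 b).1
      simp only [Nat.cast_zero, add_zero] at hb
      omega
    | succ m ih =>
      obtain ⟨g, hg, hgu, hgm⟩ := ih
      have hg0 := hasDeg_zero_iff (σ := σ).2 hg
      have hdx : HasDeg σ 1 (g * x.up σ) := by simpa using hg0.mul (x.hasDeg_up σ)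
      have hdy : HasDeg σ 1 (y.up σ * g) := by simpa using (y.hasDeg_up σ).mul hg0
      by_cases hm : σ.lo + m < σ.hi
      · obtain ⟨i₀, hi₀⟩ := σ.exists_pos (p := σ.lo + m) (by omega) (by omega)
        obtain ⟨i, hi⟩ := σ.exists_pos (p := σ.lo + m + 1) (by omega) (by omega)
        -- both sides of the equation are injective in position `lo + m`
        have hinj : ∀ M : Matrix (Idx d) (Idx d) k, HasDeg σ 1 M →
            (∀ v : Fin (d i₀) → k, M.mulVec (vincl i₀ v) = 0 → vincl i₀ v = 0) →
            Function.Injective (M.submatrix (fun a : Fin (d i) => (⟨i, a⟩ : Idx d))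
              fun b : Fin (d i₀) => (⟨i₀, b⟩ : Idx d)).mulVec := by
          intro M hM hker v w hvw
          rw [← sub_eq_zero]
          apply eq_zero_of_vincl
          apply hker
          rw [← sub_eq_zero, ← Matrix.mulVec_sub] at hvw
          ext ⟨j, a⟩
          rw [mulVec_vincl]
          by_cases hj : j = i
          · subst hj
            exact congrFun hvw a
          · refine Finset.sum_eq_zero fun b _ => ?_
            rw [hM, zero_mul]
            simp only
            intro h
            apply hj
            apply σ.pos_injective
            omega
        have hA := hinj _ hdx (fun v hv => by
          rw [← Matrix.mulVec_mulVec] at hv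
          have h1 := mulVec_injective_of_isUnit_det hgu (hv.trans (Matrix.mulVec_zero _).symm)
          have h2 := hx.vpart_eq_zero 1 (p := σ.pos i₀) (by push_cast; omega) (v := vincl i₀ v)
            (by rw [vpart_vincl, pow_one]; exact h1)
          rwa [vpart_vincl] at h2)
        have hB := hinj _ hdy (fun v hv => by
          rw [← Matrix.mulVec_mulVec] at hv
          have h1 := mulVec_vpart hg0 (σ.pos i₀) (vincl i₀ v)
          rw [vpart_vincl, add_zero] at h1
          have h2 := hy.vpart_eq_zero 1 (p := σ.pos i₀) (by push_cast; omega)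
            (v := g.mulVec (vincl i₀ v)) (by rw [← h1, pow_one]; exact hv)
          rw [← h1] at h2
          exact mulVec_injective_of_isUnit_det hgu (h2.trans (Matrix.mulVec_zero _).symm))
        obtain ⟨h, h', hh, hAB⟩ := exists_mul_eq_of_injective hA hB
        -- the automorphism that is `h` in position `lo + m + 1` and the identity elsewhere
        let H : Matrix (Idx d) (Idx d) k := Matrix.blockDiagonal'
          (Function.update (fun j => (1 : Matrix (Fin (d j)) (Fin (d j)) k)) i h)
        let H' : Matrix (Idx d) (Idx d) k := Matrix.blockDiagonal'
          (Function.update (fun j => (1 : Matrix (Fin (d j)) (Fin (d j)) k)) i h')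
        have hHH : H * H' = 1 := by
          rw [← Matrix.blockDiagonal'_mul, ← Matrix.blockDiagonal'_one]
          congr 1
          funext j
          by_cases hj : j = i
          · subst hj
            simp [hh]
          · simp [Function.update_of_ne hj]
        have hHmul : ∀ (N : Matrix (Idx d) (Idx d) k) (j : Fin n) (a : Fin (d j)) (c : Idx d),
            (H * N) ⟨j, a⟩ c = ∑ b, Function.update
              (fun j => (1 : Matrix (Fin (d j)) (Fin (d j)) k)) i h j a b * N ⟨j, b⟩ c := by
          intro N j a c
          rw [Matrix.mul_apply, Fintype.sum_sigma, Finset.sum_eq_single j]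
          · simp only [H, Matrix.blockDiagonal'_apply_eq]
          · intro j' _ hj'
            refine Finset.sum_eq_zero fun b _ => ?_
            simp only [H]
            rw [Matrix.blockDiagonal'_apply_ne _ _ _ (Ne.symm hj'), zero_mul]
          · simp
        have hH1 : ∀ (N : Matrix (Idx d) (Idx d) k) (a c : Idx d), a.1 ≠ i →
            (H * N) a c = N a c := by
          rintro N ⟨j, a⟩ c hj
          rw [hHmul, Function.update_of_ne hj]
          simp [Matrix.one_apply]
        have hHu : IsUnit H.det := isUnit_det_of_mul_eq_one hHH
        refine ⟨H * g, mul_mem_homogeneous_zero (blockDiagonal'_mem _) hg, ?_, ?_⟩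
        · rw [Matrix.det_mul]
          exact hHu.mul hgu
        · intro a b hb
          push_cast at hb
          have hR : (y.up σ * (H * g)) a b = (y.up σ * g) a b := by
            rw [Matrix.mul_apply, Matrix.mul_apply]
            refine Finset.sum_congr rfl fun c _ => ?_
            by_cases hc : c.1 = i
            · have h0 : g c b = 0 := hg0 c b (by rw [hc]; omega)
              have h1 : (H * g) c b = 0 := by
                refine hasDeg_zero_iff (σ := σ).2
                  (mul_mem_homogeneous_zero (blockDiagonal'_mem _) hg) c b ?_
                rw [hc]
                omega
              rw [h0, h1]
            · rw [hH1 _ _ _ hc]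
          rw [hR, Matrix.mul_assoc]
          by_cases ha : a.1 = i
          · obtain ⟨j, a⟩ := a
            obtain rfl : j = i := ha
            by_cases hb' : b.1 = i₀
            · obtain ⟨j', b⟩ := b
              obtain rfl : j' = i₀ := hb'
              have h1 := congrFun (congrFun hAB a) b
              rw [Matrix.submatrix_apply] at h1
              rw [← h1, hHmul, Function.update_self, Matrix.mul_apply]
              rfl
            · have h1 : σ.pos j ≠ σ.pos b.1 + 1 := by
                intro h1
                apply hb'
                apply σ.pos_injective
                omega
              rw [hdy _ _ h1, hHmul]
              refine Finset.sum_eq_zero fun c _ => ?_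
              rw [hdx _ _ h1, mul_zero]
          · rw [hH1 _ _ _ ha]
            by_cases hb' : σ.pos b.1 < σ.lo + m
            · exact hgm a b hb'
            · have h1 : σ.pos a.1 ≠ σ.pos b.1 + 1 := by
                intro h1
                apply ha
                apply σ.pos_injective
                omega
              rw [hdy _ _ h1, hdx _ _ h1]
      · refine ⟨g, hg, hgu, fun a b hb => ?_⟩
        by_cases hb' : σ.pos b.1 < σ.lo + m
        · exact hgm a b hb'
        · have h1 : σ.pos a.1 ≠ σ.pos b.1 + 1 := by
            have := (hx.1 a).2
            omega
          rw [hdy _ _ h1, hdx _ _ h1]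
  obtain ⟨g, hg, hgu, hgm⟩ := key ((σ.hi - σ.lo).toNat + 1)
  refine ⟨g, (mem_homSpace_iff σ).2 ⟨hg, ?_, ?_⟩, hgu⟩
  · ext a b
    refine hgm a b ?_
    have := (hx.1 b).2
    push_cast
    omega
  · rw [hx.dn_eq_zero, hy.dn_eq_zero, Matrix.mul_zero, Matrix.zero_mul]

theorem Lam.up_act (x : Lam k d) (g : homogeneous k d d 0) (hg : g.1.det ≠ 0) :
    (x.act g hg).up σ = g.1 * x.up σ * g.1⁻¹ := by
  cases σ <;> rfl

theorem IsTorsionFree.act {x : Lam k d} (hx : IsTorsionFree σ x) (g : homogeneous k d d 0)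
    (hg : g.1.det ≠ 0) : IsTorsionFree σ (x.act g hg) := by
  have hu := isUnit_iff_ne_zero.2 hg
  refine hx.of_injective (F := g.1⁻¹) (mem_homogeneous_of_inverse g.2
    (Matrix.mul_nonsing_inv _ hu) (Matrix.nonsing_inv_mul _ hu)) ?_ ?_
  · rw [Lam.up_act, ← Matrix.mul_assoc, ← Matrix.mul_assoc, Matrix.nonsing_inv_mul _ hu,
      Matrix.one_mul]
  · exact mulVec_injective_of_isUnit_det (isUnit_det_of_mul_eq_one (Matrix.nonsing_inv_mul _ hu))

variable (σ) in
theorem regMap_up : RegMap (regLam k d) fun x : Lam k d => x.up σ := by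
  cases σ with
  | Z Δ => exact regMap_Tp
  | L Δ => exact regMap_Tm

variable (σ) in
theorem regMap_dn : RegMap (regLam k d) fun x : Lam k d => x.dn σ := by
  cases σ with
  | Z Δ => exact regMap_Tm
  | L Δ => exact regMap_Tp

/-- A regular family of matrices is injective on an open set. -/
theorem exists_open_injective {l m : Type*} [Fintype l] [DecidableEq l] [Fintype m]
    [DecidableEq m] {M : Lam k d → Matrix l m k} (hM : RegMap (regLam k d) M) {x₀ : Lam k d}
    (h : Function.Injective (M x₀).mulVec) :
    ∃ f ∈ regLam k d, f x₀ ≠ 0 ∧ ∀ x, f x ≠ 0 → Function.Injective (M x).mulVec := by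
  obtain ⟨L, hL⟩ := exists_left_inverse_of_injective h
  refine ⟨_, ((RegMap.const L).mul hM).det, by simp [hL], fun x hx => ?_⟩
  have := mulVec_injective_of_isUnit_det (isUnit_iff_ne_zero.2 hx)
  intro v w hvw
  apply this
  simp only [← Matrix.mulVec_mulVec, hvw]

variable (σ) in
theorem isOpen_isTorsionFree : IsOpen {x : Lam k d | IsTorsionFree σ x} := by
  refine isOpen_iff_forall_mem_open.2 fun x₀ hx₀ => ?_
  -- with the projection `P` to the last position, torsion-freeness is injectivity of one matrix
  let P : Matrix (Idx d) (Idx d) k := Matrix.diagonal fun j => if σ.pos j.1 < σ.hi then 0 else 1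
  have hP : ∀ v j, P.mulVec v j = if σ.pos j.1 < σ.hi then 0 else v j := by
    intro v j
    simp [P, Matrix.mulVec_diagonal]
  have hreg : RegMap (regLam k d) fun x : Lam k d => Matrix.fromRows (x.up σ) P := by
    rw [regMap_matrix_iff]
    rintro (i | i) j
    · exact regMap_matrix_iff.1 (regMap_up σ) i j
    · exact const_mem _ _
  obtain ⟨f, hf, hf0, hinj⟩ := exists_open_injective hreg (x₀ := x₀) (by
    have hz : ∀ v, (Matrix.fromRows (x₀.up σ) P).mulVec v = 0 → v = 0 := by
      intro v hv
      rw [Matrix.fromRows_mulVec] at hv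
      have h1 : (x₀.up σ).mulVec v = 0 := funext fun i => congrFun hv (Sum.inl i)
      have h2 : P.mulVec v = 0 := funext fun i => congrFun hv (Sum.inr i)
      ext j
      by_cases hj : σ.pos j.1 < σ.hi
      · exact hx₀.2 v h1 j hj
      · have := congrFun h2 j
        rwa [hP, if_neg hj] at this
    intro v w hvw
    rw [← sub_eq_zero]
    apply hz
    rw [Matrix.mulVec_sub, sub_eq_zero]
    exact hvw)
  refine ⟨{x | f x ≠ 0}, fun x hx => ⟨hx₀.1, fun v hv j hj => ?_⟩, isOpen_ne_zero hf, hf0⟩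
  have h1 : vpart σ (σ.pos j.1) v = 0 := by
    refine hinj x hx ?_
    rw [Matrix.mulVec_zero, Matrix.fromRows_mulVec]
    ext (i | i)
    · rw [Sum.elim_inl, mulVec_vpart (x.hasDeg_up σ), hv, vpart_zero]
      rfl
    · rw [Sum.elim_inr, hP]
      split_ifs with hi
      · rfl
      · simp only [vpart, Pi.zero_apply]
        exact if_neg (by omega)
  have h2 := congrFun h1 j
  simpa [vpart] using h2

theorem isIrreducible_isTorsionFree [Infinite k] {x₀ : Lam k d} (h : IsTorsionFree σ x₀) :
    IsIrreducible {x : Lam k d | IsTorsionFree σ x} := by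
  refine ⟨⟨x₀, h⟩, ?_⟩
  convert isPreirreducible_range_act x₀ using 1
  ext x
  constructor
  · intro hx
    obtain ⟨g, hg, hu⟩ := h.exists_iso hx
    exact ⟨⟨⟨g, hg.1⟩, hu.ne_zero⟩, (eq_act_of_iso hg hu).symm⟩
  · rintro ⟨w, rfl⟩
    exact h.act _ _

/-- A component of `Λ(d)` that contains a torsion-free module is the closure of the orbit of the
torsion-free modules. -/
theorem eq_closure_isTorsionFree [Infinite k] {Z : Set (Lam k d)}
    (hZ : Z ∈ irreducibleComponents (Lam k d)) {x : Lam k d} (hx : x ∈ Z)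
    (h : IsTorsionFree σ x) : Z = closure {x : Lam k d | IsTorsionFree σ x} := by
  have h1 : Z ⊆ closure {x : Lam k d | IsTorsionFree σ x} :=
    (subset_closure_inter hZ.1.2 (isOpen_isTorsionFree σ) ⟨x, hx, h⟩).trans
      (closure_mono Set.inter_subset_right)
  exact h1.antisymm (hZ.2 (isIrreducible_isTorsionFree h).closure h1)

theorem closure_isTorsionFree_mem [Infinite k] {x₀ : Lam k d} (h : IsTorsionFree σ x₀) :
    closure {x : Lam k d | IsTorsionFree σ x} ∈ irreducibleComponents (Lam k d) := by
  obtain ⟨Z, hZ, hsub⟩ := exists_mem_irreducibleComponents_subset_of_isIrreducible _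
    (isIrreducible_isTorsionFree h)
  rw [← eq_closure_isTorsionFree hZ (hsub h) h]
  exact hZ

end Orbit

/-! ### Rigid points of the basic component -/

section Basic

variable {n : ℕ} {k : Type*} [Field k] {d e : Fin n → ℕ} {σ : BasicRep n}

theorem isRigid_iff {x : Lam k d} : IsRigid x ↔ extCocycles x x ≤ extCoboundaries x x := by
  rw [IsRigid, extDim, Module.finrank_eq_zero_iff_of_free, Submodule.Quotient.subsingleton_iff]
  exact Submodule.submoduleOf_eq_top

variable (k σ) in
theorem basicComp_eq : basicComp k σ = ⟨σ.dim, closure {x | IsTorsionFree σ x}⟩ := by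
  have key : ∀ x : Lam k σ.dim,
      SameOrbit (x.up σ) ((jordanLam k σ).up σ) ↔ IsTorsionFree σ x := by
    intro x
    constructor
    · rintro ⟨g, hg, hu, hgx⟩
      refine isTorsionFree_jordanLam.of_injective hg hgx ?_
      exact Matrix.mulVec_injective_iff_isUnit.2 hu
    · intro hx
      obtain ⟨g, hg, hu⟩ := hx.exists_iso isTorsionFree_jordanLam
      exact ⟨g, hg.1, (Matrix.isUnit_iff_isUnit_det _).2 hu, ((mem_homSpace_iff σ).1 hg).2.1⟩
  have h2 : {x : Lam k σ.dim | IsTorsionFree σ x} =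
      {x | SameOrbit (x.up σ) ((jordanLam k σ).up σ)} := Set.ext fun x => (key x).symm
  rw [h2]
  cases σ <;> rfl

/-- If the second operator vanishes on `z`, then a matrix `B` of its degree that commutes with the
Jordan operator is a self-extension of `z`, and it is not a coboundary unless `B = 0`. -/
theorem eq_zero_of_isRigid_of_comm {z : Lam k d} (hz : z.dn σ = 0) {B : Matrix (Idx d) (Idx d) k}
    (hB : HasDeg σ (-1) B) (hc : B * z.up σ = z.up σ * B) (hr : IsRigid z) : B = 0 := by
  rw [isRigid_iff] at hr
  cases σ with
  | Z Δ =>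
    have hB' : B ∈ homogeneous k d d (-1) := fun a b h => hB a b (by
      simp only [BasicRep.pos, BasicRep.sgn]; omega)
    obtain ⟨F, -, hF⟩ := hr (show ((0, B) : _ × _) ∈ extCocycles z z from
      ⟨zero_mem _, hB', by
        simp only [Matrix.zero_mul, Matrix.mul_zero, add_zero, zero_add]
        exact hc.symm⟩)
    have h1 := congrArg Prod.snd hF
    change z.Tm * F - F * z.Tm = B at h1
    rw [← h1, show z.Tm = 0 from hz, Matrix.mul_zero, Matrix.zero_mul, sub_zero]
  | L Δ =>
    have hB' : B ∈ homogeneous k d d 1 := fun a b h => hB a b (by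
      simp only [BasicRep.pos, BasicRep.sgn]; omega)
    obtain ⟨F, -, hF⟩ := hr (show ((B, 0) : _ × _) ∈ extCocycles z z from
      ⟨hB', zero_mem _, by
        simp only [Matrix.zero_mul, Matrix.mul_zero, add_zero, zero_add]
        exact hc⟩)
    have h1 := congrArg Prod.fst hF
    change z.Tp * F - F * z.Tp = B at h1
    rw [← h1, show z.Tp = 0 from hz, Matrix.mul_zero, Matrix.zero_mul, sub_zero]

theorem dn_eq_zero_of_mem_closure {z : Lam k d}
    (hz : z ∈ closure {x : Lam k d | IsTorsionFree σ x}) : z.dn σ = 0 := by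
  ext a b
  by_contra h
  obtain ⟨y, hy, hy'⟩ := mem_closure_iff.1 hz _
    (isOpen_ne_zero (regMap_matrix_iff.1 (regMap_dn σ) a b)) h
  apply hy
  simp only [IsTorsionFree.dn_eq_zero hy']
  rfl

/-- A rigid point of the basic component is torsion-free, that is, isomorphic to the Jordan block:
if the Jordan operator vanishes between two adjacent positions, then the other operator can be
deformed there. -/
theorem isTorsionFree_of_isRigid {z : Lam k σ.dim}
    (hz : z ∈ closure {x : Lam k σ.dim | IsTorsionFree σ x}) (hr : IsRigid z) :
    IsTorsionFree σ z := by
  have hD := dn_eq_zero_of_mem_closure hz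
  refine ⟨σ.idx_mem, fun v hv j hj => ?_⟩
  by_contra hvj
  -- the column of `j` vanishes, so the elementary matrix from `j'` to `j` commutes with the Jordan
  -- operator
  obtain ⟨j', hj'⟩ := σ.exists_idx (p := σ.pos j.1 + 1) (by have := σ.idx_mem j; omega) (by omega)
  have hcol : ∀ a, z.up σ a j = 0 := by
    intro a
    by_cases ha : σ.pos a.1 = σ.pos j.1 + 1
    · have h1 := congrFun hv a
      rw [Matrix.mulVec, dotProduct, Finset.sum_eq_single j] at h1
      · exact (mul_eq_zero.1 h1).resolve_right hvj
      · intro b _ hb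
        rw [z.hasDeg_up σ a b, zero_mul]
        exact fun h => hb (σ.idx_ext (by omega))
      · simp
    · exact z.hasDeg_up σ a j ha
  have hB := eq_zero_of_isRigid_of_comm (B := Matrix.single j j' 1) hD ?_ ?_ hr
  · have := congrFun (congrFun hB j) j'
    simp at this
  · intro a b hab
    refine Matrix.single_apply_of_ne _ _ _ _ _ ?_
    rintro ⟨rfl, rfl⟩
    omega
  · ext a b
    have h1 : (z.up σ * (Matrix.single j j' 1 : Matrix (Idx σ.dim) (Idx σ.dim) k)) a b = 0 := by
      rw [Matrix.mul_apply]
      refine Finset.sum_eq_zero fun c _ => ?_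
      by_cases hc : j = c
      · subst hc
        rw [hcol, zero_mul]
      · rw [Matrix.single_apply_of_ne _ _ _ _ _ (fun h => hc h.1), mul_zero]
    rw [h1, Matrix.mul_apply]
    refine Finset.sum_eq_zero fun c _ => ?_
    by_cases hc : j = a ∧ j' = c
    · obtain ⟨rfl, rfl⟩ := hc
      by_cases hb : σ.pos b.1 = σ.pos j.1
      · rw [σ.idx_ext hb, hcol, mul_zero]
      · rw [z.hasDeg_up σ j' b (by omega), mul_zero]
    · rw [Matrix.single_apply_of_ne _ _ _ _ _ hc, zero_mul]

/-- Every deformation of a Jordan block is trivial: conjugation by a diagonal matrix whose entries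
are the partial sums of the entries of the deformation. -/
theorem exists_up_boundary {A : Matrix (Idx σ.dim) (Idx σ.dim) k} (hA : HasDeg σ 1 A) :
    ∃ F ∈ homogeneous k σ.dim σ.dim 0,
      (jordanLam k σ).up σ * F - F * (jordanLam k σ).up σ = A := by
  let f : Idx σ.dim → k := fun i => ∑ p, if σ.pos p.1 ≤ σ.pos i.1 then ∑ q, A p q else 0
  refine ⟨Matrix.diagonal fun i => -f i, ?_, ?_⟩
  · rw [← hasDeg_zero_iff (σ := σ)]
    intro a b h
    refine Matrix.diagonal_apply_ne _ ?_
    rintro rfl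
    simp at h
  · ext a b
    rw [Matrix.sub_apply, Matrix.mul_diagonal, Matrix.diagonal_mul, jordanLam_up]
    split_ifs with h
    · have h1 : f a = f b + A a b := by
        have h2 : ∑ q, A a q = A a b := by
          refine Finset.sum_eq_single b (fun q _ hq => hA a q fun h' => hq (σ.idx_ext ?_)) (by simp)
          omega
        have h3 : ∑ p, (if p = a then ∑ q, A p q else 0) = A a b := by
          rw [Finset.sum_ite_eq' Finset.univ a, if_pos (Finset.mem_univ a), h2]
        rw [← h3, ← Finset.sum_add_distrib]
        refine Finset.sum_congr rfl fun p _ => ?_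
        by_cases hp : p = a
        · subst hp
          rw [if_pos le_rfl, if_neg (by omega), if_pos rfl, zero_add]
        · have hne : σ.pos p.1 ≠ σ.pos a.1 := fun h' => hp (σ.idx_ext h')
          rw [if_neg hp, add_zero]
          exact if_congr (by omega) rfl rfl
      rw [h1]
      ring
    · rw [hA a b h]
      ring

theorem isRigid_jordanLam : IsRigid (jordanLam k σ) := by
  rw [isRigid_iff]
  rintro ⟨A, B⟩ ⟨hA, hB, hAB⟩
  simp only at hA hB hAB
  cases σ with
  | Z Δ =>
    have hD : (jordanLam k (.Z Δ)).Tm = 0 := rfl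
    rw [hD, Matrix.zero_mul, Matrix.mul_zero, add_zero, zero_add] at hAB
    have hB0 : B = 0 := isTorsionFree_jordanLam.eq_zero_of_comm (σ := .Z Δ)
      (fun a b h => hB a b (by simp only [BasicRep.pos, BasicRep.sgn] at h; omega)) hAB.symm
    obtain ⟨F, hF, hFA⟩ := exists_up_boundary (σ := .Z Δ) (A := A)
      (fun a b h => hA a b (by simp only [BasicRep.pos, BasicRep.sgn] at h; omega))
    refine ⟨F, hF, Prod.ext hFA ?_⟩
    change (jordanLam k (.Z Δ)).Tm * F - F * (jordanLam k (.Z Δ)).Tm = B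
    rw [hD, hB0, Matrix.zero_mul, Matrix.mul_zero, sub_zero]
  | L Δ =>
    have hD : (jordanLam k (.L Δ)).Tp = 0 := rfl
    rw [hD, Matrix.zero_mul, Matrix.mul_zero, add_zero, zero_add] at hAB
    have hA0 : A = 0 := isTorsionFree_jordanLam.eq_zero_of_comm (σ := .L Δ)
      (fun a b h => hA a b (by simp only [BasicRep.pos, BasicRep.sgn] at h; omega)) hAB
    obtain ⟨F, hF, hFA⟩ := exists_up_boundary (σ := .L Δ) (A := B)
      (fun a b h => hB a b (by simp only [BasicRep.pos, BasicRep.sgn] at h; omega))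
    refine ⟨F, hF, Prod.ext ?_ hFA⟩
    change (jordanLam k (.L Δ)).Tp * F - F * (jordanLam k (.L Δ)).Tp = A
    rw [hD, hA0, Matrix.zero_mul, Matrix.mul_zero, sub_zero]

/-- The torsion submodule of a saturated module has no homomorphisms to `z`, and so it is zero. -/
theorem isTorsionFree_of_isSaturatedModule {z : Lam k σ.dim} (hz : IsTorsionFree σ z)
    {x : Lam k d} (h : IsSaturatedModule z x) : IsTorsionFree σ x := by
  obtain ⟨d₁, d₂, x₁, x₂, hx, h₁, h₂⟩ := exists_torsion_sequence σ x
  obtain ⟨sp, hF, hG⟩ := exists_split_of_fitsInSES hx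
  have hd₂ : d₂ = 0 := by
    by_contra hne
    obtain ⟨F, hF, -, -, hinj, -⟩ := hx
    exact h d₂ x₂ hne ⟨F, hF, hinj⟩ (homSpace_eq_bot_of_torsion h₂ hz)
  subst hd₂
  have hFR : sp.F * sp.R = 0 := by
    ext a b
    rw [Matrix.mul_apply]
    exact Finset.sum_eq_zero fun c _ => Fin.elim0 c.2
  have hSG : sp.S * sp.G = 1 := by
    have := sp.add
    rwa [hFR, add_zero] at this
  refine h₁.of_injective hG.1 ((mem_homSpace_iff σ).1 hG).2.1 fun v w hvw => ?_
  have := congrArg sp.S.mulVec hvw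
  simpa [Matrix.mulVec_mulVec, hSG] using this

theorem IsTorsionFree.isSaturatedModule {x : Lam k d} (hx : IsTorsionFree σ x) :
    IsSaturatedModule (jordanLam k σ) x := by
  rintro d' x' hd' ⟨F, hF, hinj⟩ hbot
  obtain ⟨i, hi⟩ := Function.ne_iff.1 hd'
  let b : Idx d' := ⟨i, ⟨0, Nat.pos_of_ne_zero hi⟩⟩
  have h1 : F.mulVec (Pi.single b 1) ≠ 0 := by
    intro h
    have := congrFun (hinj (h.trans (Matrix.mulVec_zero _).symm)) b
    simp at this
  obtain ⟨φ, hφ, hne⟩ := hx.exists_hom h1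
  apply hne
  have h2 : φ * F = 0 := by
    have := homSpace_comp hφ hF
    rwa [hbot] at this
  rw [Matrix.mulVec_mulVec, h2, Matrix.zero_mulVec]

/-- A component is saturated exactly if it contains a torsion-free module. -/
theorem isSigmaSaturated_iff {Z : Set (Lam k d)} :
    IsSigmaSaturated σ ⟨d, Z⟩ ↔ ∃ x ∈ Z, IsTorsionFree σ x := by
  rw [IsSigmaSaturated, basicComp_eq]
  constructor
  · rintro ⟨z, hz, hr, x, hx, hs⟩
    exact ⟨x, hx, isTorsionFree_of_isSaturatedModule (isTorsionFree_of_isRigid hz hr) hs⟩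
  · rintro ⟨x, hx, h⟩
    exact ⟨jordanLam k σ, subset_closure isTorsionFree_jordanLam, isRigid_jordanLam, x, hx,
      h.isSaturatedModule⟩

/-- A component is reduced exactly if it contains a torsion module. -/
theorem isSigmaReduced_iff {Z : Set (Lam k d)} (hZ : Z.Nonempty) :
    IsSigmaReduced σ ⟨d, Z⟩ ↔ ∃ x ∈ Z, homDim x (jordanLam k σ) = 0 := by
  rw [IsSigmaReduced, compHom, basicComp_eq, Nat.sInf_eq_zero]
  constructor
  · rintro (⟨x, hx, y, hy, h0⟩ | h)
    · refine ⟨x, hx, ?_⟩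
      -- the torsion-free points are dense in the basic component
      obtain ⟨y', hy', h'⟩ := mem_closure_iff.1 hy _ (isOpen_homDim_right x 0)
        (show homDim x y ≤ 0 from h0.ge)
      obtain ⟨g, hg, hu⟩ := isTorsionFree_jordanLam (k := k).exists_iso h'
      rw [homDim_eq_zero_iff, eq_bot_iff]
      intro φ hφ
      have h1 : g * φ = 0 := by
        have h2 := homSpace_comp hg hφ
        rwa [homDim_eq_zero_iff.1 (Nat.le_zero.1 hy')] at h2
      rw [Submodule.mem_bot, ← Matrix.one_mul φ, ← Matrix.nonsing_inv_mul g hu, Matrix.mul_assoc,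
        h1, Matrix.mul_zero]
    · obtain ⟨x, hx⟩ := hZ
      exact absurd ⟨x, hx, jordanLam k σ, subset_closure isTorsionFree_jordanLam, rfl⟩
        (Set.eq_empty_iff_forall_notMem.1 h _)
  · rintro ⟨x, hx, h0⟩
    exact Or.inl ⟨x, hx, jordanLam k σ, subset_closure isTorsionFree_jordanLam, h0.symm⟩

end Basic

/-! ### Extensions of a torsion-free module by torsion modules -/

section Extensions

variable {n : ℕ} {k : Type*} [Field k] {d d₁ d₂ d₁' d₂' e : Fin n → ℕ} {σ : BasicRep n}

/-- The modules with an exact sequence `0 → x₂ → x → x₁ → 0`, where `x₁` is torsion-free of graded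
dimension `d₁` and `x₂` is a torsion module in `C₂`. -/
def torsionSet (σ : BasicRep n) (d d₁ : Fin n → ℕ) (C₂ : Set (Lam k d₂)) : Set (Lam k d) :=
  sesSet d fun (x₁ : Lam k d₁) x₂ =>
    IsTorsionFree σ x₁ ∧ x₂ ∈ C₂ ∧ homSpace x₂ (jordanLam k σ) = ⊥

/-- The torsion-free quotient can be any torsion-free module of the right graded dimension. -/
theorem exists_split_of_mem_torsionSet {C₂ : Set (Lam k d₂)} {x : Lam k d}
    (hx : x ∈ torsionSet σ d d₁ C₂) {z : Lam k d₁} (hz : IsTorsionFree σ z) :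
    ∃ x₂ ∈ C₂, homSpace x₂ (jordanLam k σ) = ⊥ ∧
      ∃ sp : Split k d₁ d₂ d, sp.F ∈ homSpace x₂ x ∧ sp.G ∈ homSpace x z := by
  obtain ⟨x₁, x₂, ⟨h₁, hx₂, h₂⟩, F, hF, G, hG, hinj, hex, hsurj⟩ := hx
  obtain ⟨g, hg, hu⟩ := h₁.exists_iso hz
  refine ⟨x₂, hx₂, h₂, exists_split_of_fitsInSES
    ⟨F, hF, g * G, homSpace_comp hg hG, hinj, fun v => ?_, fun v => ?_⟩⟩
  · rw [← hex v, ← Matrix.mulVec_mulVec]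
    exact ⟨fun h => mulVec_injective_of_isUnit_det hu (h.trans (Matrix.mulVec_zero g).symm),
      fun h => by rw [h, Matrix.mulVec_zero]⟩
  · obtain ⟨w, hw⟩ := hsurj (g⁻¹.mulVec v)
    exact ⟨w, by rw [← Matrix.mulVec_mulVec, hw, Matrix.mulVec_mulVec,
      Matrix.mul_nonsing_inv _ hu, Matrix.one_mulVec]⟩

/-- Homomorphisms to a torsion-free module factor through the torsion-free quotient. -/
theorem homDim_eq_of_split {x₂ : Lam k d₂} {x : Lam k d} {x₁ : Lam k d₁} {z : Lam k e}
    {sp : Split k d₁ d₂ d} (hF : sp.F ∈ homSpace x₂ x) (hG : sp.G ∈ homSpace x x₁)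
    (h₂ : homSpace x₂ z = ⊥) : homDim x z = homDim x₁ z := by
  have hSG : ∀ ψ ∈ homSpace x z, ψ * sp.S * sp.G = ψ := by
    intro ψ hψ
    have h1 : ψ * sp.F = 0 := by
      have := homSpace_comp hψ hF
      rwa [h₂] at this
    have h3 := congrArg (ψ * ·) sp.add
    simp only [Matrix.mul_add, ← Matrix.mul_assoc, h1, Matrix.zero_mul, add_zero,
      Matrix.mul_one] at h3
    exact h3
  refine LinearEquiv.finrank_eq
    { toFun := fun ψ => ⟨ψ.1 * sp.S, mul_mem_homogeneous_zero ψ.2.1 sp.S_mem, ?_, ?_⟩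
      invFun := fun φ => ⟨φ.1 * sp.G, homSpace_comp φ.2 hG⟩
      map_add' := fun a b => Subtype.ext (Matrix.add_mul _ _ _)
      map_smul' := fun c a => Subtype.ext (Matrix.smul_mul _ _ _)
      left_inv := fun ψ => Subtype.ext (hSG _ ψ.2)
      right_inv := fun φ => Subtype.ext (by
        change φ.1 * sp.G * sp.S = φ.1
        rw [Matrix.mul_assoc, sp.GS, Matrix.mul_one]) }
  · calc ψ.1 * sp.S * x₁.Tp = ψ.1 * sp.S * (x₁.Tp * sp.G * sp.S) := by
          rw [Matrix.mul_assoc x₁.Tp, sp.GS, Matrix.mul_one]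
      _ = ψ.1 * sp.S * sp.G * x.Tp * sp.S := by
          rw [← hG.2.1]; simp only [Matrix.mul_assoc]
      _ = z.Tp * (ψ.1 * sp.S) := by rw [hSG _ ψ.2, ψ.2.2.1, Matrix.mul_assoc]
  · calc ψ.1 * sp.S * x₁.Tm = ψ.1 * sp.S * (x₁.Tm * sp.G * sp.S) := by
          rw [Matrix.mul_assoc x₁.Tm, sp.GS, Matrix.mul_one]
      _ = ψ.1 * sp.S * sp.G * x.Tm * sp.S := by
          rw [← hG.2.2]; simp only [Matrix.mul_assoc]
      _ = z.Tm * (ψ.1 * sp.S) := by rw [hSG _ ψ.2, ψ.2.2.2, Matrix.mul_assoc]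

theorem homDim_eq_of_mem_torsionSet {C₂ : Set (Lam k d₂)} {x y : Lam k d}
    (hx : x ∈ torsionSet σ d d₁ C₂) (hy : y ∈ torsionSet σ d d₁ C₂) {z : Lam k e}
    (hz : IsTorsionFree σ z) : homDim x z = homDim y z := by
  obtain ⟨x₁, -, ⟨h₁, -⟩, -⟩ := id hx
  obtain ⟨x₂, -, h₂, sp, hF, hG⟩ := exists_split_of_mem_torsionSet hx h₁
  obtain ⟨y₂, -, h₂', sp', hF', hG'⟩ := exists_split_of_mem_torsionSet hy h₁
  rw [homDim_eq_of_split hF hG (homSpace_eq_bot_of_torsion h₂ hz),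
    homDim_eq_of_split hF' hG' (homSpace_eq_bot_of_torsion h₂' hz)]

/-- Two such sets with the same closure have the same constant dimension of the space of
homomorphisms to a torsion-free module, by semicontinuity. -/
theorem homDim_eq_of_closure_eq {C₂ : Set (Lam k d₂)} {C₂' : Set (Lam k d₂')}
    (h : closure (torsionSet σ d d₁ C₂) = closure (torsionSet σ d d₁' C₂')) {x y : Lam k d}
    (hx : x ∈ torsionSet σ d d₁ C₂) (hy : y ∈ torsionSet σ d d₁' C₂') {z : Lam k e}
    (hz : IsTorsionFree σ z) : homDim y z = homDim x z := by
  apply le_antisymm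
  · obtain ⟨w, hw, hw'⟩ := mem_closure_iff.1 (h ▸ subset_closure hx) _
      (isOpen_homDim_left z (homDim x z)) (le_refl (homDim x z))
    rw [homDim_eq_of_mem_torsionSet hy hw' hz]
    exact hw
  · obtain ⟨w, hw, hw'⟩ := mem_closure_iff.1 (h ▸ subset_closure hy) _
      (isOpen_homDim_left z (homDim y z)) (le_refl (homDim y z))
    rw [homDim_eq_of_mem_torsionSet hx hw' hz]
    exact hw

/-- The quotient map `x → x₁` extends to a regular family `s` of homomorphisms `y → x₁`, for the `y`
near `x` with `dim Hom(y, x₁) = dim Hom(x, x₁)`. The retraction `R` of the submodule completes it to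
an invertible matrix. -/
theorem exists_quotient_section {x : Lam k d} {x₁ : Lam k d₁} (sp : Split k d₁ d₂ d)
    (hG : sp.G ∈ homSpace x x₁) :
    ∃ (q : Lam k d → k) (hq : q ∈ regLam k d) (s : Lam k d → Matrix (Idx d₁) (Idx d) k)
      (g : {y // q y ≠ 0} → Matrix (Idx d) (Idx d) k), q x ≠ 0 ∧ s x = sp.G ∧
      RegMap (regLam k d) s ∧ RegMap (locAlg (regLam k d) q hq) g ∧
      (∀ y, q y ≠ 0 → homDim y x₁ = homDim x x₁ → s y ∈ homSpace y x₁) ∧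
      (∀ y : {y // q y ≠ 0}, g y * (sp.S * s y + sp.F * sp.R) = 1) ∧
      ∀ y : {y // q y ≠ 0}, (sp.S * s y + sp.F * sp.R) * g y = 1 := by
  obtain ⟨D, hD, hDx, -, h⟩ := exists_hom_section x x₁
  obtain ⟨s, hs, hsx, hsy⟩ := h sp.G hG
  let M : Lam k d → Matrix (Idx d) (Idx d) k := fun y => sp.S * s y + sp.F * sp.R
  have hM : RegMap (regLam k d) M := ((RegMap.const sp.S).mul hs).add (RegMap.const _)
  have hdet : ∀ y : {y // D y * (M y).det ≠ 0}, IsUnit (M y.1).det :=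
    fun y => isUnit_iff_ne_zero.2 (right_ne_zero_of_mul y.2)
  refine ⟨fun y => D y * (M y).det, mul_mem hD hM.det, s, fun y => (M y)⁻¹, ?_, hsx, hs, ?_,
    fun y hy => hsy y (left_ne_zero_of_mul hy), fun y => Matrix.nonsing_inv_mul _ (hdet y),
    fun y => Matrix.mul_nonsing_inv _ (hdet y)⟩
  · have : M x = 1 := by simp only [M, hsx, sp.add]
    simpa [this] using hDx
  · refine RegMap.inv (hM.restrict (mul_mem hD hM.det)) ?_
    have h1 : (fun y : {y // D y * (M y).det ≠ 0} => (M y).det⁻¹) =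
        (fun y : {y // D y * (M y).det ≠ 0} => D y) *
          fun y : {y // D y * (M y).det ≠ 0} => (D y * (M y).det)⁻¹ := by
      ext y
      have := left_ne_zero_of_mul y.2
      simp only [Pi.mul_apply, mul_inv]
      field_simp
    rw [h1]
    exact mul_mem (restrict_mem_locAlg _ hD) (inv_mem_locAlg _)

theorem eval_mem {X ι : Type*} {A : Subalgebra k (X → k)} {c : X → ι → k}
    (hc : ∀ i, (fun x => c x i) ∈ A) (p : MvPolynomial ι k) :
    (fun x => MvPolynomial.eval (c x) p) ∈ A := by
  induction p using MvPolynomial.induction_on with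
  | C a => simpa using const_mem A a
  | add p q hp hq =>
    simp only [map_add]
    exact add_mem hp hq
  | mul_X p i hp =>
    simp only [map_mul, MvPolynomial.eval_X]
    exact mul_mem hp (hc i)

/-- A homogeneous surjection `s : V → V₁` (as a part of an invertible matrix) that vanishes on the
second summand of a decomposition `V = V₁' ⊕ V₂'` factors through a surjection `V₁' → V₁`. -/
theorem le_of_quotient_section {sp : Split k d₁ d₂ d} {sp' : Split k d₁' d₂' d}
    {s : Matrix (Idx d₁) (Idx d) k} (hs : s ∈ homogeneous k d d₁ 0)
    {g : Matrix (Idx d) (Idx d) k} (hg : (sp.S * s + sp.F * sp.R) * g = 1)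
    (hsF : s * sp'.F = 0) : d₁ ≤ d₁' := by
  have h1 : s = sp.G * (sp.S * s + sp.F * sp.R) := by
    rw [Matrix.mul_add, ← Matrix.mul_assoc, ← Matrix.mul_assoc, sp.GS, sp.GF, Matrix.one_mul,
      Matrix.zero_mul, add_zero]
  have h2 : s * sp'.S * sp'.G = s := by
    have h3 := congrArg (s * ·) sp'.add
    simp only [Matrix.mul_add, ← Matrix.mul_assoc, hsF, Matrix.zero_mul, add_zero,
      Matrix.mul_one] at h3
    exact h3
  refine le_of_mul_eq_one (g := s * sp'.S) (h := sp'.G * (g * sp.S))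
    (mul_mem_homogeneous_zero hs sp'.S_mem) ?_
  rw [← Matrix.mul_assoc, h2, ← Matrix.mul_assoc, h1, Matrix.mul_assoc sp.G, hg, Matrix.mul_one,
    sp.GS]

/-- The graded dimension of the torsion-free quotient is determined by the closure. -/
theorem dim_le_of_closure_eq {C₂ : Set (Lam k d₂)} {C₂' : Set (Lam k d₂')}
    (h : closure (torsionSet σ d d₁ C₂) = closure (torsionSet σ d d₁' C₂'))
    (hne : (torsionSet σ d d₁ C₂).Nonempty) : d₁ ≤ d₁' := by
  obtain ⟨x, hx⟩ := hne
  obtain ⟨x₁, -, ⟨h₁, -⟩, -⟩ := id hx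
  obtain ⟨x₂, -, -, sp, hF, hG⟩ := exists_split_of_mem_torsionSet hx h₁
  obtain ⟨q, hq, s, g, hqx, -, -, -, hs, -, hg⟩ := exists_quotient_section sp hG
  obtain ⟨y, hqy, hy⟩ := mem_closure_iff.1 (h ▸ subset_closure hx) _ (isOpen_ne_zero hq) hqx
  obtain ⟨y₁, -, ⟨h₁', -⟩, -⟩ := id hy
  obtain ⟨y₂, -, h₂', sp', hF', hG'⟩ := exists_split_of_mem_torsionSet hy h₁'
  have hsy := hs y hqy (homDim_eq_of_closure_eq h hx hy h₁)
  refine le_of_quotient_section hsy.1 (hg ⟨y, hqy⟩) (sp' := sp') ?_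
  have := homSpace_comp hsy hF'
  rwa [homSpace_eq_bot_of_torsion h₂' h₁] at this

/-- If the family of extensions of torsion-free modules by the torsion modules in a component `C₂'`
is dense near an extension by the torsion module `x₂`, then `x₂` lies in `C₂'`: up to isomorphism,
the torsion submodule is the value at `x` of a regular family of modules, whose members near `x` lie
in `C₂'` on a dense set. -/
theorem torsion_mem_of_closure_eq [Infinite k] {C₂ C₂' : Set (Lam k d₂)}
    (hC₂' : C₂' ∈ irreducibleComponents (Lam k d₂))
    (h : closure (torsionSet σ d d₁ C₂) = closure (torsionSet σ d d₁ C₂'))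
    {x : Lam k d} {x₁ : Lam k d₁} {x₂ : Lam k d₂} (h₁ : IsTorsionFree σ x₁) (hx₂ : x₂ ∈ C₂)
    (h₂ : homSpace x₂ (jordanLam k σ) = ⊥) (sp : Split k d₁ d₂ d) (hF : sp.F ∈ homSpace x₂ x)
    (hG : sp.G ∈ homSpace x x₁) : x₂ ∈ C₂' := by
  have hx : x ∈ torsionSet σ d d₁ C₂ := ⟨x₁, x₂, ⟨h₁, hx₂, h₂⟩, fitsInSES_of_split hF hG⟩
  obtain ⟨q, hq, s, g, hqx, hsx, hsr, hgr, hs, hgl, hg⟩ := exists_quotient_section sp hG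
  let M : Lam k d → Matrix (Idx d) (Idx d) k := fun y => sp.S * s y + sp.F * sp.R
  have hM : RegMap (locAlg (regLam k d) q hq) fun y : {y // q y ≠ 0} => M y :=
    (((RegMap.const sp.S).mul hsr).add (RegMap.const (sp.F * sp.R))).restrict hq
  -- the operators of the family of submodules
  let c : {y // q y ≠ 0} → (Idx d₂ × Idx d₂) ⊕ (Idx d₂ × Idx d₂) → k := fun y =>
    Sum.elim (fun p => (sp.R * M y * y.1.Tp * g y * sp.F) p.1 p.2)
      fun p => (sp.R * M y * y.1.Tm * g y * sp.F) p.1 p.2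
  have hc : ∀ i, (fun y => c y i) ∈ locAlg (regLam k d) q hq := by
    have key : ∀ {T : Lam k d → Matrix (Idx d) (Idx d) k}, RegMap (regLam k d) T →
        RegMap (locAlg (regLam k d) q hq) fun y : {y // q y ≠ 0} =>
          sp.R * M y * T y * g y * sp.F := fun hT =>
      ((((RegMap.const sp.R).mul hM).mul (hT.restrict hq)).mul hgr).mul (RegMap.const sp.F)
    rintro (p | p)
    · exact regMap_matrix_iff.1 (key regMap_Tp) p.1 p.2
    · exact regMap_matrix_iff.1 (key regMap_Tm) p.1 p.2
  have hMx : M x = 1 := by simp only [M, hsx, sp.add]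
  have hcx : c ⟨x, hqx⟩ = x₂.coords := by
    have hgx : g ⟨x, hqx⟩ = 1 := by
      have := hgl ⟨x, hqx⟩
      rwa [show sp.S * s x + sp.F * sp.R = 1 from hMx, Matrix.mul_one] at this
    have key : ∀ {T : Matrix (Idx d) (Idx d) k} {T₂ : Matrix (Idx d₂) (Idx d₂) k},
        sp.F * T₂ = T * sp.F → sp.R * M x * T * g ⟨x, hqx⟩ * sp.F = T₂ := by
      intro T T₂ hT
      rw [hMx, hgx, Matrix.mul_one, Matrix.mul_one, Matrix.mul_assoc, ← hT, ← Matrix.mul_assoc,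
        sp.RF, Matrix.one_mul]
    simp only [c, key hF.2.1, key hF.2.2]
    rfl
  have hcy : ∀ y : {y // q y ≠ 0}, y.1 ∈ torsionSet σ d d₁ C₂' → ∃ z ∈ C₂', c y = z.coords := by
    intro y hy
    obtain ⟨y₂, hy₂, h₂', sp', hF', hG'⟩ := exists_split_of_mem_torsionSet hy h₁
    have hsy := hs y y.2 (homDim_eq_of_closure_eq h hx hy h₁)
    have hsF : s y * sp'.F = 0 := by
      have := homSpace_comp hsy hF'
      rwa [homSpace_eq_bot_of_torsion h₂' h₁] at this
    have hMF : M y * sp'.F = sp.F * (sp.R * sp'.F) := by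
      simp only [M, Matrix.add_mul, Matrix.mul_assoc, hsF, Matrix.mul_zero, zero_add]
    have hgF : g y * sp.F * (sp.R * sp'.F) = sp'.F := by
      rw [Matrix.mul_assoc, ← hMF, ← Matrix.mul_assoc, hgl, Matrix.one_mul]
    have hinv : sp'.R * (g y * sp.F) * (sp.R * sp'.F) = 1 := by
      rw [Matrix.mul_assoc, hgF, sp'.RF]
    have hu : IsUnit (sp.R * sp'.F).det :=
      isUnit_det_of_mul_eq_one (mul_eq_one_comm.1 hinv)
    have hm : sp.R * sp'.F ∈ homogeneous k d₂ d₂ 0 := mul_mem_homogeneous_zero sp.R_mem sp'.F_mem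
    let z := y₂.act ⟨_, hm⟩ hu.ne_zero
    refine ⟨z, mem_component_of_iso hC₂' hy₂ (act_mem_homSpace y₂ ⟨_, hm⟩ hu.ne_zero) hu, ?_⟩
    have key : ∀ {T : Matrix (Idx d) (Idx d) k} {T₂ : Matrix (Idx d₂) (Idx d₂) k},
        sp'.F * T₂ = T * sp'.F →
        sp.R * M y * T * g y * sp.F = sp.R * sp'.F * T₂ * (sp.R * sp'.F)⁻¹ := by
      intro T T₂ hT
      have h3 : sp.R * M y * T * g y * sp.F * (sp.R * sp'.F) = sp.R * sp'.F * T₂ := by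
        calc _ = sp.R * M y * T * (g y * sp.F * (sp.R * sp'.F)) := by
              simp only [Matrix.mul_assoc]
          _ = sp.R * (M y * sp'.F) * T₂ := by
              rw [hgF, Matrix.mul_assoc _ T, ← hT]; simp only [Matrix.mul_assoc]
          _ = _ := by rw [hMF, ← Matrix.mul_assoc sp.R, sp.RF, Matrix.one_mul]
      rw [← h3, Matrix.mul_assoc _ (sp.R * sp'.F), Matrix.mul_nonsing_inv _ hu, Matrix.mul_one]
    simp only [c, key hF'.2.1, key hF'.2.2]
    rfl
  obtain ⟨P, hP⟩ := (isClosed_lam_iff C₂').1 (isClosed_of_mem_irreducibleComponents _ hC₂')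
  rw [hP]
  intro p hp
  rw [← hcx]
  refine locAlg_eq_zero_of_mem_closure (eval_mem hc p) (S := torsionSet σ d d₁ C₂')
    (fun y hy => ?_) ⟨x, hqx⟩ (h ▸ subset_closure hx)
  obtain ⟨z, hz, hyz⟩ := hcy y hy
  rw [hyz]
  rw [hP] at hz
  exact hz p hp

end Extensions

/-! ### The decomposition of a component -/

section Decomposition

variable {n : ℕ} {k : Type*} [Field k] {d d₁ d₂ d₁' d₂' : Fin n → ℕ} {σ : BasicRep n}

theorem exists_mem_torsion {C₂ : Set (Lam k d₂)} (h₂ : C₂ ∈ irreducibleComponents (Lam k d₂))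
    (hr : IsSigmaReduced σ ⟨d₂, C₂⟩) : ∃ x ∈ C₂, homDim x (jordanLam k σ) ≤ 0 := by
  obtain ⟨x, hx, h0⟩ := (isSigmaReduced_iff h₂.1.1).1 hr
  exact ⟨x, hx, h0.le⟩

/-- For a saturated component `C₁` and a reduced component `C₂`, the minimality of `dim Ext¹` in the
definition of `C₁ * C₂` can be replaced by the condition that the quotient is torsion-free and the
submodule is torsion. -/
theorem star_eq_closure_torsionSet [Infinite k] {C₁ : Set (Lam k d₁)} {C₂ : Set (Lam k d₂)}
    (h₁ : C₁ ∈ irreducibleComponents (Lam k d₁)) (h₂ : C₂ ∈ irreducibleComponents (Lam k d₂))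
    (hs : IsSigmaSaturated σ ⟨d₁, C₁⟩) (hr : IsSigmaReduced σ ⟨d₂, C₂⟩) :
    (star ⟨d₁, C₁⟩ ⟨d₂, C₂⟩).2 = closure (torsionSet σ (d₁ + d₂) d₁ C₂) ∧
      IsIrreducible (star ⟨d₁, C₁⟩ ⟨d₂, C₂⟩).2 := by
  obtain ⟨x₁, hx₁, ht₁⟩ := isSigmaSaturated_iff.1 hs
  obtain ⟨x₂, hx₂, ht₂⟩ := exists_mem_torsion h₂ hr
  have key := star_eq_closure_sesSet h₁.1 h₂.1 (isOpen_isTorsionFree σ)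
    (isOpen_homDim_left (jordanLam k σ) 0) ⟨x₁, hx₁, ht₁⟩ ⟨x₂, hx₂, ht₂⟩ (fun y₁ hy₁ y₂ hy₂ =>
      homDim_eq_zero_iff.2 (homSpace_eq_bot_of_torsion
        (homDim_eq_zero_iff.1 (Nat.le_zero.1 hy₂.2)) hy₁.2))
  have h0 : ∀ y : Lam k d₂, homSpace y (jordanLam k σ) = ⊥ ↔ homDim y (jordanLam k σ) ≤ 0 :=
    fun y => by rw [Nat.le_zero, homDim_eq_zero_iff]
  have hset : torsionSet σ (d₁ + d₂) d₁ C₂ = sesSet (d₁ + d₂) fun (y₁ : Lam k d₁) y₂ =>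
      y₁ ∈ C₁ ∩ {x | IsTorsionFree σ x} ∧ y₂ ∈ C₂ ∩ {x | homDim x (jordanLam k σ) ≤ 0} := by
    refine congrArg (sesSet (d₁ + d₂)) (funext fun y₁ => funext fun y₂ => propext ?_)
    rw [eq_closure_isTorsionFree h₁ hx₁ ht₁]
    exact ⟨fun h => ⟨⟨subset_closure h.1, h.1⟩, h.2.1, (h0 y₂).1 h.2.2⟩,
      fun h => ⟨h.1.2, h.2.1, (h0 y₂).2 h.2.2⟩⟩
  rw [hset]
  exact key

/-- A component of `Λ(d)` lies in the closure of one of the finitely many sets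
`torsionSet σ d d₁ C₂` with a component `C₂`, because every module has a torsion submodule with a torsion-free quotient. -/
theorem exists_subset_closure_torsionSet (σ : BasicRep n) {Z : Set (Lam k d)}
    (hZ : Z ∈ irreducibleComponents (Lam k d)) :
    ∃ (d₁ d₂ : Fin n → ℕ) (C₂ : Set (Lam k d₂)), C₂ ∈ irreducibleComponents (Lam k d₂) ∧
      (torsionSet σ d d₁ C₂).Nonempty ∧ Z ⊆ closure (torsionSet σ d d₁ C₂) := by
  let 𝒮 : Set (Set (Lam k d)) := {W | ∃ d₁ ≤ d, ∃ d₂ ≤ d, ∃ C₂ ∈ irreducibleComponents (Lam k d₂),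
    closure (torsionSet σ d d₁ C₂) = W}
  have hfin : 𝒮.Finite := by
    have h1 : 𝒮 = ⋃ d₁ ∈ Set.Iic d, ⋃ d₂ ∈ Set.Iic d,
        (fun C₂ : Set (Lam k d₂) => closure (torsionSet σ d d₁ C₂)) ''
          irreducibleComponents (Lam k d₂) := by
      ext W
      simp only [𝒮, Set.mem_iUnion, Set.mem_image, Set.mem_Iic, Set.mem_ofPred_eq, exists_prop]
    rw [h1]
    refine (Set.finite_Iic d).biUnion fun d₁ _ => (Set.finite_Iic d).biUnion fun d₂ _ => ?_
    exact TopologicalSpace.NoetherianSpace.finite_irreducibleComponents.image _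
  have hcov : Z ⊆ ⋃₀ (hfin.toFinset : Set (Set (Lam k d))) := by
    intro x _
    obtain ⟨d₁, d₂, x₁, x₂, hx, h₁, h₂⟩ := exists_torsion_sequence σ x
    obtain ⟨sp, -, -⟩ := exists_split_of_fitsInSES hx
    have hd := sp.eq_add
    refine ⟨closure (torsionSet σ d d₁ (irreducibleComponent x₂)), ?_,
      subset_closure ⟨x₁, x₂, ⟨h₁, mem_irreducibleComponent, h₂⟩, hx⟩⟩
    rw [hfin.coe_toFinset]
    exact ⟨d₁, hd ▸ le_self_add, d₂, hd ▸ le_add_self, _,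
      irreducibleComponent_mem_irreducibleComponents x₂, rfl⟩
  obtain ⟨W, hW, hZW⟩ := isIrreducible_iff_sUnion_isClosed.1 hZ.1 hfin.toFinset (fun W hW => by
    obtain ⟨d₁, -, d₂, -, C₂, -, rfl⟩ := hfin.mem_toFinset.1 hW
    exact isClosed_closure) hcov
  obtain ⟨d₁, -, d₂, -, C₂, hC₂, rfl⟩ := hfin.mem_toFinset.1 hW
  exact ⟨d₁, d₂, C₂, hC₂, closure_nonempty_iff.1 (hZ.1.1.mono hZW), hZW⟩

theorem exists_decomposition [Infinite k] (σ : BasicRep n) {C : Piece k n} (hC : IsComp C) :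
    ∃ P₁ P₂ : Piece k n, IsComp P₁ ∧ IsComp P₂ ∧ IsSigmaSaturated σ P₁ ∧ IsSigmaReduced σ P₂ ∧
      C = star P₁ P₂ := by
  obtain ⟨d, Z⟩ := C
  obtain ⟨d₁, d₂, C₂, hC₂, ⟨x, x₁, x₂, ⟨h₁, hx₂, h₂⟩, hx⟩, hZ⟩ :=
    exists_subset_closure_torsionSet σ hC
  obtain ⟨sp, -, -⟩ := exists_split_of_fitsInSES hx
  obtain rfl := sp.eq_add
  have hC₁ := closure_isTorsionFree_mem h₁
  have hs : IsSigmaSaturated σ ⟨d₁, closure {x : Lam k d₁ | IsTorsionFree σ x}⟩ :=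
    isSigmaSaturated_iff.2 ⟨x₁, subset_closure h₁, h₁⟩
  have hr : IsSigmaReduced σ ⟨d₂, C₂⟩ :=
    (isSigmaReduced_iff hC₂.1.1).2 ⟨x₂, hx₂, homDim_eq_zero_iff.2 h₂⟩
  obtain ⟨h3, h4⟩ := star_eq_closure_torsionSet hC₁ hC₂ hs hr
  refine ⟨⟨d₁, _⟩, ⟨d₂, C₂⟩, hC₁, hC₂, hs, hr, Sigma.ext rfl (heq_of_eq ?_)⟩
  rw [← h3] at hZ
  exact hZ.antisymm (hC.2 h4 hZ)

theorem subset_of_closure_torsionSet_eq [Infinite k] {C₂ C₂' : Set (Lam k d₂)}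
    (hC₂ : C₂ ∈ irreducibleComponents (Lam k d₂)) (hC₂' : C₂' ∈ irreducibleComponents (Lam k d₂))
    (hr : IsSigmaReduced σ ⟨d₂, C₂⟩) {x₁ : Lam k d₁} (h₁ : IsTorsionFree σ x₁)
    (h : closure (torsionSet σ (d₁ + d₂) d₁ C₂) = closure (torsionSet σ (d₁ + d₂) d₁ C₂')) :
    C₂ ⊆ C₂' := by
  refine (subset_closure_inter hC₂.1.2 (isOpen_homDim_left (jordanLam k σ) 0)
    (exists_mem_torsion hC₂ hr)).trans
    (closure_minimal ?_ (isClosed_of_mem_irreducibleComponents _ hC₂'))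
  rintro x₂ ⟨hx₂, h₂⟩
  obtain ⟨sp⟩ := exists_split k d₁ d₂
  -- the direct sum of `x₁` and `x₂`
  have h0 := sp.fitsInSES_ext x₁ x₂ 0 (zero_mem _)
  obtain ⟨sp', hF, hG⟩ := exists_split_of_fitsInSES h0
  exact torsion_mem_of_closure_eq hC₂' h h₁ hx₂ (homDim_eq_zero_iff.1 (Nat.le_zero.1 h₂)) sp' hF hG

theorem decomposition_unique [Infinite k] {P₁ P₂ Q₁ Q₂ : Piece k n} (hP₁ : IsComp P₁)
    (hP₂ : IsComp P₂) (hQ₁ : IsComp Q₁) (hQ₂ : IsComp Q₂)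
    (sP : IsSigmaSaturated σ P₁) (rP : IsSigmaReduced σ P₂)
    (sQ : IsSigmaSaturated σ Q₁) (rQ : IsSigmaReduced σ Q₂) (h : star P₁ P₂ = star Q₁ Q₂) :
    P₁ = Q₁ ∧ P₂ = Q₂ := by
  obtain ⟨d₁, C₁⟩ := P₁
  obtain ⟨d₂, C₂⟩ := P₂
  obtain ⟨d₁', C₁'⟩ := Q₁
  obtain ⟨d₂', C₂'⟩ := Q₂
  have hd : d₁ + d₂ = d₁' + d₂' := congrArg Sigma.fst h
  obtain ⟨eP, iP⟩ := star_eq_closure_torsionSet hP₁ hP₂ sP rP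
  obtain ⟨eQ, iQ⟩ := star_eq_closure_torsionSet hQ₁ hQ₂ sQ rQ
  have hcl : closure (torsionSet σ (d₁ + d₂) d₁ C₂) = closure (torsionSet σ (d₁ + d₂) d₁' C₂') := by
    have h1 : HEq (closure (torsionSet σ (d₁ + d₂) d₁ C₂))
        (closure (torsionSet σ (d₁' + d₂') d₁' C₂')) :=
      (heq_of_eq eP.symm).trans ((Sigma.ext_iff.1 h).2.trans (heq_of_eq eQ))
    rw [hd] at h1 ⊢
    exact eq_of_heq h1
  have nP : (torsionSet σ (d₁ + d₂) d₁ C₂).Nonempty := closure_nonempty_iff.1 (eP ▸ iP.1)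
  have nQ : (torsionSet σ (d₁ + d₂) d₁' C₂').Nonempty := by
    rw [← closure_nonempty_iff, ← hcl, closure_nonempty_iff]
    exact nP
  obtain rfl : d₁ = d₁' :=
    (dim_le_of_closure_eq hcl nP).antisymm (dim_le_of_closure_eq hcl.symm nQ)
  obtain rfl : d₂ = d₂' := add_left_cancel hd
  obtain ⟨x₁, hx₁, h₁⟩ := isSigmaSaturated_iff.1 sP
  obtain ⟨y₁, hy₁, h₁'⟩ := isSigmaSaturated_iff.1 sQ
  refine ⟨Sigma.ext rfl (heq_of_eq ?_), Sigma.ext rfl (heq_of_eq ?_)⟩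
  · exact (eq_closure_isTorsionFree hP₁ hx₁ h₁).trans
      (eq_closure_isTorsionFree hQ₁ hy₁ h₁').symm
  · exact (subset_of_closure_torsionSet_eq hP₂ hQ₂ rP h₁ hcl).antisymm
      (subset_of_closure_torsionSet_eq hQ₂ hP₂ rQ h₁ hcl.symm)

end Decomposition

end TypeA

theorem mainTheorem6 {k : Type*} [Field k] [IsAlgClosed k] {n : ℕ} (σ : TypeA.BasicRep n)
    (C : TypeA.Piece k n) (hC : TypeA.IsComp C) :
    ∃! P : TypeA.Piece k n × TypeA.Piece k n,
      TypeA.IsComp P.1 ∧ TypeA.IsComp P.2 ∧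
      TypeA.IsSigmaSaturated σ P.1 ∧ TypeA.IsSigmaReduced σ P.2 ∧
      C = TypeA.star P.1 P.2 := by
  have : Infinite k := IsAlgClosed.instInfinite
  obtain ⟨P₁, P₂, h₁, h₂, hs, hr, rfl⟩ := TypeA.exists_decomposition σ hC
  refine ⟨(P₁, P₂), ⟨h₁, h₂, hs, hr, rfl⟩, ?_⟩
  rintro ⟨Q₁, Q₂⟩ ⟨h₁', h₂', hs', hr', h⟩
  obtain ⟨rfl, rfl⟩ := TypeA.decomposition_unique h₁ h₂ h₁' h₂' hs hr hs' hr' h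
  rfl
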